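/- **Theorem 1.1.** Let $I=(-1,1)$, let $F:\mathbb R^n\to\mathbb R^n$ be smooth, $A=\nabla_UF$, and let $\bar U\in\mathbb R^n$ be a constant vector. Assume that on some open neighbourhood $N$ of $\bar U$ there are smooth functions $\lambda_1\le\dots\le\lambda_n$ and smooth vector fields $r_1,\dots,r_n$, linearly independent at each point of $N$, with $A r_i=\lambda_i r_i$ for $1\le i\le n$. Let $T=(r_1,\dots,r_n)$ be the matrix with columns $r_i$, and for a vector $V$ with $\bar U+V\in N$ let $f=T(\bar U+V)^{-1}V$ be its characteristic unknowns. Assume the non-characteristic condition $\min_{1\le i\le n}|\lambda_i(\bar U)|\neq0$, and let $\gamma=\{-1,1\}$ and $\gamma_-^i=\{x\in\gamma:\lambda_i(\bar U)\,x<0\}$. Then there exist constants $\varepsilon_0>0$ and $C>0$ (depending only on the system, $\bar U$ and the diagonalization) such that the following holds. Let $V_0\in W^{1,\infty}(I;\mathbb R^n)$ and $b\in W^{1,\infty}(\mathbb R_+;\mathbb R^n)$ (identified with their continuous representatives on $[-1,1]$ and $[0,\infty)$) satisfy $$\|V_0\|_{W^{1,\infty}(I)}+\|b\|_{W^{1,\infty}(\mathbb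 R_+)}\le\varepsilon_0$$ and the compatibility condition $f_{0,i}|_{\gamma_-^i}=b_i(0)$, $1\le i\le n$, where $f_0=T(\bar U+V_0)^{-1}V_0$. Then the problem $$\partial_tV+A(\bar U+V)\partial_xV=0\ \text{ in }(0,\infty)\times I,\qquad V|_{t=0}=V_0,\qquad f_i|_{\gamma_-^i}=b_i\quad(1\le i\le n)$$ has a unique solution $V\in W^{1,\infty}((0,\infty)\times I;\mathbb R^n)$ (identified with its continuous representative on $[0,\infty)\times[-1,1]$) with $\bar U+V\in N$, the equation holding almost everywhere, and it satisfies $$\sup_{0\le t<\infty}\Big(\|V(t)\|_{W^{1,\infty}(I)}+\|\partial_tV(t)\|_{L^\infty(I)}\Big)+\|V|_\gamma\|_{W^{1,\infty}(\mathbb R_+)}\le C\Big(\|V_0\|_{W^{1,\infty}(I)}+\|b\|_{W^{1,\infty}(\mathbb R_+)}\Big).$$ Here, for each $t\ge 0$, $\partial_tV(t)$ is the derivative at $t$ (one-sided at $t=0$) of $s\mapsto V(s)$ as a map from $[0,\infty)$ to the distributions on $I$; it exists at every $t\ge0$ and belongs to $L^\infty(I)$. -/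

import Mathlib

open MeasureTheory Set Topology
open scoped ENNReal ContDiff

noncomputable section

/-- The open interval `I = (-1,1)`. -/
def spaceInterval : Set ℝ := Ioo (-1) 1

/-- The open space-time domain `(0,∞) × I`. -/
def spaceTime : Set (ℝ × ℝ) := Ioi 0 ×ˢ spaceInterval

/-- Real-valued test functions: smooth with compact support contained in `Ω`. -/
def IsTestFunction {H : Type*} [NormedAddCommGroup H] [NormedSpace ℝ H]
    (Ω : Set H) (φ : H → ℝ) : Prop :=
  ContDiff ℝ ∞ φ ∧ HasCompactSupport φ ∧ tsupport φ ⊆ Ω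

/-- `g` is the weak derivative of `u` in the direction `v` on the open set `Ω`. -/
def IsWeakDeriv {H E : Type*} [NormedAddCommGroup H] [NormedSpace ℝ H] [MeasureSpace H]
    [NormedAddCommGroup E] [NormedSpace ℝ E] (Ω : Set H) (v : H) (u g : H → E) : Prop :=
  LocallyIntegrableOn u Ω ∧ LocallyIntegrableOn g Ω ∧
    ∀ φ : H → ℝ, IsTestFunction Ω φ →
      ∫ y in Ω, fderiv ℝ φ y v • u y = - ∫ y in Ω, φ y • g y

/-- The `L^∞(Ω)` norm (essential supremum), as an extended nonnegative number. -/
def LinfNorm {H E : Type*} [MeasureSpace H] [NormedAddCommGroup E]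
    (Ω : Set H) (u : H → E) : ℝ≥0∞ :=
  eLpNorm u ∞ (volume.restrict Ω)

/-- The `W^{1,∞}(J)` norm on an open interval `J`: the `L^∞` norm of `u` plus that of its weak
derivative. The weak derivative is unique almost everywhere, so the infimum is its norm; when
there is no weak derivative the infimum is `∞`. Thus `u ∈ W^{1,∞}(J)` iff the value is finite. -/
def W1infNorm {E : Type*} [NormedAddCommGroup E] [NormedSpace ℝ E]
    (J : Set ℝ) (u : ℝ → E) : ℝ≥0∞ :=
  LinfNorm J u + ⨅ (g : ℝ → E) (_ : IsWeakDeriv J 1 u g), LinfNorm J g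

/-- `g = ∂_t V(t)` at the given time `t ≥ 0`: the map `s ↦ V(s)` from `[0,∞)` to distributions
on `I` is differentiable at `t` (from the right if `t = 0`), and its derivative is `g`. -/
def IsTimeDerivAt {E : Type*} [NormedAddCommGroup E] [NormedSpace ℝ E]
    (V : ℝ → ℝ → E) (t : ℝ) (g : ℝ → E) : Prop :=
  LocallyIntegrableOn g spaceInterval ∧
    ∀ φ : ℝ → ℝ, IsTestFunction spaceInterval φ →
      HasDerivWithinAt (fun s => ∫ x in spaceInterval, φ x • V s x)
        (∫ x in spaceInterval, φ x • g x) (Ici 0) t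

/-- `‖∂_t V(t)‖_{L^∞(I)}` at the given time `t`; it is `∞` when `∂_t V(t)` does not exist.
As above, `∂_t V(t)` is unique almost everywhere in `I`. -/
def timeDerivNorm {E : Type*} [NormedAddCommGroup E] [NormedSpace ℝ E]
    (V : ℝ → ℝ → E) (t : ℝ) : ℝ≥0∞ :=
  ⨅ (g : ℝ → E) (_ : IsTimeDerivAt V t g), LinfNorm spaceInterval g

/-- `sup_{t ≥ 0} (‖V(t)‖_{W^{1,∞}(I)} + ‖∂_t V(t)‖_{L^∞(I)})
plus the `W^{1,∞}(ℝ₊)` norm of the boundary trace of `V` on `{-1,1}`. -/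
def solutionNorm {E : Type*} [NormedAddCommGroup E] [NormedSpace ℝ E]
    (V : ℝ → ℝ → E) : ℝ≥0∞ :=
  (⨆ t ∈ Ici (0 : ℝ), (W1infNorm spaceInterval (V t) + timeDerivNorm V t)) +
    (W1infNorm (Ioi 0) (fun t => V t (-1)) + W1infNorm (Ioi 0) (fun t => V t 1))

/-- The structural assumption on `A = ∇F` near the constant state `Ubar`: on an open neighbourhood
`N` of `Ubar` there are smooth ordered eigenvalues `lam i` and smooth linearly independent
eigenvectors `r i`. -/
structure SmoothlyDiagonalizable {n : ℕ} (F : (Fin n → ℝ) → (Fin n → ℝ)) (Ubar : Fin n → ℝ)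
    (N : Set (Fin n → ℝ)) (lam : Fin n → (Fin n → ℝ) → ℝ)
    (r : Fin n → (Fin n → ℝ) → (Fin n → ℝ)) : Prop where
  isOpen : IsOpen N
  mem : Ubar ∈ N
  smooth_lam : ∀ i, ContDiffOn ℝ ∞ (lam i) N
  smooth_r : ∀ i, ContDiffOn ℝ ∞ (r i) N
  ordered : ∀ U ∈ N, ∀ i j, i ≤ j → lam i U ≤ lam j U
  eigen : ∀ U ∈ N, ∀ i, fderiv ℝ F U (r i U) = lam i U • r i U
  linearIndependent : ∀ U ∈ N, LinearIndependent ℝ (fun i => r i U)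

/-- The matrix `T(U)` whose `i`-th column is the eigenvector `r i U`. -/
def eigenMatrix {n : ℕ} (r : Fin n → (Fin n → ℝ) → (Fin n → ℝ)) (U : Fin n → ℝ) :
    Matrix (Fin n) (Fin n) ℝ :=
  Matrix.of fun j i => r i U j

/-- The characteristic unknowns `f = T(Ubar + v)⁻¹ v`. -/
def charUnknown {n : ℕ} (r : Fin n → (Fin n → ℝ) → (Fin n → ℝ)) (Ubar v : Fin n → ℝ) :
    Fin n → ℝ :=
  Matrix.mulVec (eigenMatrix r (Ubar + v))⁻¹ v

/-- The incoming set of the family with speed `l` at the constant state: the boundary points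
`x ∈ {-1,1}` (where the outward normal is `x`) such that `l x < 0`. -/
def incomingSet (l : ℝ) : Set ℝ := {x | (x = -1 ∨ x = 1) ∧ l * x < 0}

/-- `V` is a global `W^{1,∞}` solution of `∂_t V + A(Ubar + V) ∂_x V = 0` on `(0,∞) × I`, with
`A = ∇F`, initial value `V0` and inflow data `f_i = b_i` on the incoming set of the `i`-th family.
The function `V` is the continuous representative on `[0,∞) × [-1,1]`, so that the initial and
boundary traces are its values; `Ubar + V` takes values in the set `N` on which the
diagonalization, hence `f`, is defined. -/
structure IsSolution {n : ℕ} (F : (Fin n → ℝ) → (Fin n → ℝ)) (Ubar : Fin n → ℝ)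
    (N : Set (Fin n → ℝ)) (lam : Fin n → (Fin n → ℝ) → ℝ)
    (r : Fin n → (Fin n → ℝ) → (Fin n → ℝ)) (V0 : ℝ → Fin n → ℝ) (b : ℝ → Fin n → ℝ)
    (V : ℝ → ℝ → Fin n → ℝ) : Prop where
  continuousOn : ContinuousOn (fun p : ℝ × ℝ => V p.1 p.2) (Ici 0 ×ˢ Icc (-1) 1)
  mem_nhd : ∀ t, 0 ≤ t → ∀ x ∈ Icc (-1 : ℝ) 1, Ubar + V t x ∈ N
  bounded : LinfNorm spaceTime (fun p : ℝ × ℝ => V p.1 p.2) < ⊤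
  equation : ∃ Vt Vx : ℝ × ℝ → Fin n → ℝ,
    IsWeakDeriv spaceTime (1, 0) (fun p : ℝ × ℝ => V p.1 p.2) Vt ∧
    IsWeakDeriv spaceTime (0, 1) (fun p : ℝ × ℝ => V p.1 p.2) Vx ∧
    LinfNorm spaceTime Vt < ⊤ ∧ LinfNorm spaceTime Vx < ⊤ ∧
    ∀ᵐ p ∂(volume.restrict spaceTime), Vt p + fderiv ℝ F (Ubar + V p.1 p.2) (Vx p) = 0
  initial : ∀ x ∈ Icc (-1 : ℝ) 1, V 0 x = V0 x
  inflow : ∀ t, 0 ≤ t → ∀ i, ∀ x ∈ incomingSet (lam i Ubar), charUnknown r Ubar (V t x) i = b t i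

end

/-! In characteristic components the system is a set of scalar transport equations with speeds
bounded away from zero, coupled through terms quadratic in the solution and its derivatives. Every
characteristic leaves `I` in bounded time, so each family carries small inflow data across the
interval once, and small quadratic interactions cannot accumulate. This is made quantitative by a
weight between 2 and 4 that grows along the direction of propagation: transport then gives a damping
proportional to the speed, and the damping absorbs the quadratic errors uniformly in time.

Existence comes from an explicit upwind scheme. Its step is a convex combination of values at a
point and at its upwind neighbour, so the weighted maximum principle `abs_le_of_convex_step`
propagates bounds on the characteristic unknowns and on their time differences
(`UpwindSolution.bounds`). Space differences need no estimate of their own: the non-characteristic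
condition recovers them from time differences (`norm_space_sub_le`). The resulting uniform Lipschitz
bounds give a locally uniform limit (`exists_limit_of_asymptotically_lipschitz`). Summing the scheme
over small blocks shows that the limit solves the system wherever it is differentiable
(`abs_transport_le_of_close`), and by Rademacher's theorem this is almost everywhere
(`isWeakDeriv_lineDeriv`).

Uniqueness holds among all `W^{1,∞}` solutions. Mollification turns two solutions into
differentiable functions that almost solve the system on a slightly smaller rectangle
(`IsSolution.exists_isSmoothApprox`). At a maximum of the exponentially weighted difference one
looks back along the characteristic of the largest component, or uses the common data on the edge
where that component enters (`norm_sub_le_of_isSmoothApprox`). A first-exit-time argument removes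
the smallness assumption on the competitor (`eq_of_isSolution`).

The time derivative exists at every time, not only almost everywhere, because the system is a
conservation law: the distribution `-∂ₓ F(Ubar + V(t))` depends continuously on `t`
(`isTimeDerivAt`). -/

noncomputable section

/-! ### Uniform diagonalization near the constant state -/

/-- A diagonalization of `A = ∇F` near the constant state with uniform bounds on a closed ball:
`L v` is the inverse of the eigenvector matrix `R v` at `Ubar + v`, and `sg i` is the sign of
the `i`-th speed. -/
structure CharSystem {n : ℕ} (F : (Fin n → ℝ) → (Fin n → ℝ)) (Ubar : Fin n → ℝ)
    (N : Set (Fin n → ℝ)) (lam : Fin n → (Fin n → ℝ) → ℝ)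
    (r : Fin n → (Fin n → ℝ) → (Fin n → ℝ)) where
  L : (Fin n → ℝ) → (Fin n → ℝ) →L[ℝ] (Fin n → ℝ)
  R : (Fin n → ℝ) → (Fin n → ℝ) →L[ℝ] (Fin n → ℝ)
  sg : Fin n → ℤ
  ρ : ℝ
  K : ℝ
  c : ℝ
  sg_cases : ∀ i, sg i = 1 ∨ sg i = -1
  ρ_pos : 0 < ρ
  one_le_K : 1 ≤ K
  c_pos : 0 < c
  mem_N : ∀ v, ‖v‖ ≤ ρ → Ubar + v ∈ N
  L_R : ∀ v, ‖v‖ ≤ ρ → ∀ y, L v (R v y) = y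
  norm_L : ∀ v, ‖v‖ ≤ ρ → ‖L v‖ ≤ K
  norm_le : ∀ v, ‖v‖ ≤ ρ → ∀ w, ‖w‖ ≤ K * ‖L v w‖
  lip_L : ∀ v v', ‖v‖ ≤ ρ → ‖v'‖ ≤ ρ → ‖L v - L v'‖ ≤ K * ‖v - v'‖
  diff_L : ∀ v, ‖v‖ ≤ ρ → DifferentiableAt ℝ L v
  eigen : ∀ v, ‖v‖ ≤ ρ → ∀ w i, L v (fderiv ℝ F (Ubar + v) w) i = lam i (Ubar + v) * L v w i
  le_speed : ∀ v, ‖v‖ ≤ ρ → ∀ i, c ≤ sg i * lam i (Ubar + v)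
  speed_le : ∀ v, ‖v‖ ≤ ρ → ∀ i, sg i * lam i (Ubar + v) ≤ K
  lip_lam : ∀ v v', ‖v‖ ≤ ρ → ‖v'‖ ≤ ρ → ∀ i,
    |lam i (Ubar + v) - lam i (Ubar + v')| ≤ K * ‖v - v'‖
  norm_A : ∀ v, ‖v‖ ≤ ρ → ‖fderiv ℝ F (Ubar + v)‖ ≤ K
  lip_A : ∀ v v', ‖v‖ ≤ ρ → ‖v'‖ ≤ ρ →
    ‖fderiv ℝ F (Ubar + v) - fderiv ℝ F (Ubar + v')‖ ≤ K * ‖v - v'‖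
  charUnknown_eq : ∀ v, ‖v‖ ≤ ρ → charUnknown r Ubar v = L v v
  incoming : ∀ i x, x ∈ incomingSet (lam i Ubar) ↔ x = -(sg i : ℝ)

/-- The linear map whose matrix has the eigenvectors as columns. -/
def eigenMap {n : ℕ} (r : Fin n → (Fin n → ℝ) → (Fin n → ℝ)) (U : Fin n → ℝ) :
    (Fin n → ℝ) →L[ℝ] (Fin n → ℝ) :=
  ∑ i, (ContinuousLinearMap.proj i : (Fin n → ℝ) →L[ℝ] ℝ).smulRight (r i U)

theorem eigenMap_apply {n : ℕ} (r : Fin n → (Fin n → ℝ) → (Fin n → ℝ)) (U y : Fin n → ℝ) :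
    eigenMap r U y = ∑ i, y i • r i U := by
  simp [eigenMap]

theorem eigenMap_eq_mulVec {n : ℕ} (r : Fin n → (Fin n → ℝ) → (Fin n → ℝ)) (U y : Fin n → ℝ) :
    eigenMap r U y = (eigenMatrix r U).mulVec y := by
  ext j
  simp [eigenMap_apply, eigenMatrix, Matrix.mulVec, dotProduct, mul_comm]

theorem isUnit_eigenMatrix {n : ℕ} {r : Fin n → (Fin n → ℝ) → (Fin n → ℝ)} {U : Fin n → ℝ}
    (h : LinearIndependent ℝ (fun i => r i U)) : IsUnit (eigenMatrix r U) := by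
  rw [← Matrix.linearIndependent_cols_iff_isUnit]
  exact h

/-- The eigenvector map as a continuous linear equivalence. -/
def eigenEquiv {n : ℕ} {r : Fin n → (Fin n → ℝ) → (Fin n → ℝ)} {U : Fin n → ℝ}
    (h : LinearIndependent ℝ (fun i => r i U)) : (Fin n → ℝ) ≃L[ℝ] (Fin n → ℝ) :=
  ContinuousLinearEquiv.equivOfInverse (eigenMap r U)
    (Matrix.mulVecLin (eigenMatrix r U)⁻¹).toContinuousLinearMap
    (fun x => by
      have := isUnit_eigenMatrix h
      simp [eigenMap_eq_mulVec, Matrix.mulVec_mulVec,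
        Matrix.nonsing_inv_mul _ ((Matrix.isUnit_iff_isUnit_det _).1 this)])
    (fun x => by
      have := isUnit_eigenMatrix h
      simp [eigenMap_eq_mulVec, Matrix.mulVec_mulVec,
        Matrix.mul_nonsing_inv _ ((Matrix.isUnit_iff_isUnit_det _).1 this)])

theorem eigenEquiv_coe {n : ℕ} {r : Fin n → (Fin n → ℝ) → (Fin n → ℝ)} {U : Fin n → ℝ}
    (h : LinearIndependent ℝ (fun i => r i U)) :
    (eigenEquiv h : (Fin n → ℝ) →L[ℝ] (Fin n → ℝ)) = eigenMap r U := rfl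

theorem inverse_eigenMap {n : ℕ} {r : Fin n → (Fin n → ℝ) → (Fin n → ℝ)} {U : Fin n → ℝ}
    (h : LinearIndependent ℝ (fun i => r i U)) (w : Fin n → ℝ) :
    (eigenMap r U).inverse w = ((eigenMatrix r U)⁻¹).mulVec w := by
  rw [← eigenEquiv_coe h, ContinuousLinearMap.inverse_equiv]
  rfl

theorem contDiffAt_eigenMap {n : ℕ} {r : Fin n → (Fin n → ℝ) → (Fin n → ℝ)} {U : Fin n → ℝ}
    (h : ∀ i, ContDiffAt ℝ 1 (r i) U) : ContDiffAt ℝ 1 (eigenMap r) U := by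
  unfold eigenMap
  refine ContDiffAt.sum fun i _ => ?_
  exact contDiffAt_const.smulRight (h i)

/-- Near a point where it is `C¹`, a map is bounded and Lipschitz with a common constant. -/
theorem eventually_bdd_lip {X Y : Type*} [NormedAddCommGroup X] [NormedSpace ℝ X]
    [NormedAddCommGroup Y] [NormedSpace ℝ Y] {f : X → Y} (h : ContDiffAt ℝ 1 f 0) :
    ∃ K : ℝ, ∃ ρ > 0, ∀ K' ≥ K, ∀ ρ' ≤ ρ, ∀ v v' : X, ‖v‖ ≤ ρ' → ‖v'‖ ≤ ρ' →
      ‖f v‖ ≤ K' ∧ ‖f v - f v'‖ ≤ K' * ‖v - v'‖ ∧ DifferentiableAt ℝ f v := by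
  obtain ⟨k, t, ht, hk⟩ := h.exists_lipschitzOnWith
  have hd : ∀ᶠ v in 𝓝 (0 : X), DifferentiableAt ℝ f v :=
    (h.eventually (by simp)).mono fun v hv => hv.differentiableAt (by simp)
  have hb : ∀ᶠ v in 𝓝 (0 : X), ‖f v‖ < ‖f 0‖ + 1 :=
    h.continuousAt.norm.eventually_lt continuousAt_const (by simp)
  obtain ⟨ε, hε, H⟩ := Metric.eventually_nhds_iff.1 ((hd.and hb).and ht)
  refine ⟨max k (‖f 0‖ + 1), ε / 2, by positivity, fun K' hK' ρ' hρ' v v' hv hv' => ?_⟩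
  have h1 := H (y := v) (by rw [dist_zero_right]; linarith)
  have h2 := H (y := v') (by rw [dist_zero_right]; linarith)
  refine ⟨h1.1.2.le.trans ((le_max_right _ _).trans hK'), ?_, h1.1.1⟩
  have := hk.norm_sub_le h1.2 h2.2
  exact this.trans (mul_le_mul_of_nonneg_right ((le_max_left _ _).trans hK') (norm_nonneg _))

theorem exists_charSystem {n : ℕ} {F : (Fin n → ℝ) → (Fin n → ℝ)} (hF : ContDiff ℝ ∞ F)
    {Ubar : Fin n → ℝ} {N : Set (Fin n → ℝ)} {lam : Fin n → (Fin n → ℝ) → ℝ}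
    {r : Fin n → (Fin n → ℝ) → (Fin n → ℝ)}
    (hdiag : SmoothlyDiagonalizable F Ubar N lam r) (hnonchar : ∀ i, lam i Ubar ≠ 0) :
    Nonempty (CharSystem F Ubar N lam r) := by
  have hN : N ∈ 𝓝 (Ubar + 0) := by simpa using hdiag.isOpen.mem_nhds hdiag.mem
  have shift : ∀ {Y : Type} [NormedAddCommGroup Y] [NormedSpace ℝ Y] {f : (Fin n → ℝ) → Y},
      ContDiffAt ℝ 1 f (Ubar + 0) → ContDiffAt ℝ 1 (fun v => f (Ubar + v)) 0 := by
    intro Y _ _ f hf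
    exact hf.comp (0 : Fin n → ℝ) (contDiffAt_const.add contDiffAt_id)
  have hr : ContDiffAt ℝ 1 (eigenMap r) (Ubar + 0) :=
    contDiffAt_eigenMap fun i => ((hdiag.smooth_r i).contDiffAt hN).of_le (by simp)
  have hR := shift hr
  have hL : ContDiffAt ℝ 1 (fun v => (eigenMap r (Ubar + v)).inverse) 0 := by
    refine ContDiffAt.comp (0 : Fin n → ℝ) (g := ContinuousLinearMap.inverse) ?_ hR
    have := hdiag.linearIndependent (Ubar + 0) (mem_of_mem_nhds hN)
    rw [← eigenEquiv_coe this]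
    exact contDiffAt_map_inverse _
  have hA : ContDiffAt ℝ 1 (fun v => fderiv ℝ F (Ubar + v)) 0 :=
    shift (f := fderiv ℝ F) (((hF.of_le (by norm_cast) :
      ContDiff ℝ 2 F).fderiv_right (m := 1) le_rfl).contDiffAt)
  have hlam : ContDiffAt ℝ 1 (fun v => fun i => lam i (Ubar + v)) 0 := by
    rw [contDiffAt_pi]
    exact fun i => shift (((hdiag.smooth_lam i).contDiffAt hN).of_le (by simp))
  -- Speeds are at least `2 * c` in modulus at `Ubar`. Over the ball they vary by at most `c`, since
  -- `ρ ≤ c / K`, so `c` remains.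
  have hc : ∃ c > 0, ∀ i, 2 * c ≤ |lam i Ubar| := by
    rcases isEmpty_or_nonempty (Fin n) with h | h
    · exact ⟨1, one_pos, fun i => h.elim i⟩
    · obtain ⟨i, hi⟩ := Finite.exists_min fun i => |lam i Ubar|
      exact ⟨|lam i Ubar| / 2, by have := abs_pos.2 (hnonchar i); positivity,
        fun j => by have := hi j; linarith⟩
  obtain ⟨c, hc0, hc⟩ := hc
  obtain ⟨K1, ρ1, h1, H1⟩ := eventually_bdd_lip hL
  obtain ⟨K2, ρ2, h2, H2⟩ := eventually_bdd_lip hR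
  obtain ⟨K3, ρ3, h3, H3⟩ := eventually_bdd_lip hA
  obtain ⟨K4, ρ4, h4, H4⟩ := eventually_bdd_lip hlam
  obtain ⟨ρ5, h5, H5⟩ := Metric.mem_nhds_iff.1 hN
  obtain ⟨K, hK1, hK2, hK3, hK4, hK⟩ : ∃ K, K ≥ K1 ∧ K ≥ K2 ∧ K ≥ K3 ∧ K ≥ K4 ∧ 1 ≤ K :=
    ⟨max (max (max K1 K2) (max K3 K4)) 1, by simp, by simp, by simp, by simp, by simp⟩
  have hKc : 0 < c / K := by positivity
  obtain ⟨ρ, hρ1, hρ2, hρ3, hρ4, hρ5, hρ6, hρ⟩ : ∃ ρ, ρ ≤ ρ1 ∧ ρ ≤ ρ2 ∧ ρ ≤ ρ3 ∧ ρ ≤ ρ4 ∧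
      ρ ≤ ρ5 / 2 ∧ ρ ≤ c / K ∧ 0 < ρ := by
    refine ⟨min (min (min ρ1 ρ2) (min ρ3 ρ4)) (min (ρ5 / 2) (c / K)), by simp, by simp, by simp,
      by simp, by simp, by simp, ?_⟩
    simp only [lt_min_iff]
    exact ⟨⟨⟨h1, h2⟩, h3, h4⟩, by linarith, hKc⟩
  have hmem : ∀ v : Fin n → ℝ, ‖v‖ ≤ ρ → Ubar + v ∈ N := fun v hv => H5 (by
    rw [Metric.mem_ball, dist_eq_norm]; simp; linarith)
  have hli := fun v hv => hdiag.linearIndependent _ (hmem v hv)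
  have hinv : ∀ v (hv : ‖v‖ ≤ ρ), (eigenMap r (Ubar + v)).inverse = (eigenEquiv (hli v hv)).symm := by
    intro v hv
    rw [← eigenEquiv_coe (hli v hv), ContinuousLinearMap.inverse_equiv]
  have hlip : ∀ v v' : Fin n → ℝ, ‖v‖ ≤ ρ → ‖v'‖ ≤ ρ → ∀ i,
      |lam i (Ubar + v) - lam i (Ubar + v')| ≤ K * ‖v - v'‖ := fun v v' hv hv' i =>
    (norm_le_pi_norm ((fun i => lam i (Ubar + v)) - fun i => lam i (Ubar + v')) i).trans
      (H4 K hK4 ρ hρ4 v v' hv hv').2.1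
  obtain ⟨sg, hsgc, hsg⟩ : ∃ sg : Fin n → ℤ, (∀ i, sg i = 1 ∨ sg i = -1) ∧
      ∀ i, (sg i : ℝ) * lam i Ubar = |lam i Ubar| := by
    refine ⟨fun i => if 0 < lam i Ubar then 1 else -1, fun i => ?_, fun i => ?_⟩
    · by_cases h : 0 < lam i Ubar <;> simp [h]
    · by_cases h : 0 < lam i Ubar
      · simp [h, abs_of_pos h]
      · simp [h, abs_of_nonpos (not_lt.1 h)]
  have hsga : ∀ i, |(sg i : ℝ)| = 1 := fun i => by rcases hsgc i with h | h <;> simp [h]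
  have hdiff : ∀ v : Fin n → ℝ, ‖v‖ ≤ ρ → ∀ i,
      |lam i Ubar - lam i (Ubar + v)| ≤ c := fun v hv i => by
    have := hlip 0 v (by simpa using hρ.le) hv i
    simp only [add_zero, zero_sub, norm_neg] at this
    refine this.trans ?_
    calc K * ‖v‖ ≤ K * (c / K) := by gcongr; exact hv.trans hρ6
      _ = c := by field_simp
  refine ⟨⟨fun v => (eigenMap r (Ubar + v)).inverse, fun v => eigenMap r (Ubar + v), sg, ρ, K, c,
    hsgc, hρ, hK, hc0, hmem, ?_, fun v hv => (H1 K hK1 ρ hρ1 v v hv hv).1, ?_,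
    fun v v' hv hv' => (H1 K hK1 ρ hρ1 v v' hv hv').2.1,
    fun v hv => (H1 K hK1 ρ hρ1 v v hv hv).2.2, ?_, ?_, ?_, hlip,
    fun v hv => (H3 K hK3 ρ hρ3 v v hv hv).1,
    fun v v' hv hv' => (H3 K hK3 ρ hρ3 v v' hv hv').2.1, ?_, ?_⟩⟩
  · intro v hv y
    rw [hinv v hv]
    exact (eigenEquiv (hli v hv)).symm_apply_apply y
  · intro v hv w
    have h := (H2 K hK2 ρ hρ2 v v hv hv).1
    have : eigenMap r (Ubar + v) ((eigenMap r (Ubar + v)).inverse w) = w := by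
      rw [hinv v hv]
      exact (eigenEquiv (hli v hv)).apply_symm_apply w
    calc ‖w‖ = ‖eigenMap r (Ubar + v) ((eigenMap r (Ubar + v)).inverse w)‖ := by rw [this]
      _ ≤ _ := ContinuousLinearMap.le_of_opNorm_le _ h _
  · intro v hv w i
    obtain ⟨y, rfl⟩ : ∃ y, eigenMap r (Ubar + v) y = w := (eigenEquiv (hli v hv)).surjective w
    have e1 : ∀ y, (eigenMap r (Ubar + v)).inverse (eigenMap r (Ubar + v) y) = y := fun y => by
      rw [hinv v hv]; exact (eigenEquiv (hli v hv)).symm_apply_apply y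
    have e2 : fderiv ℝ F (Ubar + v) (eigenMap r (Ubar + v) y) =
        eigenMap r (Ubar + v) (fun i => lam i (Ubar + v) * y i) := by
      simp only [eigenMap_apply, map_sum, map_smul, hdiag.eigen _ (hmem v hv), smul_smul]
      simp only [mul_comm]
    rw [e2, e1, e1]
  · intro v hv i
    have h1 := abs_le.1 (hdiff v hv i)
    have h2 := hc i
    rw [← hsg i] at h2
    rcases hsgc i with h | h <;> simp only [h] at h2 ⊢ <;> push_cast at h2 ⊢ <;> linarith
  · intro v hv i
    have h := (norm_le_pi_norm (fun i => lam i (Ubar + v)) i).trans (H4 K hK4 ρ hρ4 v v hv hv).1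
    rw [Real.norm_eq_abs] at h
    calc _ ≤ |(sg i : ℝ) * lam i (Ubar + v)| := le_abs_self _
      _ = |lam i (Ubar + v)| := by rw [abs_mul, hsga, one_mul]
      _ ≤ K := h
  · intro v hv
    exact (inverse_eigenMap (hli v hv) v).symm
  · intro i x
    have h0 := abs_pos.2 (hnonchar i)
    have h1 := hsg i
    rcases hsgc i with h | h <;> rw [h] at h1 ⊢ <;> push_cast at h1 ⊢
    · constructor
      · rintro ⟨rfl | rfl, h'⟩
        · simp
        · linarith
      · rintro rfl
        exact ⟨Or.inl rfl, by linarith⟩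
    · constructor
      · rintro ⟨rfl | rfl, h'⟩
        · linarith
        · simp
      · rintro rfl
        exact ⟨Or.inr (by simp), by linarith⟩

namespace CharSystem

variable {n : ℕ} {F : (Fin n → ℝ) → (Fin n → ℝ)} {Ubar : Fin n → ℝ}
    {N : Set (Fin n → ℝ)} {lam : Fin n → (Fin n → ℝ) → ℝ}
    {r : Fin n → (Fin n → ℝ) → (Fin n → ℝ)} (S : CharSystem F Ubar N lam r)

theorem K_pos : 0 < S.K := zero_lt_one.trans_le S.one_le_K

theorem abs_sg (i : Fin n) : |(S.sg i : ℝ)| = 1 := by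
  rcases S.sg_cases i with h | h <;> simp [h]

theorem abs_L_le {v : Fin n → ℝ} (hv : ‖v‖ ≤ S.ρ) (w : Fin n → ℝ) (i : Fin n) :
    |S.L v w i| ≤ S.K * ‖w‖ :=
  (norm_le_pi_norm (S.L v w) i).trans (ContinuousLinearMap.le_of_opNorm_le _ (S.norm_L v hv) w)

theorem abs_L_sub_le {v v' : Fin n → ℝ} (hv : ‖v‖ ≤ S.ρ) (hv' : ‖v'‖ ≤ S.ρ) (w : Fin n → ℝ)
    (i : Fin n) : |S.L v w i - S.L v' w i| ≤ S.K * ‖v - v'‖ * ‖w‖ :=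
  (norm_le_pi_norm ((S.L v - S.L v') w) i).trans
    (ContinuousLinearMap.le_of_opNorm_le _ (S.lip_L v v' hv hv') w)

theorem norm_le_of_abs_le {v w : Fin n → ℝ} (hv : ‖v‖ ≤ S.ρ) {B : ℝ} (hB : 0 ≤ B)
    (h : ∀ i, |S.L v w i| ≤ B) : ‖w‖ ≤ S.K * B :=
  (S.norm_le v hv w).trans (mul_le_mul_of_nonneg_left ((pi_norm_le_iff_of_nonneg hB).2 h)
    S.K_pos.le)

/-- The modulus of the `i`-th characteristic speed. -/
def speed (v : Fin n → ℝ) (i : Fin n) : ℝ := S.sg i * lam i (Ubar + v)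

theorem abs_speed_sub_le {v v' : Fin n → ℝ} (hv : ‖v‖ ≤ S.ρ) (hv' : ‖v'‖ ≤ S.ρ) (i : Fin n) :
    |S.speed v i - S.speed v' i| ≤ S.K * ‖v - v'‖ := by
  rw [speed, speed, ← mul_sub, abs_mul, S.abs_sg, one_mul]
  exact S.lip_lam v v' hv hv' i

/-! ### Uniform estimates for the upwind scheme -/

/-- The index of the grid point `-1` or `1` at which the `i`-th family enters. -/
def inlet (J : ℕ) (i : Fin n) : ℤ := if S.sg i = 1 then 0 else J

/-- A solution of the explicit upwind scheme with mesh sizes `h` in space and `ν h` in time,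
with data of size `δ` small enough. -/
structure UpwindSolution (ν h δ : ℝ) (J : ℕ) (b : ℕ → Fin n → ℝ) (V : ℕ → ℤ → Fin n → ℝ) :
    Prop where
  ν_pos : 0 < ν
  ν_le : ν ≤ 1
  ν_mul_K : ν * S.K ≤ 1
  h_pos : 0 < h
  J_mul_h : J * h = 2
  τ_le : ν * h ≤ 1
  δ_nonneg : 0 ≤ δ
  -- `K ^ 2 * δ` is the amplitude of the bounds to be propagated. The three conditions keep the next
  -- time level in the ball, absorb quadratic errors at the inlet and in space differences, and make
  -- the damping dominate the error of an interior step.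
  small_ball : 8 * S.K * (S.K ^ 2 * δ) ≤ S.ρ
  small_sup : 32 * S.K ^ 3 * (S.K ^ 2 * δ) ≤ 1
  small_speed : (12 * S.K ^ 3 * (8 * S.K / S.c) + 32 * S.K ^ 4) * (S.K ^ 2 * δ) ≤ S.c
  upwind : ∀ (m : ℕ) (j : ℤ) (i : Fin n), 0 ≤ j → j ≤ J → ‖V m j‖ ≤ S.ρ → j ≠ S.inlet J i →
    S.L (V m j) (V (m + 1) j - V m j) i =
      -(ν * S.speed (V m j) i * S.L (V m j) (V m j - V m (j - S.sg i)) i)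
  -- The data are imposed in the frame of the previous level, which keeps the scheme explicit; the
  -- true characteristic unknown meets them up to a quadratic error.
  inflow : ∀ (m : ℕ) (j : ℤ) (i : Fin n), 0 ≤ j → j ≤ J → ‖V m j‖ ≤ S.ρ → j = S.inlet J i →
    S.L (V m j) (V (m + 1) j) i = b (m + 1) i
  compat : ∀ (j : ℤ) (i : Fin n), 0 ≤ j → j ≤ J → j = S.inlet J i → S.L (V 0 j) (V 0 j) i = b 0 i
  norm_initial : ∀ j : ℤ, 0 ≤ j → j ≤ J → ‖V 0 j‖ ≤ δ
  norm_initial_sub : ∀ j : ℤ, 0 < j → j ≤ J → ‖V 0 j - V 0 (j - 1)‖ ≤ δ * h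
  norm_data : ∀ m, ‖b m‖ ≤ δ
  norm_data_sub : ∀ m, ‖b (m + 1) - b m‖ ≤ δ * (ν * h)

/-- The weight, increasing in the direction of propagation of the `i`-th family. -/
def weight (h : ℝ) (i : Fin n) (j : ℤ) : ℝ := 3 + S.sg i * (-1 + j * h)

/-- This loss of `h` toward the upwind neighbour is the damping: in a convex combination with
coefficient `a` it leaves a margin `M * (a * h)` for the error of one step. -/
theorem weight_sub (h : ℝ) (i : Fin n) (j : ℤ) :
    S.weight h i (j - S.sg i) = S.weight h i j - h := by
  rcases S.sg_cases i with e | e <;> simp [weight, e] <;> ring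

/-- One step of the weighted maximum principle. -/
theorem abs_le_of_convex_step {a g g' M w h x : ℝ} (ha : 0 ≤ a) (ha1 : a ≤ 1)
    (hg : |g| ≤ M * w) (hg' : |g'| ≤ M * (w - h)) (hx : |x - ((1 - a) * g + a * g')| ≤ M * (a * h)) :
    |x| ≤ M * w := by
  have h1 : |(1 - a) * g + a * g'| ≤ (1 - a) * (M * w) + a * (M * (w - h)) := by
    refine (abs_add_le _ _).trans ?_
    rw [abs_mul, abs_mul, abs_of_nonneg ha, abs_of_nonneg (sub_nonneg.2 ha1)]
    exact add_le_add (mul_le_mul_of_nonneg_left hg (sub_nonneg.2 ha1))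
      (mul_le_mul_of_nonneg_left hg' ha)
  have h2 := abs_le.1 h1
  have h3 := abs_le.1 hx
  rw [abs_le]
  constructor <;> nlinarith

/-- The error of one step of the scheme for the characteristic unknowns. -/
theorem self_step_error {K B M ν h c a x y g g' l d nk : ℝ} (hK : 1 ≤ K) (hB : 0 ≤ B)
    (hM : 0 ≤ M) (hν : 0 < ν) (hh : 0 < h) (hs : (12 * K ^ 3 * B + 32 * K ^ 4) * M ≤ c)
    (a0 : 0 ≤ a) (aK : a ≤ ν * K) (ac : c * (ν * h) ≤ a * h)
    (hx : |x - y| ≤ 32 * K ^ 3 * M * M * (ν * h)) (hy : y - g = -(a * (g - l)))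
    (hl : |l - g'| ≤ K * d * nk) (hd : d ≤ B * M * h) (hnk : nk ≤ 4 * K * M) (hnk0 : 0 ≤ nk) :
    |x - ((1 - a) * g + a * g')| ≤ M * (a * h) := by
  have hK0 : 0 < K := zero_lt_one.trans_le hK
  have e : x - ((1 - a) * g + a * g') = (x - y) + a * (l - g') := by linarith
  have h1 : a * |l - g'| ≤ ν * K * (K * (B * M * h) * (4 * K * M)) := by
    refine mul_le_mul aK (hl.trans (by gcongr)) (abs_nonneg _) (by positivity)
  have h2 : K ^ 3 ≤ K ^ 4 := pow_le_pow_right₀ hK (by norm_num)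
  calc |x - ((1 - a) * g + a * g')| ≤ |x - y| + a * |l - g'| := by
        rw [e]; refine (abs_add_le _ _).trans_eq ?_; rw [abs_mul, abs_of_nonneg a0]
    _ ≤ 32 * K ^ 3 * M * M * (ν * h) + ν * K * (K * (B * M * h) * (4 * K * M)) :=
        add_le_add hx h1
    _ = (4 * K ^ 3 * B + 32 * K ^ 3) * M * (M * (ν * h)) := by ring
    _ ≤ (12 * K ^ 3 * B + 32 * K ^ 4) * M * (M * (ν * h)) := by gcongr; norm_num
    _ ≤ c * (M * (ν * h)) := by gcongr
    _ = M * (c * (ν * h)) := by ring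
    _ ≤ M * (a * h) := by gcongr

/-- The error of one step of the scheme for the characteristic time differences. -/
theorem diff_step_error {K B M ν h c a a' q qu lD lD' lP lPu p d z s : ℝ} (hK : 1 ≤ K)
    (hB : 0 ≤ B) (hM : 0 ≤ M) (hν : 0 < ν) (hν1 : ν ≤ 1) (hh : 0 < h)
    (hs : (12 * K ^ 3 * B + 32 * K ^ 4) * M ≤ c)
    (a0 : 0 ≤ a') (aK : a' ≤ ν * K) (ac : c * (ν * h) ≤ a' * h) (hq : q = -(a * lD))
    (haa : |a - a'| ≤ ν * (K * p)) (hlD : |lD| ≤ K * d) (hlD' : |lD' - lD| ≤ K * p * d)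
    (hlP : |lP - q| ≤ K * p * p) (hlPu : |lPu - qu| ≤ K * z * s) (hz : z ≤ p + d)
    (hp : p ≤ 4 * K * M * (ν * h)) (hd : d ≤ B * M * h) (hss : s ≤ 4 * K * M * (ν * h))
    (hp0 : 0 ≤ p) (hd0 : 0 ≤ d) (_hz0 : 0 ≤ z) (hs0 : 0 ≤ s) :
    |-(a' * (lD' + lP - lPu)) - ((1 - a') * q + a' * qu)| ≤ M * (ν * h) * (a' * h) := by
  have hK0 : 0 < K := zero_lt_one.trans_le hK
  -- Because `q = -(a * lD)`, what remains is one change of speed and three changes of the base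
  -- point of `L`, each multiplied by a difference: every term is quadratic.
  have e : -(a' * (lD' + lP - lPu)) - ((1 - a') * q + a' * qu) =
      (a - a') * lD + a' * (-(lD' - lD) - (lP - q) + (lPu - qu)) := by rw [hq]; ring
  have h0 : |-(lD' - lD) - (lP - q) + (lPu - qu)| ≤ K * p * d + K * p * p + K * z * s := by
    rw [abs_le] at *
    constructor <;> linarith
  have hz' : z ≤ 4 * K * M * (ν * h) + B * M * h := hz.trans (add_le_add hp hd)
  have h1 : |a - a'| * |lD| ≤
      ν * (K * (4 * K * M * (ν * h))) * (K * (B * M * h)) :=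
    mul_le_mul (haa.trans (by gcongr)) (hlD.trans (by gcongr)) (abs_nonneg _) (by positivity)
  have h2 : a' * |-(lD' - lD) - (lP - q) + (lPu - qu)| ≤
      ν * K * (K * (4 * K * M * (ν * h)) * (B * M * h)
        + K * (4 * K * M * (ν * h)) * (4 * K * M * (ν * h))
        + K * (4 * K * M * (ν * h) + B * M * h) * (4 * K * M * (ν * h))) := by
    refine mul_le_mul aK (h0.trans ?_) (abs_nonneg _) (by positivity)
    gcongr
  calc _ ≤ |a - a'| * |lD| + a' * |-(lD' - lD) - (lP - q) + (lPu - qu)| := by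
        rw [e]; refine (abs_add_le _ _).trans_eq ?_; rw [abs_mul, abs_mul, abs_of_nonneg a0]
    _ ≤ _ := add_le_add h1 h2
    _ = (12 * K ^ 3 * B + 32 * K ^ 4 * ν) * M * (M * (ν * h) * (ν * h)) := by ring
    _ ≤ (12 * K ^ 3 * B + 32 * K ^ 4 * 1) * M * (M * (ν * h) * (ν * h)) := by gcongr
    _ ≤ c * (M * (ν * h) * (ν * h)) := by rw [mul_one]; gcongr
    _ = M * (ν * h) * (c * (ν * h)) := by ring
    _ ≤ M * (ν * h) * (a' * h) := by gcongr

theorem upwind_mem {J : ℕ} {i : Fin n} {j : ℤ} (h0 : 0 ≤ j) (hJ : j ≤ J) (hj : j ≠ S.inlet J i) :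
    0 ≤ j - S.sg i ∧ j - S.sg i ≤ J := by
  rcases S.sg_cases i with e | e <;> simp [inlet, e] at hj ⊢ <;> omega

namespace UpwindSolution

variable {S} {ν h δ : ℝ} {J : ℕ} {b : ℕ → Fin n → ℝ} {V : ℕ → ℤ → Fin n → ℝ}
  (H : S.UpwindSolution ν h δ J b V)
include H

theorem weight_mem (i : Fin n) {j : ℤ} (h0 : 0 ≤ j) (hJ : j ≤ J) :
    2 ≤ S.weight h i j ∧ S.weight h i j ≤ 4 := by
  have h1 : (0 : ℝ) ≤ j * h := mul_nonneg (by exact_mod_cast h0) H.h_pos.le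
  have h2 : (j : ℝ) * h ≤ 2 := by
    rw [← H.J_mul_h]; exact mul_le_mul_of_nonneg_right (by exact_mod_cast hJ) H.h_pos.le
  rcases S.sg_cases i with e | e <;> simp [weight, e] <;> constructor <;> linarith

theorem speed_bounds {v : Fin n → ℝ} (hv : ‖v‖ ≤ S.ρ) (i : Fin n) :
    0 ≤ ν * S.speed v i ∧ ν * S.speed v i ≤ 1 ∧ S.c * (ν * h) ≤ ν * S.speed v i * h ∧
      ν * S.speed v i ≤ ν * S.K := by
  have h1 := S.le_speed v hv i
  have h2 := S.speed_le v hv i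
  have h3 := S.c_pos
  have hν := H.ν_pos
  have hh := H.h_pos
  change S.c ≤ S.speed v i at h1
  change S.speed v i ≤ S.K at h2
  have h4 : ν * S.speed v i ≤ ν * S.K := mul_le_mul_of_nonneg_left h2 hν.le
  refine ⟨mul_nonneg hν.le (h3.le.trans h1), h4.trans H.ν_mul_K, ?_, h4⟩
  calc S.c * (ν * h) = ν * S.c * h := by ring
    _ ≤ ν * S.speed v i * h := by gcongr

/-- The bounds propagated by the scheme at time level `m`. -/
def Bounds (_ : S.UpwindSolution ν h δ J b V) (m : ℕ) : Prop :=
  ∀ j : ℤ, 0 ≤ j → j ≤ J → ‖V m j‖ ≤ S.ρ ∧ ∀ i,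
    |S.L (V m j) (V m j) i| ≤ S.K ^ 2 * δ * S.weight h i j ∧
    |S.L (V m j) (V (m + 1) j - V m j) i| ≤ S.K ^ 2 * δ * (ν * h) * S.weight h i j

theorem M_nonneg : 0 ≤ S.K ^ 2 * δ := mul_nonneg (sq_nonneg _) H.δ_nonneg

theorem τ_pos : 0 < ν * h := mul_pos H.ν_pos H.h_pos

theorem norm_le {m : ℕ} (hm : H.Bounds m) {j : ℤ} (h0 : 0 ≤ j) (hJ : j ≤ J) :
    ‖V m j‖ ≤ 4 * S.K * (S.K ^ 2 * δ) := by
  have hM := H.M_nonneg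
  obtain ⟨h1, h2⟩ := hm j h0 hJ
  have := S.norm_le_of_abs_le (w := V m j) h1 (B := S.K ^ 2 * δ * 4) (by positivity) fun i =>
    (h2 i).1.trans (mul_le_mul_of_nonneg_left (H.weight_mem i h0 hJ).2 hM)
  linarith

theorem norm_time_sub_le {m : ℕ} (hm : H.Bounds m) {j : ℤ} (h0 : 0 ≤ j) (hJ : j ≤ J) :
    ‖V (m + 1) j - V m j‖ ≤ 4 * S.K * (S.K ^ 2 * δ) * (ν * h) := by
  have hM := mul_nonneg H.M_nonneg H.τ_pos.le
  obtain ⟨h1, h2⟩ := hm j h0 hJ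
  have := S.norm_le_of_abs_le (w := V (m + 1) j - V m j) h1 (B := S.K ^ 2 * δ * (ν * h) * 4)
    (by positivity) fun i =>
    (h2 i).2.trans (mul_le_mul_of_nonneg_left (H.weight_mem i h0 hJ).2 hM)
  linarith

theorem norm_succ_le {m : ℕ} (hm : H.Bounds m) {j : ℤ} (h0 : 0 ≤ j) (hJ : j ≤ J) :
    ‖V (m + 1) j‖ ≤ 8 * S.K * (S.K ^ 2 * δ) := by
  have h1 := H.norm_le hm h0 hJ
  have h2 := H.norm_time_sub_le hm h0 hJ
  have hM := H.M_nonneg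
  have hK := S.K_pos
  have h3 : 4 * S.K * (S.K ^ 2 * δ) * (ν * h) ≤ 4 * S.K * (S.K ^ 2 * δ) * 1 :=
    mul_le_mul_of_nonneg_left H.τ_le (by positivity)
  calc ‖V (m + 1) j‖ = ‖V m j + (V (m + 1) j - V m j)‖ := by congr 1; abel
    _ ≤ ‖V m j‖ + ‖V (m + 1) j - V m j‖ := norm_add_le _ _
    _ ≤ _ := by linarith

/-- The upwind equation read backwards: the time difference is the speed times the space difference,
and the speed is at least `c`. The non-characteristic condition thus replaces a separate estimate in
space. -/
theorem abs_upwind_sub_le {m : ℕ} (hm : H.Bounds m) {j : ℤ} (h0 : 0 ≤ j) (hJ : j ≤ J)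
    {i : Fin n} (hj : j ≠ S.inlet J i) :
    |S.L (V m j) (V m j - V m (j - S.sg i)) i| ≤ 4 * (S.K ^ 2 * δ) * h / S.c := by
  obtain ⟨h1, h2⟩ := hm j h0 hJ
  have hM := H.M_nonneg
  have hc := S.c_pos
  have hν := H.ν_pos
  have h3 := (h2 i).2
  rw [H.upwind m j i h0 hJ h1 hj, abs_neg, abs_mul, abs_of_nonneg (H.speed_bounds h1 i).1] at h3
  have h4 : S.K ^ 2 * δ * (ν * h) * S.weight h i j ≤ S.K ^ 2 * δ * (ν * h) * 4 :=
    mul_le_mul_of_nonneg_left (H.weight_mem i h0 hJ).2 (mul_nonneg hM H.τ_pos.le)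
  have h5 : S.c ≤ S.speed (V m j) i := S.le_speed _ h1 i
  rw [le_div_iff₀ hc]
  set y := |S.L (V m j) (V m j - V m (j - S.sg i)) i|
  have hy : 0 ≤ y := abs_nonneg _
  have h6 : ν * S.c * y ≤ ν * S.speed (V m j) i * y := by gcongr
  have h7 : ν * (y * S.c) ≤ ν * (4 * (S.K ^ 2 * δ) * h) := by nlinarith
  exact le_of_mul_le_mul_left h7 hν

/-- Right-going and left-going families see the same cell from its two ends, hence in two different
frames. Moving to a common frame costs `K * ‖D‖ * ‖D‖`, which is absorbed on the left because `D` is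
already known to be small. -/
theorem norm_space_sub_le {m : ℕ} (hm : H.Bounds m) {j : ℤ} (h0 : 0 < j) (hJ : j ≤ J) :
    ‖V m j - V m (j - 1)‖ ≤ 8 * S.K / S.c * (S.K ^ 2 * δ) * h := by
  have hM := H.M_nonneg
  have hK := S.K_pos
  have hc := S.c_pos
  have hh := H.h_pos
  have b1 := (hm j h0.le hJ).1
  have b2 := (hm (j - 1) (by omega) (by omega)).1
  have n1 := H.norm_le hm h0.le hJ
  have n2 := H.norm_le hm (j := j - 1) (by omega) (by omega)
  set D := V m j - V m (j - 1) with hD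
  have hDn : ‖D‖ ≤ 8 * S.K * (S.K ^ 2 * δ) := (norm_sub_le _ _).trans (by linarith)
  have key : ∀ i, |S.L (V m j) D i| ≤ 4 * (S.K ^ 2 * δ) * h / S.c + S.K * ‖D‖ * ‖D‖ := by
    intro i
    rcases S.sg_cases i with e | e
    · have := H.abs_upwind_sub_le hm h0.le hJ (i := i) (by simp [inlet, e]; omega)
      rw [e, ← hD] at this
      have : 0 ≤ S.K * ‖D‖ * ‖D‖ := by positivity
      linarith
    · have h1 := H.abs_upwind_sub_le hm (j := j - 1) (by omega) (by omega) (i := i)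
        (by simp [inlet, e]; omega)
      rw [e, show j - 1 - -1 = j by ring, ← neg_sub (V m j), ← hD, map_neg, Pi.neg_apply,
        abs_neg] at h1
      have h2 := S.abs_L_sub_le b1 b2 D i
      rw [← hD] at h2
      have h3 := abs_add_le (S.L (V m j) D i - S.L (V m (j - 1)) D i) (S.L (V m (j - 1)) D i)
      rw [sub_add_cancel] at h3
      linarith
  have h1 := S.norm_le_of_abs_le b1 (by positivity) key
  have h2 : S.K * (S.K * ‖D‖ * ‖D‖) ≤ 1 / 2 * ‖D‖ := by
    have h3 : S.K ^ 2 * ‖D‖ ≤ 1 / 2 := by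
      calc S.K ^ 2 * ‖D‖ ≤ S.K ^ 2 * (8 * S.K * (S.K ^ 2 * δ)) := by gcongr
        _ = 32 * S.K ^ 3 * (S.K ^ 2 * δ) / 4 := by ring
        _ ≤ 1 / 2 := by linarith [H.small_sup]
    calc S.K * (S.K * ‖D‖ * ‖D‖) = S.K ^ 2 * ‖D‖ * ‖D‖ := by ring
      _ ≤ 1 / 2 * ‖D‖ := by gcongr
  have h4 : 8 * S.K / S.c * (S.K ^ 2 * δ) * h =
      2 * (S.K * (4 * (S.K ^ 2 * δ) * h / S.c)) := by field_simp; ring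
  rw [h4]
  linarith

theorem norm_upwind_sub_le {m : ℕ} (hm : H.Bounds m) {j : ℤ} (h0 : 0 ≤ j) (hJ : j ≤ J)
    {i : Fin n} (hj : j ≠ S.inlet J i) :
    ‖V m j - V m (j - S.sg i)‖ ≤ 8 * S.K / S.c * (S.K ^ 2 * δ) * h := by
  have h1 := S.upwind_mem h0 hJ hj
  rcases S.sg_cases i with e | e
  · rw [e] at h1 ⊢
    exact H.norm_space_sub_le hm (by omega) hJ
  · rw [e] at h1 ⊢
    have := H.norm_space_sub_le hm (j := j + 1) (by omega) (by omega)
    rw [norm_sub_rev, add_sub_cancel_right] at this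
    simpa using this

theorem weight_inlet {i : Fin n} {j : ℤ} (hj : j = S.inlet J i) : S.weight h i j = 2 := by
  have := H.J_mul_h
  rcases S.sg_cases i with e | e <;> simp [inlet, e] at hj <;> simp [weight, e, hj] <;> linarith

/-- The scheme fixes the components of the new value in the old frame; this is the cost of passing
to the new frame, quadratic in the amplitude and proportional to the time step. -/
theorem self_error {m : ℕ} (hm : H.Bounds m) {j : ℤ} (h0 : 0 ≤ j) (hJ : j ≤ J) (i : Fin n) :
    |S.L (V (m + 1) j) (V (m + 1) j) i - S.L (V m j) (V (m + 1) j) i| ≤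
      32 * S.K ^ 3 * (S.K ^ 2 * δ) * (S.K ^ 2 * δ) * (ν * h) := by
  have hK := S.K_pos
  have h1 := H.norm_succ_le hm h0 hJ
  have h2 := H.norm_time_sub_le hm h0 hJ
  have hM := H.M_nonneg
  have hτ := H.τ_pos.le
  refine (S.abs_L_sub_le (h1.trans H.small_ball) (hm j h0 hJ).1 _ i).trans ?_
  calc S.K * ‖V (m + 1) j - V m j‖ * ‖V (m + 1) j‖
      ≤ S.K * (4 * S.K * (S.K ^ 2 * δ) * (ν * h)) * (8 * S.K * (S.K ^ 2 * δ)) := by gcongr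
    _ = _ := by ring

/-- The first time difference is reduced to differences of the data: at the inlet by the
compatibility condition, elsewhere by the upwind equation applied to the initial values. -/
theorem bounds_zero : H.Bounds 0 := by
  have hK := S.K_pos
  have hK1 := S.one_le_K
  have hδ := H.δ_nonneg
  have hτ := H.τ_pos.le
  have hh := H.h_pos
  have e1 : δ ≤ S.K ^ 2 * δ := le_mul_of_one_le_left hδ (one_le_pow₀ hK1)
  have e2 : S.K * δ ≤ S.K ^ 2 * δ := by
    rw [pow_two, mul_assoc]; exact le_mul_of_one_le_left (by positivity) hK1
  have hρ : δ ≤ S.ρ := by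
    refine e1.trans (le_trans ?_ H.small_ball)
    exact le_mul_of_one_le_left H.M_nonneg (by linarith)
  intro j h0 hJ
  have n0 := H.norm_initial j h0 hJ
  have nρ := n0.trans hρ
  refine ⟨nρ, fun i => ⟨?_, ?_⟩⟩
  · calc |S.L (V 0 j) (V 0 j) i| ≤ S.K * ‖V 0 j‖ := S.abs_L_le nρ _ i
      _ ≤ S.K * δ := by gcongr
      _ ≤ S.K ^ 2 * δ * 1 := by linarith
      _ ≤ _ := mul_le_mul_of_nonneg_left (by linarith [(H.weight_mem i h0 hJ).1]) H.M_nonneg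
  · suffices |S.L (V 0 j) (V (0 + 1) j - V 0 j) i| ≤ S.K ^ 2 * δ * (ν * h) * 1 from
      this.trans (mul_le_mul_of_nonneg_left (by linarith [(H.weight_mem i h0 hJ).1])
        (mul_nonneg H.M_nonneg hτ))
    rw [mul_one]
    by_cases hj : j = S.inlet J i
    · rw [map_sub, Pi.sub_apply, H.inflow 0 j i h0 hJ nρ hj, H.compat j i h0 hJ hj]
      calc |b (0 + 1) i - b 0 i| ≤ ‖b (0 + 1) - b 0‖ := norm_le_pi_norm (b (0 + 1) - b 0) i
        _ ≤ δ * (ν * h) := H.norm_data_sub 0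
        _ ≤ _ := by gcongr
    · have hd : ‖V 0 j - V 0 (j - S.sg i)‖ ≤ δ * h := by
        have h1 := S.upwind_mem h0 hJ hj
        rcases S.sg_cases i with e | e
        · rw [e] at h1 ⊢
          exact H.norm_initial_sub j (by omega) hJ
        · rw [e] at h1 ⊢
          have := H.norm_initial_sub (j + 1) (by omega) (by omega)
          rw [norm_sub_rev, add_sub_cancel_right] at this
          simpa using this
      have hs := H.speed_bounds nρ i
      rw [H.upwind 0 j i h0 hJ nρ hj, abs_neg, abs_mul, abs_of_nonneg hs.1]
      calc _ ≤ ν * S.K * (S.K * (δ * h)) :=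
            mul_le_mul hs.2.2.2 ((S.abs_L_le nρ _ i).trans (by gcongr)) (abs_nonneg _)
              (mul_nonneg H.ν_pos.le hK.le)
        _ = _ := by ring

theorem bounds_succ {m : ℕ} (hm : H.Bounds m) : H.Bounds (m + 1) := by
  have hK := S.K_pos
  have hK1 := S.one_le_K
  have hc := S.c_pos
  have hδ := H.δ_nonneg
  have hτ := H.τ_pos.le
  have hh := H.h_pos
  have hν := H.ν_pos
  have hM := H.M_nonneg
  have hsup := H.small_sup
  have e1 : δ ≤ S.K ^ 2 * δ := le_mul_of_one_le_left hδ (one_le_pow₀ hK1)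
  have hsp := H.small_speed
  have hB0 : 0 ≤ 8 * S.K / S.c := by positivity
  intro j h0 hJ
  have nv := (hm j h0 hJ).1
  have nv' := (H.norm_succ_le hm h0 hJ).trans H.small_ball
  have hP := H.norm_time_sub_le hm h0 hJ
  refine ⟨nv', fun i => ?_⟩
  have hself := H.self_error hm h0 hJ i
  by_cases hj : j = S.inlet J i
  -- The weight equals 2 at the inlet: one unit pays for the data and the other for the change of
  -- frame in `hself`. The same split serves values and time differences.
  · rw [H.weight_inlet hj]
    have hb := H.inflow m j i h0 hJ nv hj
    have hb' := H.inflow (m + 1) j i h0 hJ nv' hj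
    rw [hb] at hself
    rw [map_sub, Pi.sub_apply, hb']
    have err : 32 * S.K ^ 3 * (S.K ^ 2 * δ) * (S.K ^ 2 * δ) * (ν * h) ≤
        S.K ^ 2 * δ * (ν * h) := by
      have := mul_le_mul_of_nonneg_right hsup (mul_nonneg hM hτ)
      linarith
    have hτ1 : S.K ^ 2 * δ * (ν * h) ≤ S.K ^ 2 * δ := mul_le_of_le_one_right hM H.τ_le
    have d1 : |b (m + 1) i| ≤ S.K ^ 2 * δ :=
      ((norm_le_pi_norm (b (m + 1)) i).trans (H.norm_data _)).trans e1
    have d2 : |b (m + 1 + 1) i - b (m + 1) i| ≤ S.K ^ 2 * δ * (ν * h) :=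
      ((norm_le_pi_norm (b (m + 1 + 1) - b (m + 1)) i).trans (H.norm_data_sub _)).trans
        (mul_le_mul_of_nonneg_right e1 hτ)
    have d3 := hself.trans err
    rw [abs_le] at d1 d2 d3
    constructor <;> rw [abs_le] <;> constructor <;> linarith
  · obtain ⟨k0, kJ⟩ := S.upwind_mem h0 hJ hj
    have hD := H.norm_upwind_sub_le hm h0 hJ hj
    have hw := S.weight_sub h i j
    have up := H.upwind m j i h0 hJ nv hj
    have up' := H.upwind (m + 1) j i h0 hJ nv' hj
    generalize j - S.sg i = k at *
    obtain ⟨nu, gu⟩ := hm k k0 kJ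
    obtain ⟨a0, a1, ac, aK⟩ := H.speed_bounds nv i
    obtain ⟨a0', a1', ac', aK'⟩ := H.speed_bounds nv' i
    have gv := (hm j h0 hJ).2 i
    have gu := gu i
    rw [hw] at gu
    constructor
    · rw [map_sub, Pi.sub_apply, map_sub, Pi.sub_apply] at up
      exact abs_le_of_convex_step a0 a1 gv.1 gu.1
        (self_step_error hK1 hB0 hM hν hh hsp a0 aK ac hself up
          (S.abs_L_sub_le nv nu (V m k) i) hD (H.norm_le hm k0 kJ) (norm_nonneg _))
    -- Expressing the new space difference through the old one makes the time differences at `j` and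
    -- at its upwind neighbour `k` obey the same convex combination as the values, up to quadratic
    -- terms.
    · have split : V (m + 1) j - V (m + 1) k =
          V m j - V m k + (V (m + 1) j - V m j) - (V (m + 1) k - V m k) := by abel
      rw [split, map_sub (S.L (V (m + 1) j)) _ (V (m + 1) k - V m k), map_add, Pi.sub_apply,
        Pi.add_apply] at up'
      rw [up']
      have haa : |ν * S.speed (V m j) i - ν * S.speed (V (m + 1) j) i| ≤
          ν * (S.K * ‖V (m + 1) j - V m j‖) := by
        rw [← mul_sub, abs_mul, abs_of_pos hν, norm_sub_rev]
        exact mul_le_mul_of_nonneg_left (S.abs_speed_sub_le nv nv' i) hν.le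
      exact abs_le_of_convex_step a0' a1' gv.2 gu.2
        (diff_step_error hK1 hB0 hM hν H.ν_le hh hsp a0' aK' ac' up haa
          (S.abs_L_le nv (V m j - V m k) i) (S.abs_L_sub_le nv' nv (V m j - V m k) i)
          (S.abs_L_sub_le nv' nv (V (m + 1) j - V m j) i)
          (S.abs_L_sub_le nv' nu (V (m + 1) k - V m k) i)
          (norm_sub_le_norm_sub_add_norm_sub _ _ _) hP hD (H.norm_time_sub_le hm k0 kJ)
          (norm_nonneg _) (norm_nonneg _) (norm_nonneg _) (norm_nonneg _))

theorem bounds : ∀ m, H.Bounds m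
  | 0 => H.bounds_zero
  | m + 1 => H.bounds_succ (bounds m)

end UpwindSolution
end CharSystem

/-! ### Compactness, and summation of a discrete transport equation -/

/-- A pointwise bounded sequence of asymptotically Lipschitz functions converges, along some
filter, uniformly on compact sets to a Lipschitz function. -/
theorem exists_limit_of_asymptotically_lipschitz {X : Type*} [PseudoMetricSpace X] {Y : Type*}
    [NormedAddCommGroup Y] [ProperSpace Y] {D : Set X} {f : ℕ → X → Y}
    {A B : ℝ} (hB : 0 ≤ B) (hb : ∀ J, ∀ p ∈ D, ‖f J p‖ ≤ A) {e : ℕ → ℝ}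
    (he : Filter.Tendsto e Filter.atTop (𝓝 0))
    (hlip : ∀ J, ∀ p ∈ D, ∀ q ∈ D, ‖f J p - f J q‖ ≤ B * (dist p q + e J)) :
    ∃ (l : Filter ℕ) (V : X → Y), l.NeBot ∧ l ≤ Filter.atTop ∧
      (∀ p ∈ D, Filter.Tendsto (fun J => f J p) l (𝓝 (V p))) ∧ (∀ p ∈ D, ‖V p‖ ≤ A) ∧
      (∀ p ∈ D, ∀ q ∈ D, ‖V p - V q‖ ≤ B * dist p q) ∧
      ∀ Q ⊆ D, IsCompact Q → ∀ ε > 0, ∀ᶠ J in l, ∀ p ∈ Q, ‖f J p - V p‖ ≤ ε := by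
  -- An ultrafilter finer than `atTop` provides the limits at all points at once, in place of a
  -- diagonal subsequence.
  have hl : (Filter.hyperfilter ℕ : Filter ℕ) ≤ Filter.atTop := by
    rw [← Nat.cofinite_eq_atTop]; exact Filter.hyperfilter_le_cofinite
  have hex : ∀ p, ∃ y, p ∈ D → ‖y‖ ≤ A ∧
      Filter.Tendsto (fun J => f J p) (Filter.hyperfilter ℕ) (𝓝 y) := by
    intro p
    by_cases hp : p ∈ D
    · obtain ⟨y, hy, hy'⟩ := (isCompact_closedBall (0 : Y) A).ultrafilter_le_nhds
        ((Filter.hyperfilter ℕ).map fun J => f J p) (by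
          rw [Ultrafilter.coe_map, Filter.le_principal_iff, Filter.mem_map]
          exact Filter.univ_mem' fun J => by simpa using hb J p hp)
      exact ⟨y, fun _ => ⟨by simpa using hy, hy'⟩⟩
    · exact ⟨0, fun h => absurd h hp⟩
  choose V hV using hex
  have hVlip : ∀ p ∈ D, ∀ q ∈ D, ‖V p - V q‖ ≤ B * dist p q := by
    intro p hp q hq
    have h1 := ((hV p hp).2.sub (hV q hq).2).norm
    have h2 : Filter.Tendsto (fun J => B * (dist p q + e J)) (Filter.hyperfilter ℕ)
        (𝓝 (B * (dist p q + 0))) := ((he.mono_left hl).const_add _).const_mul _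
    rw [add_zero] at h2
    exact le_of_tendsto_of_tendsto' h1 h2 fun J => hlip J p hp q hq
  refine ⟨Filter.hyperfilter ℕ, V, inferInstance, hl, fun p hp => (hV p hp).2,
    fun p hp => (hV p hp).1, hVlip, ?_⟩
  intro Q hQ hQc ε hε
  obtain ⟨d, hd, hdε⟩ : ∃ d > 0, B * d ≤ ε / 4 := by
    refine ⟨ε / (4 * (B + 1)), by positivity, ?_⟩
    rw [mul_div_assoc', div_le_div_iff₀ (by positivity) (by positivity)]
    nlinarith
  -- Convergence at the finitely many centres spreads to `Q` by the asymptotic Lipschitz bound of `f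
  -- J` and the Lipschitz bound of `V`.
  obtain ⟨t, ht, htf, hcov⟩ := hQc.finite_cover_balls hd
  have h1 : ∀ᶠ J in (Filter.hyperfilter ℕ : Filter ℕ), ∀ p ∈ t, ‖f J p - V p‖ < ε / 4 := by
    rw [Filter.eventually_all_finite htf]
    intro p hp
    have := ((hV p (hQ (ht hp))).2.sub_const (V p)).norm
    rw [sub_self, norm_zero] at this
    exact this.eventually_lt_const (by positivity)
  have h2 : ∀ᶠ J in (Filter.hyperfilter ℕ : Filter ℕ), e J < d :=
    (he.mono_left hl).eventually_lt_const hd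
  filter_upwards [h1, h2] with J hJ1 hJ2 p hp
  obtain ⟨q, hq, hpq⟩ := mem_iUnion₂.1 (hcov hp)
  have hqD := hQ (ht hq)
  have hpq : dist p q ≤ d := (Metric.mem_ball.1 hpq).le
  have a1 : ‖f J p - f J q‖ ≤ ε / 4 + ε / 4 := (hlip J p (hQ hp) q hqD).trans (by
    rw [mul_add]
    exact add_le_add ((mul_le_mul_of_nonneg_left hpq hB).trans hdε)
      ((mul_le_mul_of_nonneg_left hJ2.le hB).trans hdε))
  have a2 : ‖V q - V p‖ ≤ ε / 4 := by
    rw [norm_sub_rev]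
    exact (hVlip p (hQ hp) q hqD).trans ((mul_le_mul_of_nonneg_left hpq hB).trans hdε)
  have a3 := hJ1 q hq
  calc ‖f J p - V p‖ = ‖(f J p - f J q) + (f J q - V q) + (V q - V p)‖ := by congr 1; abel
    _ ≤ ‖f J p - f J q‖ + ‖f J q - V q‖ + ‖V q - V p‖ := norm_add₃_le
    _ ≤ ε := by linarith

/-- Summing a discrete transport equation over a square block of grid points. -/
theorem abs_transport_block_le {u : ℕ → ℕ → ℝ} {a e α α' β : ℝ} {P : ℕ} (hP : 0 < P)
    (ha : 0 ≤ a) (hres : ∀ m < P, ∀ k < P,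
      |u (m + 1) (k + 1) - u m (k + 1) + a * (u m (k + 1) - u m k)| ≤ e)
    (ht : ∀ k < P, |u P (k + 1) - u 0 (k + 1) - α| ≤ β)
    (hx : ∀ m < P, |u m P - u m 0 - α'| ≤ β) :
    |α + a * α'| ≤ P * e + (1 + a) * β := by
  -- A discrete divergence theorem: since `a` is constant, time differences telescope in `m` and
  -- space differences in `k`, so only differences between opposite sides of the block survive.
  have h1 : ∑ k ∈ Finset.range P, (u P (k + 1) - u 0 (k + 1)) +
      a * ∑ m ∈ Finset.range P, (u m P - u m 0) =
      ∑ k ∈ Finset.range P, ∑ m ∈ Finset.range P,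
        (u (m + 1) (k + 1) - u m (k + 1) + a * (u m (k + 1) - u m k)) := by
    simp_rw [Finset.sum_add_distrib]
    congr 1
    · exact Finset.sum_congr rfl fun k _ =>
        (Finset.sum_range_sub (fun m => u m (k + 1)) P).symm
    · rw [Finset.sum_comm, Finset.mul_sum]
      refine Finset.sum_congr rfl fun m _ => ?_
      rw [← Finset.mul_sum, Finset.sum_range_sub (fun k => u m k)]
  have h2 : |∑ k ∈ Finset.range P, ∑ m ∈ Finset.range P,
        (u (m + 1) (k + 1) - u m (k + 1) + a * (u m (k + 1) - u m k))| ≤ P * (P * e) := by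
    have : ∀ k ∈ Finset.range P, |∑ m ∈ Finset.range P,
        (u (m + 1) (k + 1) - u m (k + 1) + a * (u m (k + 1) - u m k))| ≤ P * e := by
      intro k hk
      refine (Finset.abs_sum_le_sum_abs _ _).trans ?_
      refine (Finset.sum_le_card_nsmul _ _ e fun m hm => ?_).trans_eq (by simp)
      exact hres m (Finset.mem_range.1 hm) k (Finset.mem_range.1 hk)
    refine (Finset.abs_sum_le_sum_abs _ _).trans ?_
    exact (Finset.sum_le_card_nsmul _ _ _ this).trans_eq (by simp)
  have h3 : |∑ k ∈ Finset.range P, (u P (k + 1) - u 0 (k + 1)) - P * α| ≤ P * β := by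
    have : ∑ k ∈ Finset.range P, (u P (k + 1) - u 0 (k + 1)) - P * α =
        ∑ k ∈ Finset.range P, (u P (k + 1) - u 0 (k + 1) - α) := by
      rw [Finset.sum_sub_distrib (g := fun _ => α)]; simp
    rw [this]
    refine (Finset.abs_sum_le_sum_abs _ _).trans ?_
    exact (Finset.sum_le_card_nsmul _ _ β fun k hk => ht k (Finset.mem_range.1 hk)).trans_eq
      (by simp)
  have h4 : |∑ m ∈ Finset.range P, (u m P - u m 0) - P * α'| ≤ P * β := by
    have : ∑ m ∈ Finset.range P, (u m P - u m 0) - P * α' =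
        ∑ m ∈ Finset.range P, (u m P - u m 0 - α') := by
      rw [Finset.sum_sub_distrib (g := fun _ => α')]; simp
    rw [this]
    refine (Finset.abs_sum_le_sum_abs _ _).trans ?_
    exact (Finset.sum_le_card_nsmul _ _ β fun k hk => hx k (Finset.mem_range.1 hk)).trans_eq
      (by simp)
  rw [← h1] at h2
  generalize ∑ k ∈ Finset.range P, (u P (k + 1) - u 0 (k + 1)) = s at *
  generalize ∑ m ∈ Finset.range P, (u m P - u m 0) = s' at *
  have h5 : |a * (s' - P * α')| ≤ a * (P * β) := by
    rw [abs_mul, abs_of_nonneg ha]; exact mul_le_mul_of_nonneg_left h4 ha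
  have hP' : (0 : ℝ) < P := by exact_mod_cast hP
  have h6 : |P * (α + a * α')| ≤ P * (P * e + (1 + a) * β) := by
    have e1 : P * (α + a * α') = (s + a * s') - (s - P * α) - a * (s' - P * α') := by ring
    rw [abs_le] at *
    rw [e1]
    constructor <;> linarith
  rw [abs_mul, abs_of_pos hP'] at h6
  exact le_of_mul_le_mul_left h6 hP'

/-! ### Construction of the approximate solutions and their grid functions -/

namespace CharSystem

variable {n : ℕ} {F : (Fin n → ℝ) → (Fin n → ℝ)} {Ubar : Fin n → ℝ}
    {N : Set (Fin n → ℝ)} {lam : Fin n → (Fin n → ℝ) → ℝ}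
    {r : Fin n → (Fin n → ℝ) → (Fin n → ℝ)} (S : CharSystem F Ubar N lam r)

/-- The explicit upwind scheme. -/
def upwindScheme (ν : ℝ) (J : ℕ) (V0 : ℤ → Fin n → ℝ) (b : ℕ → Fin n → ℝ) :
    ℕ → ℤ → Fin n → ℝ
  | 0, j => V0 j
  | m + 1, j =>
    let V := upwindScheme ν J V0 b m
    -- `R` inverts `L`, so the components of the new value in the frame at `V j` can be prescribed
    -- one by one. For `j` on the grid, `j - sg i` leaves the grid only at the inlet, where the data
    -- are used instead.
    S.R (V j) fun i =>
      if j = S.inlet J i then b (m + 1) i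
      else S.L (V j) (V j) i - ν * S.speed (V j) i * S.L (V j) (V j - V (j - S.sg i)) i

/-- The ratio of the time step to the space step. -/
def meshRatio : ℝ := 1 / (2 * S.K)

/-- Small Lipschitz initial and boundary data that are compatible at the corners. -/
structure SmallData (δ : ℝ) (V0 b : ℝ → Fin n → ℝ) : Prop where
  δ_nonneg : 0 ≤ δ
  small_ball : 8 * S.K * (S.K ^ 2 * δ) ≤ S.ρ
  small_sup : 32 * S.K ^ 3 * (S.K ^ 2 * δ) ≤ 1
  small_speed : (12 * S.K ^ 3 * (8 * S.K / S.c) + 32 * S.K ^ 4) * (S.K ^ 2 * δ) ≤ S.c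
  norm_initial : ∀ x ∈ Icc (-1 : ℝ) 1, ‖V0 x‖ ≤ δ
  lip_initial : ∀ x ∈ Icc (-1 : ℝ) 1, ∀ y ∈ Icc (-1 : ℝ) 1, ‖V0 x - V0 y‖ ≤ δ * |x - y|
  norm_data : ∀ t, 0 ≤ t → ‖b t‖ ≤ δ
  lip_data : ∀ t, 0 ≤ t → ∀ s, 0 ≤ s → ‖b t - b s‖ ≤ δ * |t - s|
  compat : ∀ i, S.L (V0 (-(S.sg i : ℝ))) (V0 (-(S.sg i : ℝ))) i = b 0 i

/-- The approximate solution on the grid with `J + 1` space intervals. -/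
def approx (V0 b : ℝ → Fin n → ℝ) (J : ℕ) : ℕ → ℤ → Fin n → ℝ :=
  S.upwindScheme S.meshRatio (J + 1) (fun j => V0 (-1 + j * (2 / (J + 1 : ℝ))))
    (fun m => b (m * (S.meshRatio * (2 / (J + 1 : ℝ)))))

theorem meshRatio_pos : 0 < S.meshRatio := by
  have := S.K_pos
  unfold meshRatio; positivity

theorem meshRatio_mul_K : S.meshRatio * S.K = 1 / 2 := by
  have := S.K_pos.ne'
  unfold meshRatio; field_simp

theorem meshRatio_le : S.meshRatio ≤ 1 / 2 := by
  rw [← S.meshRatio_mul_K]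
  exact le_mul_of_one_le_right S.meshRatio_pos.le S.one_le_K

theorem upwindSolution_approx {δ : ℝ} {V0 b : ℝ → Fin n → ℝ} (hd : S.SmallData δ V0 b) (J : ℕ) :
    S.UpwindSolution S.meshRatio (2 / (J + 1 : ℝ)) δ (J + 1)
      (fun m => b (m * (S.meshRatio * (2 / (J + 1 : ℝ))))) (S.approx V0 b J) := by
  have hν := S.meshRatio_pos
  have hν2 := S.meshRatio_le
  have hJ : (0 : ℝ) < J + 1 := by positivity
  have hh : 0 < 2 / (J + 1 : ℝ) := by positivity
  have hh2 : 2 / (J + 1 : ℝ) ≤ 2 := div_le_self (by norm_num) (by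
    have : (0 : ℝ) ≤ J := by positivity
    linarith)
  have hJh : ((J + 1 : ℕ) : ℝ) * (2 / (J + 1 : ℝ)) = 2 := by push_cast; field_simp
  have hx : ∀ j : ℤ, 0 ≤ j → j ≤ (J + 1 : ℕ) → -1 + j * (2 / (J + 1 : ℝ)) ∈ Icc (-1 : ℝ) 1 := by
    intro j h0 h1
    have a1 : (0 : ℝ) ≤ j := by exact_mod_cast h0
    have a2 : (j : ℝ) ≤ (J + 1 : ℕ) := by exact_mod_cast h1
    have a3 := mul_le_mul_of_nonneg_right a2 hh.le
    rw [hJh] at a3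
    have a4 := mul_nonneg a1 hh.le
    constructor <;> linarith
  have step : ∀ (m : ℕ) (j : ℤ) (i : Fin n), ‖S.approx V0 b J m j‖ ≤ S.ρ →
      S.L (S.approx V0 b J m j) (S.approx V0 b J (m + 1) j) i =
      if j = S.inlet (J + 1) i then b ((m + 1 : ℕ) * (S.meshRatio * (2 / (J + 1 : ℝ)))) i
      else S.L (S.approx V0 b J m j) (S.approx V0 b J m j) i -
        S.meshRatio * S.speed (S.approx V0 b J m j) i *
        S.L (S.approx V0 b J m j) (S.approx V0 b J m j - S.approx V0 b J m (j - S.sg i)) i := by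
    intro m j i hv
    exact congrFun (S.L_R _ hv _) i
  -- The CFL number is `1 / 2`. The time step is at most 1 because `ν ≤ 1 / 2` and `h ≤ 2`.
  refine ⟨hν, by linarith, by rw [S.meshRatio_mul_K]; norm_num, hh, hJh, by nlinarith,
    hd.δ_nonneg, hd.small_ball, hd.small_sup, hd.small_speed, ?_, ?_, ?_, ?_, ?_, ?_, ?_⟩
  · intro m j i _ _ hv hj
    rw [map_sub, Pi.sub_apply, step m j i hv, if_neg hj]
    ring
  · intro m j i _ _ hv hj
    rw [step m j i hv, if_pos hj]
  · intro j i _ _ hj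
    have e : -1 + (j : ℝ) * (2 / (J + 1 : ℝ)) = -(S.sg i : ℝ) := by
      rcases S.sg_cases i with e | e <;> rw [hj] <;> simp only [inlet, e]
      · simp
      · rw [if_neg (by norm_num), Int.cast_natCast, hJh]; norm_num
    have := hd.compat i
    simpa only [approx, upwindScheme, e, Nat.cast_zero, zero_mul] using this
  · intro j h0 h1
    exact hd.norm_initial _ (hx j h0 h1)
  · intro j h0 h1
    refine (hd.lip_initial _ (hx j h0.le h1) _ (hx (j - 1) (by omega) (by omega))).trans_eq ?_
    congr 1
    rw [← abs_of_pos hh]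
    congr 1
    rw [abs_of_pos hh]
    push_cast
    ring
  · intro m
    exact hd.norm_data _ (by positivity)
  · intro m
    refine (hd.lip_data _ (by positivity) _ (by positivity)).trans_eq ?_
    congr 1
    rw [← abs_of_pos (mul_pos hν hh)]
    congr 1
    rw [abs_of_pos (mul_pos hν hh)]
    push_cast
    ring

end CharSystem

namespace CharSystem

variable {n : ℕ} {F : (Fin n → ℝ) → (Fin n → ℝ)} {Ubar : Fin n → ℝ}
    {N : Set (Fin n → ℝ)} {lam : Fin n → (Fin n → ℝ) → ℝ}
    {r : Fin n → (Fin n → ℝ) → (Fin n → ℝ)} (S : CharSystem F Ubar N lam r)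

/-- The piecewise constant function with the given values at the grid points. -/
def gridFun {Y : Type*} (τ h : ℝ) (V : ℕ → ℤ → Y) (p : ℝ × ℝ) : Y :=
  V ⌊p.1 / τ⌋₊ ⌊(p.2 + 1) / h⌋

theorem gridFun_grid {Y : Type*} {τ h : ℝ} (hτ : 0 < τ) (hh : 0 < h) (V : ℕ → ℤ → Y) (m : ℕ)
    (j : ℤ) : gridFun τ h V (m * τ, -1 + j * h) = V m j := by
  have e1 : (m * τ) / τ = m := by field_simp
  have e2 : (-1 + j * h + 1) / h = j := by field_simp; ring
  simp only [gridFun, e1, e2, Nat.floor_natCast, Int.floor_intCast]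

/-- The Lipschitz constant of the approximate solutions relative to the size of the data. -/
def lipConst : ℝ := (4 * S.K + 8 * S.K / S.c) * S.K ^ 2

theorem lipConst_pos : 0 < S.lipConst := by
  have := S.K_pos
  have := S.c_pos
  unfold lipConst; positivity

namespace UpwindSolution

variable {S} {ν h δ : ℝ} {J : ℕ} {b : ℕ → Fin n → ℝ} {V : ℕ → ℤ → Fin n → ℝ}
  (H : S.UpwindSolution ν h δ J b V)
include H

theorem norm_time_sub_le_mul (m k : ℕ) {j : ℤ} (h0 : 0 ≤ j) (hJ : j ≤ J) :
    ‖V (m + k) j - V m j‖ ≤ k * (4 * S.K * (S.K ^ 2 * δ) * (ν * h)) := by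
  induction k with
  | zero => simp
  | succ k ih =>
    have := H.norm_time_sub_le (H.bounds (m + k)) h0 hJ
    calc ‖V (m + k + 1) j - V m j‖ ≤ ‖V (m + k + 1) j - V (m + k) j‖ + ‖V (m + k) j - V m j‖ :=
          norm_sub_le_norm_sub_add_norm_sub _ _ _
      _ ≤ _ := by push_cast; linarith

theorem norm_space_sub_le_mul (m k : ℕ) {j : ℤ} (h0 : 0 ≤ j) (hJ : j + k ≤ J) :
    ‖V m (j + k) - V m j‖ ≤ k * (8 * S.K / S.c * (S.K ^ 2 * δ) * h) := by
  induction k with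
  | zero => simp
  | succ k ih =>
    have ih := ih (by push_cast at hJ; omega)
    have := H.norm_space_sub_le (H.bounds m) (j := j + (k + 1 : ℕ)) (by positivity) hJ
    rw [show j + ((k + 1 : ℕ) : ℤ) - 1 = j + k by push_cast; ring] at this
    calc _ ≤ ‖V m (j + (k + 1 : ℕ)) - V m (j + k)‖ + ‖V m (j + k) - V m j‖ :=
          norm_sub_le_norm_sub_add_norm_sub _ _ _
      _ ≤ _ := by push_cast at *; linarith

theorem norm_sub_le_mul (m m' : ℕ) {j j' : ℤ} (h0 : 0 ≤ j) (hJ : j ≤ J) (h0' : 0 ≤ j')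
    (hJ' : j' ≤ J) : ‖V m j - V m' j'‖ ≤ |(m : ℝ) - m'| * (4 * S.K * (S.K ^ 2 * δ) * (ν * h)) +
      |(j : ℝ) - j'| * (8 * S.K / S.c * (S.K ^ 2 * δ) * h) := by
  have ht : ‖V m j - V m' j‖ ≤ |(m : ℝ) - m'| * (4 * S.K * (S.K ^ 2 * δ) * (ν * h)) := by
    rcases le_total m m' with hm | hm
    · obtain ⟨k, rfl⟩ := Nat.exists_eq_add_of_le hm
      have := H.norm_time_sub_le_mul m k h0 hJ
      rw [norm_sub_rev]
      refine this.trans_eq ?_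
      push_cast
      rw [sub_add_cancel_left, abs_neg, Nat.abs_cast]
    · obtain ⟨k, rfl⟩ := Nat.exists_eq_add_of_le hm
      have := H.norm_time_sub_le_mul m' k h0 hJ
      refine this.trans_eq ?_
      push_cast
      rw [add_sub_cancel_left, Nat.abs_cast]
  have hx : ‖V m' j - V m' j'‖ ≤ |(j : ℝ) - j'| * (8 * S.K / S.c * (S.K ^ 2 * δ) * h) := by
    rcases le_total j j' with hm | hm
    · obtain ⟨k, rfl⟩ := Int.le.dest hm
      have := H.norm_space_sub_le_mul m' k h0 hJ'
      rw [norm_sub_rev]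
      refine this.trans_eq ?_
      push_cast
      rw [sub_add_cancel_left, abs_neg, Nat.abs_cast]
    · obtain ⟨k, rfl⟩ := Int.le.dest hm
      have := H.norm_space_sub_le_mul m' k h0' hJ
      refine this.trans_eq ?_
      push_cast
      rw [add_sub_cancel_left, Nat.abs_cast]
  exact (norm_sub_le_norm_sub_add_norm_sub _ _ _).trans (add_le_add ht hx)

theorem floor_mem {x : ℝ} (hx : x ∈ Icc (-1 : ℝ) 1) :
    0 ≤ ⌊(x + 1) / h⌋ ∧ ⌊(x + 1) / h⌋ ≤ J := by
  have hh := H.h_pos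
  refine ⟨Int.floor_nonneg.2 (div_nonneg (by linarith [hx.1]) hh.le), ?_⟩
  have : (x + 1) / h ≤ J := by
    rw [div_le_iff₀ hh, H.J_mul_h]; linarith [hx.2]
  exact_mod_cast (Int.floor_le _).trans this

theorem norm_gridFun_le {p : ℝ × ℝ} (hp : p ∈ Ici (0 : ℝ) ×ˢ Icc (-1 : ℝ) 1) :
    ‖gridFun (ν * h) h V p‖ ≤ 4 * S.K * (S.K ^ 2 * δ) :=
  H.norm_le (H.bounds _) (H.floor_mem hp.2).1 (H.floor_mem hp.2).2

/-- Rounding down may add one cell in each variable, so the Lipschitz bound holds only up to the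
mesh size, an error that disappears in the limit. -/
theorem norm_gridFun_sub_le {p q : ℝ × ℝ} (hp : p ∈ Ici (0 : ℝ) ×ˢ Icc (-1 : ℝ) 1)
    (hq : q ∈ Ici (0 : ℝ) ×ˢ Icc (-1 : ℝ) 1) :
    ‖gridFun (ν * h) h V p - gridFun (ν * h) h V q‖ ≤ S.lipConst * δ * (dist p q + h) := by
  have hh := H.h_pos
  have hτ := H.τ_pos
  have hK := S.K_pos
  have hc := S.c_pos
  have hM := H.M_nonneg
  have floor_sub : ∀ a b : ℝ, |(⌊a⌋ : ℝ) - ⌊b⌋| ≤ |a - b| + 1 := by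
    intro a b
    have := Int.floor_le a
    have := Int.floor_le b
    have := Int.lt_floor_add_one a
    have := Int.lt_floor_add_one b
    have h1 := abs_le.1 (le_refl |a - b|)
    rw [abs_le]; constructor <;> linarith
  have h1 := H.norm_sub_le_mul ⌊p.1 / (ν * h)⌋₊ ⌊q.1 / (ν * h)⌋₊ (H.floor_mem hp.2).1
    (H.floor_mem hp.2).2 (H.floor_mem hq.2).1 (H.floor_mem hq.2).2
  have h2 := floor_sub ((p.2 + 1) / h) ((q.2 + 1) / h)
  have h3 := floor_sub (p.1 / (ν * h)) (q.1 / (ν * h))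
  have hp1 : (0 : ℝ) ≤ p.1 / (ν * h) := div_nonneg hp.1 hτ.le
  have hq1 : (0 : ℝ) ≤ q.1 / (ν * h) := div_nonneg hq.1 hτ.le
  rw [← natCast_floor_eq_intCast_floor hp1, ← natCast_floor_eq_intCast_floor hq1] at h3
  have e2 : |(p.2 + 1) / h - (q.2 + 1) / h| = |p.2 - q.2| / h := by
    rw [← sub_div, abs_div, abs_of_pos hh]; congr 2; ring
  have e3 : |p.1 / (ν * h) - q.1 / (ν * h)| = |p.1 - q.1| / (ν * h) := by
    rw [← sub_div, abs_div, abs_of_pos hτ]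
  rw [e2] at h2
  rw [e3] at h3
  have d1 : |p.1 - q.1| ≤ dist p q := by rw [Prod.dist_eq, ← Real.dist_eq]; exact le_max_left _ _
  have d2 : |p.2 - q.2| ≤ dist p q := by rw [Prod.dist_eq, ← Real.dist_eq]; exact le_max_right _ _
  have hτh : ν * h ≤ h := mul_le_of_le_one_left hh.le H.ν_le
  calc _ ≤ _ := h1
    _ ≤ (|p.1 - q.1| / (ν * h) + 1) * (4 * S.K * (S.K ^ 2 * δ) * (ν * h)) +
        (|p.2 - q.2| / h + 1) * (8 * S.K / S.c * (S.K ^ 2 * δ) * h) := by gcongr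
    _ = (|p.1 - q.1| + ν * h) * (4 * S.K * (S.K ^ 2 * δ)) +
        (|p.2 - q.2| + h) * (8 * S.K / S.c * (S.K ^ 2 * δ)) := by
        have := hτ.ne'; have := H.ν_pos.ne'
        field_simp
    _ ≤ (dist p q + h) * (4 * S.K * (S.K ^ 2 * δ)) +
        (dist p q + h) * (8 * S.K / S.c * (S.K ^ 2 * δ)) := by gcongr
    _ = _ := by unfold lipConst; ring

theorem abs_inflow_sub_le (m : ℕ) (i : Fin n) :
    |S.L (V m (S.inlet J i)) (V m (S.inlet J i)) i - b m i| ≤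
      32 * S.K ^ 3 * (S.K ^ 2 * δ) * (S.K ^ 2 * δ) * (ν * h) := by
  have h0 : 0 ≤ S.inlet J i := by unfold inlet; split_ifs <;> simp
  have hJ : S.inlet J i ≤ J := by unfold inlet; split_ifs <;> simp
  cases m with
  | zero =>
    rw [H.compat _ i h0 hJ rfl, sub_self, abs_zero]
    have := H.M_nonneg
    have := H.τ_pos
    have := S.K_pos
    positivity
  | succ m =>
    rw [← H.inflow m _ i h0 hJ (H.bounds m _ h0 hJ).1 rfl]
    exact H.self_error (H.bounds m) h0 hJ i

/-- The frozen-coefficient transport equation on a block of grid points. -/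
theorem abs_block_le {v : Fin n → ℝ} (hv : ‖v‖ ≤ S.ρ) (i : Fin n) {m₀ P : ℕ} {j₀ : ℤ}
    (hP : 0 < P) (hmem : ∀ k : ℕ, k ≤ P → 0 ≤ j₀ + S.sg i * k ∧ j₀ + S.sg i * k ≤ J) {η : ℝ}
    (hclose : ∀ m k : ℕ, m ≤ P → k ≤ P → ‖V (m₀ + m) (j₀ + S.sg i * k) - v‖ ≤ η) {α α' β : ℝ}
    (ht : ∀ k : ℕ, k ≤ P →
      |S.L v (V (m₀ + P) (j₀ + S.sg i * k) - V m₀ (j₀ + S.sg i * k)) i - α| ≤ β)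
    (hx : ∀ m : ℕ, m ≤ P →
      |S.L v (V (m₀ + m) (j₀ + S.sg i * P) - V (m₀ + m) j₀) i - α'| ≤ β) :
    |α + ν * S.speed v i * α'| ≤ P * (2 * S.K ^ 2 * S.lipConst * δ * η * (ν * h)) + 2 * β := by
  obtain ⟨a0, a1, -, aK⟩ := H.speed_bounds hv i
  have hη : 0 ≤ η := (norm_nonneg _).trans (hclose 0 0 (by simp) (by simp))
  have hβ : 0 ≤ β := (abs_nonneg _).trans (hx 0 (by simp))
  have hK := S.K_pos
  have hc := S.c_pos
  have hν := H.ν_pos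
  have hh := H.h_pos
  have hM := H.M_nonneg
  have key := abs_transport_block_le (u := fun m k => S.L v (V (m₀ + m) (j₀ + S.sg i * k)) i)
    (e := 2 * S.K ^ 2 * S.lipConst * δ * η * (ν * h)) (α := α) (α' := α') (β := β) hP a0 ?_ ?_ ?_
  · refine key.trans ?_
    have : (1 + ν * S.speed v i) * β ≤ 2 * β := mul_le_mul_of_nonneg_right (by linarith) hβ
    linarith
  · intro m hm k hk
    obtain ⟨j0, jJ⟩ := hmem (k + 1) hk
    have hin : j₀ + S.sg i * (k + 1 : ℕ) ≠ S.inlet J i := by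
      have := hmem k hk.le
      rcases S.sg_cases i with e | e <;> simp [inlet, e] at this ⊢ <;> omega
    have ej : j₀ + S.sg i * (k + 1 : ℕ) - S.sg i = j₀ + S.sg i * k := by push_cast; ring
    have hB := H.bounds (m₀ + m)
    have hw := (hB _ j0 jJ).1
    have up := H.upwind (m₀ + m) _ i j0 jJ hw hin
    have hD := H.norm_upwind_sub_le hB j0 jJ hin
    have hPt := H.norm_time_sub_le hB j0 jJ
    rw [ej] at up hD
    have hcl := hclose m (k + 1) hm.le hk
    generalize j₀ + S.sg i * (k + 1 : ℕ) = j at *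
    generalize j₀ + S.sg i * (k : ℤ) = j' at *
    have hsp : |S.speed v i - S.speed (V (m₀ + m) j) i| ≤ S.K * η :=
      (S.abs_speed_sub_le hv hw i).trans (by rw [norm_sub_rev]; gcongr)
    have l1 := S.abs_L_sub_le hv hw (V (m₀ + m + 1) j - V (m₀ + m) j) i
    have l2 := S.abs_L_sub_le hv hw (V (m₀ + m) j - V (m₀ + m) j') i
    have l3 := S.abs_L_le hw (V (m₀ + m) j - V (m₀ + m) j') i
    rw [norm_sub_rev v] at l1 l2
    -- Freezing the frame and the speed at `v` leaves three errors: frame in time, speed, frame in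
    -- space. Each is of order `η` times a one-step difference of `V`.
    have e : S.L v (V (m₀ + (m + 1)) j) i - S.L v (V (m₀ + m) j) i + ν * S.speed v i *
        (S.L v (V (m₀ + m) j) i - S.L v (V (m₀ + m) j') i) =
        (S.L v (V (m₀ + m + 1) j - V (m₀ + m) j) i -
          S.L (V (m₀ + m) j) (V (m₀ + m + 1) j - V (m₀ + m) j) i) +
        ν * (S.speed v i - S.speed (V (m₀ + m) j) i) *
          S.L (V (m₀ + m) j) (V (m₀ + m) j - V (m₀ + m) j') i +
        ν * S.speed v i * (S.L v (V (m₀ + m) j - V (m₀ + m) j') i -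
          S.L (V (m₀ + m) j) (V (m₀ + m) j - V (m₀ + m) j') i) := by
      rw [up]
      simp only [map_sub, Pi.sub_apply, add_assoc]
      ring
    rw [e]
    have b1 : |S.L v (V (m₀ + m + 1) j - V (m₀ + m) j) i -
          S.L (V (m₀ + m) j) (V (m₀ + m + 1) j - V (m₀ + m) j) i| ≤
        S.K * η * (4 * S.K * (S.K ^ 2 * δ) * (ν * h)) := l1.trans (by gcongr)
    have b2 : |ν * (S.speed v i - S.speed (V (m₀ + m) j) i) *
          S.L (V (m₀ + m) j) (V (m₀ + m) j - V (m₀ + m) j') i| ≤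
        ν * (S.K * η) * (S.K * (8 * S.K / S.c * (S.K ^ 2 * δ) * h)) := by
      rw [abs_mul, abs_mul, abs_of_pos hν]
      exact mul_le_mul (by gcongr) (l3.trans (by gcongr)) (abs_nonneg _) (by positivity)
    have b3 : |ν * S.speed v i * (S.L v (V (m₀ + m) j - V (m₀ + m) j') i -
          S.L (V (m₀ + m) j) (V (m₀ + m) j - V (m₀ + m) j') i)| ≤
        ν * S.K * (S.K * η * (8 * S.K / S.c * (S.K ^ 2 * δ) * h)) := by
      rw [abs_mul, abs_of_nonneg a0]
      exact mul_le_mul aK (l2.trans (by gcongr)) (abs_nonneg _) (by positivity)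
    refine (abs_add_three _ _ _).trans ((add_le_add_three b1 b2 b3).trans ?_)
    have h1 : S.K * η * (4 * S.K * (S.K ^ 2 * δ) * (ν * h)) ≤
        2 * S.K * (S.K * η * (4 * S.K * (S.K ^ 2 * δ) * (ν * h))) :=
      le_mul_of_one_le_left (by positivity) (by linarith [S.one_le_K])
    refine (add_le_add_three h1 le_rfl le_rfl).trans_eq ?_
    unfold lipConst
    ring
  · intro k hk
    simpa [map_sub] using ht (k + 1) hk
  · intro m hm
    simpa [map_sub] using hx m hm.le

end UpwindSolution
end CharSystem

/-! ### Passage to the limit in the scheme -/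

/-- The closed space-time domain `[0,∞) × [-1,1]`. -/
def closedSpaceTime : Set (ℝ × ℝ) := Ici 0 ×ˢ Icc (-1) 1

/-- The nearest-point projection onto the closed space-time domain. -/
def clamp (p : ℝ × ℝ) : ℝ × ℝ := (max p.1 0, max (min p.2 1) (-1))

theorem clamp_mem (p : ℝ × ℝ) : clamp p ∈ closedSpaceTime :=
  ⟨mem_Ici.2 (le_max_right _ _), mem_Icc.2 ⟨le_max_right _ _, max_le (min_le_right _ _) (by norm_num)⟩⟩

theorem clamp_of_mem {p : ℝ × ℝ} (hp : p ∈ closedSpaceTime) : clamp p = p := by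
  obtain ⟨h0, h1, h2⟩ := hp
  exact Prod.ext (max_eq_left h0) (by simp only [clamp, min_eq_left h2, max_eq_left h1])

theorem dist_clamp_le (p q : ℝ × ℝ) : dist (clamp p) (clamp q) ≤ dist p q := by
  have h1 : LipschitzWith (max 1 1) clamp :=
    (LipschitzWith.prod_fst.max_const 0).prodMk ((LipschitzWith.prod_snd.min_const 1).max_const (-1))
  simpa using h1.dist_le_mul p q

theorem isOpen_spaceTime : IsOpen spaceTime := isOpen_Ioi.prod isOpen_Ioo

theorem spaceTime_subset : spaceTime ⊆ closedSpaceTime :=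
  prod_mono Ioi_subset_Ici_self Ioo_subset_Icc_self

namespace CharSystem

variable {n : ℕ} {F : (Fin n → ℝ) → (Fin n → ℝ)} {Ubar : Fin n → ℝ}
    {N : Set (Fin n → ℝ)} {lam : Fin n → (Fin n → ℝ) → ℝ}
    {r : Fin n → (Fin n → ℝ) → (Fin n → ℝ)} (S : CharSystem F Ubar N lam r)

/-- A uniform limit of approximate solutions satisfies the transport equation of each family at
its points of differentiability, up to an error that is small with the block size. -/
theorem abs_transport_le_of_close {ν h δ : ℝ} {J : ℕ} {b : ℕ → Fin n → ℝ}
    {V : ℕ → ℤ → Fin n → ℝ} (H : S.UpwindSolution ν h δ J b V) {v : Fin n → ℝ}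
    (hv : ‖v‖ ≤ S.ρ) (i : Fin n) {p : ℝ × ℝ} {D : ℝ × ℝ →L[ℝ] Fin n → ℝ} {s κ Λ : ℝ}
    (hs : 0 < s) (hκ : 0 ≤ κ) (hball : Metric.closedBall p (2 * s) ⊆ closedSpaceTime)
    (hhs : h ≤ s / 2)
    (hclose : ∀ q ∈ Metric.closedBall p (2 * s), ‖gridFun (ν * h) h V q - v - D (q - p)‖ ≤ κ * s)
    (hlip : ∀ q ∈ Metric.closedBall p (2 * s), ‖gridFun (ν * h) h V q - v‖ ≤ Λ * s) :
    ν * |S.L v (D (1, 0)) i + lam i (Ubar + v) * S.L v (D (0, 1)) i| ≤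
      4 * ν * S.K ^ 2 * S.lipConst * δ * Λ * s + 8 * S.K * κ := by
  have hh := H.h_pos
  have hτ := H.τ_pos
  have hν := H.ν_pos
  have hK := S.K_pos
  have hδ := H.δ_nonneg
  have hl := S.lipConst_pos
  have hp : p ∈ closedSpaceTime := hball (Metric.mem_closedBall_self (by positivity))
  have hΛ : 0 ≤ Λ * s := (norm_nonneg _).trans (hlip p (Metric.mem_closedBall_self (by positivity)))
  have hτh : ν * h ≤ h := mul_le_of_le_one_left hh.le H.ν_le
  -- The block has width `P * h` between `s / 2` and `s`, so dividing by `P * h` later costs only a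
  -- factor 2.
  obtain ⟨P, hPdef⟩ : ∃ P, P = ⌊s / h⌋₊ := ⟨_, rfl⟩
  have hP1 : P * h ≤ s := by
    rw [← le_div_iff₀ hh, hPdef]; exact Nat.floor_le (by positivity)
  have hP2 : s - h < P * h := by
    have := Nat.lt_floor_add_one (s / h)
    rw [← hPdef, div_lt_iff₀ hh] at this
    linarith
  have hP : 0 < P := by
    rw [hPdef]; exact Nat.floor_pos.2 ((one_le_div hh).2 (by linarith))
  have hPr : (0 : ℝ) < P := by exact_mod_cast hP
  obtain ⟨m₀, hm₀⟩ : ∃ m₀, m₀ = ⌊p.1 / (ν * h)⌋₊ := ⟨_, rfl⟩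
  obtain ⟨j₀, hj₀⟩ : ∃ j₀, j₀ = ⌊(p.2 + 1) / h⌋ := ⟨_, rfl⟩
  have m1 : m₀ * (ν * h) ≤ p.1 := by
    rw [← le_div_iff₀ hτ, hm₀]; exact Nat.floor_le (div_nonneg hp.1 hτ.le)
  have m2 : p.1 < (m₀ + 1) * (ν * h) := by
    rw [← div_lt_iff₀ hτ, hm₀]; exact Nat.lt_floor_add_one _
  have j1 : j₀ * h ≤ p.2 + 1 := by rw [← le_div_iff₀ hh, hj₀]; exact Int.floor_le _
  have j2 : p.2 + 1 < (j₀ + 1) * h := by rw [← div_lt_iff₀ hh, hj₀]; exact Int.lt_floor_add_one _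
  -- The block starts in the cell of `p` and extends forward in time and in the direction of
  -- propagation of the family. The radius `2 * s` leaves room for the offset between `p` and the
  -- grid.
  let q : ℕ → ℕ → ℝ × ℝ := fun m k =>
    ((m₀ + m : ℕ) * (ν * h), -1 + (j₀ + S.sg i * k : ℤ) * h)
  have hq : ∀ m k, m ≤ P → k ≤ P → q m k ∈ Metric.closedBall p (2 * s) := by
    intro m k hm hk
    have e1 : (m : ℝ) * (ν * h) ≤ s :=
      (mul_le_mul (by exact_mod_cast hm) hτh hτ.le hPr.le).trans hP1
    have e2 : (k : ℝ) * h ≤ s := (mul_le_mul_of_nonneg_right (by exact_mod_cast hk) hh.le).trans hP1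
    have e3 : (0 : ℝ) ≤ m * (ν * h) := by positivity
    have e4 : (0 : ℝ) ≤ k * h := by positivity
    rw [Metric.mem_closedBall, Prod.dist_eq, max_le_iff, Real.dist_eq, Real.dist_eq, abs_le, abs_le]
    simp only [q]
    push_cast
    refine ⟨⟨by linarith, by linarith⟩, ?_⟩
    rcases S.sg_cases i with e | e <;> rw [e] <;> push_cast <;> constructor <;> linarith
  have hgrid : ∀ m k, gridFun (ν * h) h V (q m k) = V (m₀ + m) (j₀ + S.sg i * k) := fun m k =>
    gridFun_grid hτ hh V _ _
  have hmem : ∀ k : ℕ, k ≤ P → 0 ≤ j₀ + S.sg i * k ∧ j₀ + S.sg i * k ≤ J := by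
    intro k hk
    have := (hball (hq 0 k hP.le hk)).2
    have e := H.floor_mem this
    have e' : (-1 + ((j₀ + S.sg i * k : ℤ) : ℝ) * h + 1) / h = (j₀ + S.sg i * k : ℤ) := by
      field_simp; ring
    simp only [q, e', Int.floor_intCast] at e
    exact e
  have hdiff : ∀ m k m' k', m ≤ P → k ≤ P → m' ≤ P → k' ≤ P →
      |S.L v (V (m₀ + m) (j₀ + S.sg i * k) - V (m₀ + m') (j₀ + S.sg i * k')) i -
        S.L v (D (q m k - q m' k')) i| ≤ 2 * S.K * (κ * s) := by
    intro m k m' k' hm hk hm' hk'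
    have h1 := hclose _ (hq m k hm hk)
    have h2 := hclose _ (hq m' k' hm' hk')
    rw [hgrid] at h1 h2
    rw [← Pi.sub_apply, ← map_sub]
    refine (S.abs_L_le hv _ i).trans ?_
    have e : V (m₀ + m) (j₀ + S.sg i * k) - V (m₀ + m') (j₀ + S.sg i * k') - D (q m k - q m' k') =
        (V (m₀ + m) (j₀ + S.sg i * k) - v - D (q m k - p)) -
        (V (m₀ + m') (j₀ + S.sg i * k') - v - D (q m' k' - p)) := by
      simp only [map_sub]; abel
    rw [e]
    calc _ ≤ S.K * (κ * s + κ * s) := by gcongr; exact (norm_sub_le _ _).trans (add_le_add h1 h2)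
      _ = _ := by ring
  -- `α` and `α'` are the increments of the linear map `D` across the block in time and in space,
  -- seen in the `i`-th component.
  have key := H.abs_block_le hv i (m₀ := m₀) (P := P) (j₀ := j₀) hP hmem (η := Λ * s)
    (α := P * (ν * h) * S.L v (D (1, 0)) i) (α' := S.sg i * (P * h) * S.L v (D (0, 1)) i)
    (β := 2 * S.K * (κ * s)) ?_ ?_ ?_
  · have e : P * (ν * h) * S.L v (D (1, 0)) i + ν * S.speed v i *
        (S.sg i * (P * h) * S.L v (D (0, 1)) i) =
        P * (ν * h) * (S.L v (D (1, 0)) i + lam i (Ubar + v) * S.L v (D (0, 1)) i) := by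
      have : (S.sg i : ℝ) * S.sg i = 1 := by rcases S.sg_cases i with e | e <;> simp [e]
      unfold speed
      linear_combination (P * (ν * h) * (lam i (Ubar + v) * S.L v (D (0, 1)) i)) * this
    rw [e, abs_mul, abs_of_pos (by positivity)] at key
    generalize |S.L v (D (1, 0)) i + lam i (Ubar + v) * S.L v (D (0, 1)) i| = X at key ⊢
    have hPh : s / 2 ≤ P * h := by linarith
    have k2 : ν * (P * h) * X ≤ P * h * (2 * S.K ^ 2 * S.lipConst * δ * Λ * ν * s) +
        P * h * (8 * S.K * κ) := by
      have : 2 * (2 * S.K * (κ * s)) ≤ P * h * (8 * S.K * κ) := by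
        have := mul_le_mul_of_nonneg_right hPh (by positivity : 0 ≤ 8 * S.K * κ)
        linarith
      calc ν * (P * h) * X = P * (ν * h) * X := by ring
        _ ≤ _ := key
        _ ≤ _ := by
          refine add_le_add (le_of_eq ?_) this
          ring
    have k3 : P * h * (ν * X) ≤
        P * h * (2 * S.K ^ 2 * S.lipConst * δ * Λ * ν * s + 8 * S.K * κ) := by linarith
    have k4 := le_of_mul_le_mul_left k3 (by positivity)
    have k5 : 0 ≤ 2 * S.K ^ 2 * S.lipConst * δ * ν * (Λ * s) := by positivity
    linarith
  · intro m k hm hk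
    rw [← hgrid]
    exact hlip _ (hq m k hm hk)
  · intro k hk
    have := hdiff P k 0 k le_rfl hk hP.le hk
    have e : q P k - q 0 k = (P * (ν * h)) • ((1 : ℝ), (0 : ℝ)) := by
      simp [q]; ring
    rw [e, map_smul, map_smul, Pi.smul_apply, smul_eq_mul] at this
    exact this
  · intro m hm
    have := hdiff m P m 0 hm le_rfl hm hP.le
    have e : q m P - q m 0 = (S.sg i * (P * h)) • ((0 : ℝ), (1 : ℝ)) := by
      simp [q]; ring
    rw [e, map_smul, map_smul, Pi.smul_apply, smul_eq_mul] at this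
    simpa using this

/-- For small data, the upwind scheme produces a Lipschitz solution. -/
theorem exists_lipschitz_solution {δ : ℝ} {V0 b : ℝ → Fin n → ℝ} (hd : S.SmallData δ V0 b) :
    ∃ V : ℝ × ℝ → Fin n → ℝ, (∀ p, ‖V p‖ ≤ 4 * S.K * (S.K ^ 2 * δ)) ∧
      (∀ p q, ‖V p - V q‖ ≤ S.lipConst * δ * dist p q) ∧
      (∀ x ∈ Icc (-1 : ℝ) 1, V (0, x) = V0 x) ∧
      (∀ t, 0 ≤ t → ∀ i, S.L (V (t, -S.sg i)) (V (t, -S.sg i)) i = b t i) ∧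
      ∀ p ∈ spaceTime, ∀ D : ℝ × ℝ →L[ℝ] Fin n → ℝ, HasFDerivAt V D p →
        D (1, 0) + fderiv ℝ F (Ubar + V p) (D (0, 1)) = 0 := by
  have hδ := hd.δ_nonneg
  have hK := S.K_pos
  have hl := S.lipConst_pos
  have hν := S.meshRatio_pos
  have hV := S.upwindSolution_approx hd
  have he : Filter.Tendsto (fun J : ℕ => 2 / (J + 1 : ℝ)) Filter.atTop (𝓝 0) := by
    have := (tendsto_one_div_add_atTop_nhds_zero_nat (𝕜 := ℝ)).const_mul 2
    simpa [div_eq_mul_inv] using this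
  obtain ⟨l, V, hlb, hla, hlim, hVb, hVl, hunif⟩ := exists_limit_of_asymptotically_lipschitz
    (D := closedSpaceTime)
    (f := fun J => gridFun (S.meshRatio * (2 / (J + 1 : ℝ))) (2 / (J + 1 : ℝ)) (S.approx V0 b J))
    (B := S.lipConst * δ) (by positivity) (fun J p hp => (hV J).norm_gridFun_le hp) he
    (fun J p hp q hq => (hV J).norm_gridFun_sub_le hp hq)
  have he' := he.mono_left hla
  have hρ : 4 * S.K * (S.K ^ 2 * δ) ≤ S.ρ := by
    have := hd.small_ball
    have : 0 ≤ S.K * (S.K ^ 2 * δ) := by positivity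
    linarith
  have hclampV : ∀ p ∈ closedSpaceTime, V (clamp p) = V p := fun p hp => by rw [clamp_of_mem hp]
  -- Composing with the projection preserves the Lipschitz constant and yields a function on the
  -- whole plane, as needed for Rademacher's theorem.
  refine ⟨fun p => V (clamp p), fun p => hVb _ (clamp_mem p), fun p q => ?_, ?_, ?_, ?_⟩
  · refine (hVl _ (clamp_mem p) _ (clamp_mem q)).trans ?_
    gcongr
    exact dist_clamp_le p q
  · intro x hx
    have hmem : ((0 : ℝ), x) ∈ closedSpaceTime := ⟨mem_Ici.2 le_rfl, hx⟩
    change V (clamp (0, x)) = V0 x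
    rw [hclampV _ hmem]
    refine tendsto_nhds_unique (hlim _ hmem) ?_
    rw [tendsto_iff_norm_sub_tendsto_zero]
    refine squeeze_zero (fun _ => norm_nonneg _) (fun J => ?_) (by simpa using he'.const_mul δ)
    have hh := (hV J).h_pos
    have f1 := Int.floor_le ((x + 1) / (2 / (J + 1 : ℝ)))
    have f2 := Int.lt_floor_add_one ((x + 1) / (2 / (J + 1 : ℝ)))
    have f3 : (0 : ℝ) ≤ ⌊(x + 1) / (2 / (J + 1 : ℝ))⌋ := by
      exact_mod_cast ((hV J).floor_mem hx).1
    have e : gridFun (S.meshRatio * (2 / (J + 1 : ℝ))) (2 / (J + 1 : ℝ)) (S.approx V0 b J) (0, x) =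
        V0 (-1 + ⌊(x + 1) / (2 / (J + 1 : ℝ))⌋ * (2 / (J + 1 : ℝ))) := by
      simp [gridFun, approx, upwindScheme]
    rw [e]
    generalize (⌊(x + 1) / (2 / (J + 1 : ℝ))⌋ : ℝ) = y at *
    rw [le_div_iff₀ hh] at f1
    rw [div_lt_iff₀ hh] at f2
    have := mul_nonneg f3 hh.le
    refine (hd.lip_initial _ ⟨by linarith, by linarith [hx.2]⟩ _ hx).trans ?_
    gcongr
    rw [abs_le]; constructor <;> linarith
  · intro t ht i
    have hmem : (t, -(S.sg i : ℝ)) ∈ closedSpaceTime :=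
      ⟨ht, by rcases S.sg_cases i with e | e <;> simp [e]⟩
    change S.L (V (clamp (t, -S.sg i))) (V (clamp (t, -S.sg i))) i = b t i
    rw [hclampV _ hmem]
    have hc : ContinuousAt (fun v => S.L v v i) (V (t, -S.sg i)) := by
      have := (S.diff_L _ ((hVb _ hmem).trans hρ)).continuousAt
      exact (continuousAt_pi.1 (this.clm_apply continuousAt_id)) i
    refine tendsto_nhds_unique (hc.tendsto.comp (hlim _ hmem)) ?_
    rw [tendsto_iff_norm_sub_tendsto_zero]
    have hlimit : Filter.Tendsto (fun J : ℕ =>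
        (32 * S.K ^ 3 * (S.K ^ 2 * δ) * (S.K ^ 2 * δ) + δ) * (2 / (J + 1 : ℝ))) l (𝓝 0) := by
      simpa using he'.const_mul (32 * S.K ^ 3 * (S.K ^ 2 * δ) * (S.K ^ 2 * δ) + δ)
    refine squeeze_zero (fun _ => norm_nonneg _) (fun J => ?_) hlimit
    have hh := (hV J).h_pos
    have hτ := (hV J).τ_pos
    have hτh : S.meshRatio * (2 / (J + 1 : ℝ)) ≤ 2 / (J + 1 : ℝ) :=
      mul_le_of_le_one_left hh.le (hV J).ν_le
    have e : gridFun (S.meshRatio * (2 / (J + 1 : ℝ))) (2 / (J + 1 : ℝ)) (S.approx V0 b J)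
        (t, -(S.sg i : ℝ)) = S.approx V0 b J ⌊t / (S.meshRatio * (2 / (J + 1 : ℝ)))⌋₊
          (S.inlet (J + 1) i) := by
      have : ⌊(-(S.sg i : ℝ) + 1) / (2 / (J + 1 : ℝ))⌋ = S.inlet (J + 1) i := by
        rcases S.sg_cases i with e | e
        · simp [e, inlet]
        · have : (-((-1 : ℤ) : ℝ) + 1) / (2 / (J + 1 : ℝ)) = ((J + 1 : ℕ) : ℤ) := by
            push_cast; field_simp; norm_num
          simp only [e, inlet, this, Int.floor_intCast]
          simp
      simp only [gridFun, this]
    have h1 := (hV J).abs_inflow_sub_le ⌊t / (S.meshRatio * (2 / (J + 1 : ℝ)))⌋₊ i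
    have f1 := Nat.floor_le (div_nonneg ht hτ.le)
    have f2 := Nat.lt_floor_add_one (t / (S.meshRatio * (2 / (J + 1 : ℝ))))
    simp only [Function.comp_apply, e, Real.norm_eq_abs]
    generalize ⌊t / (S.meshRatio * (2 / (J + 1 : ℝ)))⌋₊ = m at *
    rw [le_div_iff₀ hτ] at f1
    rw [div_lt_iff₀ hτ] at f2
    have h2 : |b (m * (S.meshRatio * (2 / (J + 1 : ℝ)))) i - b t i| ≤ δ * (2 / (J + 1 : ℝ)) := by
      refine (norm_le_pi_norm (b (m * (S.meshRatio * (2 / (J + 1 : ℝ)))) - b t) i).trans ?_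
      refine (hd.lip_data _ (by positivity) _ ht).trans ?_
      gcongr
      rw [abs_le]; constructor <;> linarith
    refine (abs_sub_le _ _ _).trans ((add_le_add h1 h2).trans ?_)
    rw [add_mul]
    gcongr
  · intro p hp D hD
    have hpc := spaceTime_subset hp
    change D (1, 0) + fderiv ℝ F (Ubar + V (clamp p)) (D (0, 1)) = 0
    have hD0 := hD
    rw [hclampV p hpc]
    set v := V p with hvdef
    have hv : ‖v‖ ≤ S.ρ := (hVb p hpc).trans hρ
    suffices h : ∀ i, S.L v (D (1, 0)) i + lam i (Ubar + v) * S.L v (D (0, 1)) i = 0 by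
      have h0 : S.L v (D (1, 0) + fderiv ℝ F (Ubar + v) (D (0, 1))) = 0 := by
        ext i
        rw [map_add, Pi.add_apply, S.eigen v hv, h i]; rfl
      have := S.norm_le v hv (D (1, 0) + fderiv ℝ F (Ubar + v) (D (0, 1)))
      rw [h0, norm_zero, mul_zero] at this
      exact norm_le_zero_iff.1 this
    intro i
    obtain ⟨s₀, hs₀, hball⟩ : ∃ s₀ > 0, Metric.closedBall p s₀ ⊆ spaceTime :=
      Metric.nhds_basis_closedBall.mem_iff.1 (isOpen_spaceTime.mem_nhds hp)
    set X := |S.L v (D (1, 0)) i + lam i (Ubar + v) * S.L v (D (0, 1)) i| with hX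
    obtain ⟨C, hC⟩ : ∃ C, C = 4 * S.meshRatio * S.K ^ 2 * S.lipConst * δ * (1 + S.lipConst * δ * 2) +
      8 * S.K * 3 := ⟨_, rfl⟩
    have hC0 : 0 ≤ C := by rw [hC]; positivity
    have key : ∀ κ : ℝ, 0 < κ → κ ≤ 1 → S.meshRatio * X ≤ C * κ := by
      intro κ hκ hκ1
      have h1 := hasFDerivAt_iff_isLittleO_nhds_zero.1 hD
      have h2 := h1.def hκ
      obtain ⟨s₁, hs₁, hs₁b⟩ := Metric.eventually_nhds_iff.1 h2
      obtain ⟨s, hs, hsκ, hss0, hss1⟩ : ∃ s > 0, s ≤ κ ∧ 2 * s ≤ s₀ ∧ 2 * s < s₁ :=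
        ⟨min κ (min (s₀ / 2) (s₁ / 4)), by positivity, by simp,
          by have : min κ (min (s₀ / 2) (s₁ / 4)) ≤ s₀ / 2 := by simp
             linarith,
          by have : min κ (min (s₀ / 2) (s₁ / 4)) ≤ s₁ / 4 := by simp
             linarith⟩
      have hsub : Metric.closedBall p (2 * s) ⊆ closedSpaceTime :=
        (Metric.closedBall_subset_closedBall hss0).trans (hball.trans spaceTime_subset)
      have ev1 := hunif _ hsub (isCompact_closedBall p (2 * s)) (κ * s) (by positivity)
      have ev2 : ∀ᶠ J : ℕ in l, 2 / (J + 1 : ℝ) < s / 2 := he'.eventually_lt_const (by positivity)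
      obtain ⟨J, hJ1, hJ2⟩ := (ev1.and ev2).exists
      -- The error `3 * κ * s` consists of `κ * s` from uniform convergence and `κ * (2 * s)` from
      -- differentiability on the ball of radius `2 * s`.
      have := S.abs_transport_le_of_close (hV J) hv i (p := p) (D := D) (s := s) (κ := 3 * κ)
        (Λ := 1 + S.lipConst * δ * 2) hs (by positivity) hsub hJ2.le ?_ ?_
      · refine this.trans ?_
        rw [hC, add_mul]
        refine add_le_add ?_ (le_of_eq (by ring))
        gcongr
      · intro q hq
        have a1 := hJ1 q hq
        have hqp : ‖q - p‖ ≤ 2 * s := by rwa [← dist_eq_norm]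
        have a2 := hs₁b (y := q - p) (by rw [dist_zero_right]; linarith)
        rw [add_sub_cancel, hclampV q (hsub hq), hclampV p hpc] at a2
        calc _ = ‖(gridFun (S.meshRatio * (2 / (J + 1 : ℝ))) (2 / (J + 1 : ℝ)) (S.approx V0 b J) q
              - V q) + (V q - V p - D (q - p))‖ := by congr 1; rw [hvdef]; abel
          _ ≤ κ * s + κ * (2 * s) :=
            (norm_add_le _ _).trans (add_le_add a1 (a2.trans (by gcongr)))
          _ = 3 * κ * s := by ring
      · intro q hq
        have a1 := hJ1 q hq
        have a2 := hVl q (hsub hq) p hpc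
        have hqp : dist q p ≤ 2 * s := hq
        calc _ = ‖(gridFun (S.meshRatio * (2 / (J + 1 : ℝ))) (2 / (J + 1 : ℝ)) (S.approx V0 b J) q
              - V q) + (V q - V p)‖ := by congr 1; rw [hvdef]; abel
          _ ≤ 1 * s + S.lipConst * δ * (2 * s) :=
            (norm_add_le _ _).trans (add_le_add (a1.trans (by gcongr)) (a2.trans (by gcongr)))
          _ = _ := by ring
    have hlimit : S.meshRatio * X ≤ 0 := by
      have ht : Filter.Tendsto (fun κ : ℝ => C * κ) (𝓝[>] 0) (𝓝 (C * 0)) :=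
        ((continuous_const.mul continuous_id).tendsto 0).mono_left nhdsWithin_le_nhds
      rw [mul_zero] at ht
      refine ge_of_tendsto ht ?_
      filter_upwards [Ioc_mem_nhdsGT (zero_lt_one (α := ℝ))] with κ hκ using key κ hκ.1 hκ.2
    have : X ≤ 0 := nonpos_of_mul_nonpos_right hlimit hν
    exact abs_eq_zero.1 (le_antisymm this (abs_nonneg _))

end CharSystem

set_option linter.unusedSectionVars false

/-! ### Mollification and weak derivatives -/

section Mollification

variable {H E : Type*} [NormedAddCommGroup H] [NormedSpace ℝ H] [FiniteDimensional ℝ H]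
  [MeasureSpace H] [BorelSpace H] [(volume : Measure H).IsAddHaarMeasure]
  [NormedAddCommGroup E] [NormedSpace ℝ E] [CompleteSpace E]

/-- A smooth probability density supported in the ball of radius `ε`. -/
structure IsMollifier (η : H → ℝ) (ε : ℝ) : Prop where
  smooth : ContDiff ℝ ∞ η
  compact : HasCompactSupport η
  nonneg : ∀ x, 0 ≤ η x
  integral : ∫ x, η x = 1
  support : tsupport η ⊆ Metric.closedBall 0 ε

theorem exists_isMollifier {ε : ℝ} (hε : 0 < ε) : ∃ η : H → ℝ, IsMollifier η ε := by
  let f : ContDiffBump (0 : H) := ⟨ε / 2, ε, by positivity, by linarith⟩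
  exact ⟨f.normed volume, f.contDiff_normed, f.hasCompactSupport_normed, f.nonneg_normed,
    f.integral_normed, (f.tsupport_normed_eq).le⟩

/-- The average of `u` over `Ω` with respect to the density `η` centred at `p`. -/
def mollify (η : H → ℝ) (Ω : Set H) (u : H → E) (p : H) : E := ∫ q in Ω, η (p - q) • u q

namespace IsMollifier

variable {η : H → ℝ} {ε : ℝ} (hη : IsMollifier η ε) {Ω : Set H} {u g : H → E} {B : ℝ} {p : H}
include hη

theorem integrable_sub (p : H) : Integrable fun q => η (p - q) :=
  (hη.smooth.continuous.integrable_of_hasCompactSupport hη.compact).comp_sub_left p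

theorem integral_density (p : H) : ∫ q, η (p - q) = 1 := by
  rw [integral_sub_left_eq_self]; exact hη.integral

theorem eq_zero_of_notMem {q : H} (hq : q ∉ Metric.closedBall p ε) : η (p - q) = 0 := by
  by_contra h
  have := hη.support (subset_tsupport η h)
  rw [mem_closedBall_zero_iff, ← dist_eq_norm, dist_comm] at this
  exact hq this

theorem integrable_smul (hu : AEStronglyMeasurable u (volume.restrict Ω))
    (hB : ∀ᵐ q ∂volume.restrict Ω, ‖u q‖ ≤ B) (p : H) :
    Integrable (fun q => η (p - q) • u q) (volume.restrict Ω) := by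
  refine ((hη.integrable_sub p).restrict.const_mul B).mono'
    ((hη.integrable_sub p).restrict.aestronglyMeasurable.smul hu) ?_
  filter_upwards [hB] with q hq
  rw [norm_smul, Real.norm_of_nonneg (hη.nonneg _), mul_comm]
  exact mul_le_mul_of_nonneg_right hq (hη.nonneg _)

theorem norm_integral_smul_le (hB0 : 0 ≤ B)
    (hB : ∀ᵐ q ∂volume.restrict Ω, q ∈ Metric.closedBall p ε → ‖u q‖ ≤ B) :
    ‖∫ q in Ω, η (p - q) • u q‖ ≤ B := by
  calc ‖∫ q in Ω, η (p - q) • u q‖ ≤ ∫ q in Ω, B * η (p - q) := by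
        refine norm_integral_le_of_norm_le ((hη.integrable_sub p).restrict.const_mul B) ?_
        filter_upwards [hB] with q hq
        by_cases h : q ∈ Metric.closedBall p ε
        · rw [norm_smul, Real.norm_of_nonneg (hη.nonneg _), mul_comm]
          exact mul_le_mul_of_nonneg_right (hq h) (hη.nonneg _)
        · simp [hη.eq_zero_of_notMem h]
    _ ≤ ∫ q, B * η (p - q) := by
        refine setIntegral_le_integral ((hη.integrable_sub p).const_mul B) ?_
        exact Filter.Eventually.of_forall fun q => mul_nonneg hB0 (hη.nonneg _)
    _ = B := by rw [integral_const_mul, hη.integral_density, mul_one]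

theorem norm_mollify_sub_le (hu : AEStronglyMeasurable u (volume.restrict Ω))
    (huB : ∀ᵐ q ∂volume.restrict Ω, ‖u q‖ ≤ B) (hp : Metric.closedBall p ε ⊆ Ω) {y : E} {d : ℝ}
    (hd0 : 0 ≤ d) (hd : ∀ q ∈ Metric.closedBall p ε, ‖u q - y‖ ≤ d) :
    ‖mollify η Ω u p - y‖ ≤ d := by
  have h1 : ∫ q in Ω, η (p - q) • y = y := by
    rw [setIntegral_eq_integral_of_forall_compl_eq_zero, integral_smul_const, hη.integral_density,
      one_smul]
    intro q hq
    rw [hη.eq_zero_of_notMem fun h => hq (hp h), zero_smul]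
  have h2 : mollify η Ω u p - y = ∫ q in Ω, η (p - q) • (u q - y) := by
    conv_lhs => rw [← h1]
    rw [mollify, ← integral_sub (hη.integrable_smul hu huB p)
      ((hη.integrable_sub p).restrict.smul_const y)]
    simp only [smul_sub]
  rw [h2]
  exact hη.norm_integral_smul_le hd0 (Filter.Eventually.of_forall hd)

/-- Extended by zero outside `Ω`, `u` is locally integrable, and `mollify` becomes a convolution
with a smooth kernel; it is therefore differentiable everywhere, even near the boundary of `Ω`. -/
theorem hasFDerivAt_mollify (hΩ : MeasurableSet Ω)
    (hu : AEStronglyMeasurable u (volume.restrict Ω))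
    (huB : ∀ᵐ q ∂volume.restrict Ω, ‖u q‖ ≤ B) (p : H) :
    ∃ D : H →L[ℝ] E, HasFDerivAt (mollify η Ω u) D p ∧
      ∀ v, D v = ∫ q in Ω, fderiv ℝ η (p - q) v • u q := by
  have hloc : LocallyIntegrable (Ω.indicator u) := by
    have hm : AEStronglyMeasurable (Ω.indicator u) :=
      (aestronglyMeasurable_indicator_iff hΩ).2 hu
    refine (locallyIntegrable_const B).mono hm ?_
    have := (ae_restrict_iff' hΩ).1 huB
    filter_upwards [this] with q hq
    by_cases h : q ∈ Ω
    · rw [indicator_of_mem h]; exact (hq h).trans (le_abs_self B)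
    · rw [indicator_of_notMem h]; simp
  have hsm : ContDiff ℝ 1 η := hη.smooth.of_le (by norm_cast)
  have h := hη.compact.hasFDerivAt_convolution_left (μ := volume) (ContinuousLinearMap.lsmul ℝ ℝ)
    hsm hloc p
  have e : convolution η (Ω.indicator u) (ContinuousLinearMap.lsmul ℝ ℝ) volume =
      mollify η Ω u := by
    ext p
    rw [convolution_eq_swap, mollify, ← integral_indicator hΩ]
    congr 1 with q
    by_cases h : q ∈ Ω <;> simp [h]
  rw [e] at h
  refine ⟨_, h, fun v => ?_⟩
  have hex := (hη.compact.fderiv (𝕜 := ℝ)).convolutionExists_left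
    ((ContinuousLinearMap.lsmul ℝ ℝ : ℝ →L[ℝ] E →L[ℝ] E).precompL H)
    (hsm.continuous_fderiv (by simp)) hloc p
  rw [convolution_eq_swap, ContinuousLinearMap.integral_apply hex.integrable_swap, ← integral_indicator hΩ]
  congr 1 with q
  by_cases h : q ∈ Ω <;> simp [h, ContinuousLinearMap.precompL_apply]

/-- The derivatives of the mollification are the mollifications of the weak derivatives. -/
theorem fderiv_mollify (hΩ : MeasurableSet Ω)
    (huB : ∀ᵐ q ∂volume.restrict Ω, ‖u q‖ ≤ B) {v : H} (hw : IsWeakDeriv Ω v u g)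
    (hp : Metric.closedBall p ε ⊆ Ω) :
    fderiv ℝ (mollify η Ω u) p v = ∫ q in Ω, η (p - q) • g q := by
  obtain ⟨D, hD, hDv⟩ := hη.hasFDerivAt_mollify hΩ hw.1.aestronglyMeasurable huB p
  rw [hD.fderiv, hDv]
  have hdiff : Differentiable ℝ η := hη.smooth.differentiable (by simp)
  have hder : ∀ q, fderiv ℝ (fun q => η (p - q)) q v = -fderiv ℝ η (p - q) v := by
    intro q
    have h1 : HasFDerivAt (fun q => p - q) (-ContinuousLinearMap.id ℝ H) q :=
      (hasFDerivAt_id q).const_sub p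
    have h2 := (hdiff (p - q)).hasFDerivAt.comp q h1
    have h3 : fderiv ℝ (fun q => η (p - q)) q = _ := h2.fderiv
    rw [h3]; simp
  have htest : IsTestFunction Ω fun q => η (p - q) := by
    have hts : tsupport (fun q => η (p - q)) ⊆ Metric.closedBall p ε := by
      refine closure_minimal (fun q hq => ?_) Metric.isClosed_closedBall
      by_contra h
      exact hq (hη.eq_zero_of_notMem h)
    exact ⟨hη.smooth.comp (contDiff_const.sub contDiff_id),
      HasCompactSupport.of_support_subset_isCompact (isCompact_closedBall p ε)
        ((subset_tsupport _).trans hts), hts.trans hp⟩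
  have := hw.2.2 _ htest
  simp only [hder, neg_smul, integral_neg] at this
  exact neg_injective this

theorem differentiable_mollify (hΩ : MeasurableSet Ω)
    (hu : AEStronglyMeasurable u (volume.restrict Ω))
    (huB : ∀ᵐ q ∂volume.restrict Ω, ‖u q‖ ≤ B) : Differentiable ℝ (mollify η Ω u) := fun p => by
  obtain ⟨D, hD, -⟩ := hη.hasFDerivAt_mollify hΩ hu huB p
  exact hD.differentiableAt

end IsMollifier

theorem ae_norm_le_of_LinfNorm_le {Ω : Set H} {u : H → E} {B : ℝ} (hB : 0 ≤ B)
    (h : LinfNorm Ω u ≤ ENNReal.ofReal B) : ∀ᵐ q ∂volume.restrict Ω, ‖u q‖ ≤ B := by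
  rw [LinfNorm, eLpNorm_exponent_top] at h
  filter_upwards [ae_le_eLpNormEssSup (f := u) (μ := volume.restrict Ω)] with q hq
  have := hq.trans h
  rwa [← ofReal_norm, ENNReal.ofReal_le_ofReal_iff hB] at this

theorem LinfNorm_le_of_norm_le {Ω : Set H} {u : H → E} {B : ℝ}
    (h : ∀ᵐ q ∂volume.restrict Ω, ‖u q‖ ≤ B) : LinfNorm Ω u ≤ ENNReal.ofReal B := by
  rw [LinfNorm, eLpNorm_exponent_top]
  refine eLpNormEssSup_le_of_ae_enorm_bound ?_
  filter_upwards [h] with q hq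
  rw [← ofReal_norm]
  exact ENNReal.ofReal_le_ofReal hq

/-- An average over a small ball is bounded by `B` through the almost everywhere bound, and is close
to `u p` by continuity. -/
theorem norm_le_of_ae_norm_le {Ω : Set H} (hΩ : IsOpen Ω) {u : H → E} (hu : ContinuousOn u Ω)
    {B : ℝ} (hB : 0 ≤ B) (h : ∀ᵐ q ∂volume.restrict Ω, ‖u q‖ ≤ B) : ∀ p ∈ Ω, ‖u p‖ ≤ B := by
  intro p hp
  refine le_of_forall_pos_le_add fun d hd => ?_
  have h1 := (hu.continuousAt (hΩ.mem_nhds hp)).sub_const (u p) |>.norm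
  simp only [sub_self, norm_zero] at h1
  have h2 : ∀ᶠ q in 𝓝 p, ‖u q - u p‖ < d := by
    refine h1.eventually_lt continuousAt_const (by simpa using hd)
  obtain ⟨ε, hε, hεb⟩ := Metric.nhds_basis_closedBall.mem_iff.1 (h2.and (hΩ.mem_nhds hp))
  obtain ⟨η, hη⟩ := exists_isMollifier (H := H) hε
  have hm := hu.aestronglyMeasurable hΩ.measurableSet (μ := volume)
  have a1 := hη.norm_mollify_sub_le hm h (fun q hq => (hεb hq).2) hd.le
    (y := u p) (fun q hq => (hεb hq).1.le)
  have a2 := hη.norm_integral_smul_le (p := p) hB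
    (h.mono fun q hq _ => hq)
  calc ‖u p‖ = ‖mollify η Ω u p - (mollify η Ω u p - u p)‖ := by congr 1; abel
    _ ≤ B + d := (norm_sub_le _ _).trans (add_le_add a2 a1)

end Mollification

section Interval

variable {E : Type*} [NormedAddCommGroup E] [NormedSpace ℝ E] [CompleteSpace E]

/-- A continuous function on an open interval with a bounded weak derivative is Lipschitz. -/
theorem norm_sub_le_of_isWeakDeriv {J : Set ℝ} (hJ : IsOpen J) (hJc : Convex ℝ J) {u g : ℝ → E}
    (hu : ContinuousOn u J) {A B : ℝ} (hA : ∀ᵐ q ∂volume.restrict J, ‖u q‖ ≤ A) (hB0 : 0 ≤ B)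
    (hB : ∀ᵐ q ∂volume.restrict J, ‖g q‖ ≤ B) (hw : IsWeakDeriv J 1 u g) :
    ∀ x ∈ J, ∀ y ∈ J, ‖u x - u y‖ ≤ B * |x - y| := by
  intro x hx y hy
  refine le_of_forall_pos_le_add fun d hd => ?_
  have hnear : ∀ z ∈ J, ∀ᶠ q in 𝓝 z, ‖u q - u z‖ < d / 2 := by
    intro z hz
    have h1 := (hu.continuousAt (hJ.mem_nhds hz)).sub_const (u z) |>.norm
    simp only [sub_self, norm_zero] at h1
    exact h1.eventually_lt continuousAt_const (by simpa using hd)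
  have hseg : segment ℝ x y ⊆ J := hJc.segment_subset hx hy
  have hcs : IsCompact (segment ℝ x y) := by
    rw [segment_eq_uIcc]; exact isCompact_uIcc
  -- With a radius small for the whole segment, the derivative of the mollification along it is an
  -- average of `g`, and the mean value inequality applies.
  obtain ⟨ε₀, hε₀, hth⟩ := hcs.exists_cthickening_subset_open hJ hseg
  obtain ⟨ε₁, hε₁, hb₁⟩ := Metric.nhds_basis_closedBall.mem_iff.1 (hnear x hx)
  obtain ⟨ε₂, hε₂, hb₂⟩ := Metric.nhds_basis_closedBall.mem_iff.1 (hnear y hy)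
  obtain ⟨ε, hε, h0, h1, h2⟩ : ∃ ε > 0, ε ≤ ε₀ ∧ ε ≤ ε₁ ∧ ε ≤ ε₂ :=
    ⟨min ε₀ (min ε₁ ε₂), by positivity, by simp, by simp, by simp⟩
  have hball : ∀ z ∈ segment ℝ x y, Metric.closedBall z ε ⊆ J := fun z hz =>
    (Metric.closedBall_subset_closedBall h0).trans
      ((Metric.closedBall_subset_cthickening hz ε₀).trans hth)
  obtain ⟨η, hη⟩ := exists_isMollifier (H := ℝ) hε
  have hm := hJ.measurableSet
  have hx' := hη.norm_mollify_sub_le hw.1.aestronglyMeasurable hA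
    (hball x (left_mem_segment ℝ x y)) (y := u x) (d := d / 2) (by positivity)
    (fun q hq => (hb₁ (Metric.closedBall_subset_closedBall h1 hq)).le)
  have hy' := hη.norm_mollify_sub_le hw.1.aestronglyMeasurable hA
    (hball y (right_mem_segment ℝ x y)) (y := u y) (d := d / 2) (by positivity)
    (fun q hq => (hb₂ (Metric.closedBall_subset_closedBall h2 hq)).le)
  have hdiff := hη.differentiable_mollify hm hw.1.aestronglyMeasurable hA
  have hlip : ‖mollify η J u x - mollify η J u y‖ ≤ B * ‖x - y‖ := by
    refine (convex_segment x y).norm_image_sub_le_of_norm_deriv_le (fun z _ => hdiff z) ?_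
      (right_mem_segment ℝ x y) (left_mem_segment ℝ x y)
    intro z hz
    rw [← fderiv_apply_one_eq_deriv, hη.fderiv_mollify hm hA hw (hball z hz)]
    exact hη.norm_integral_smul_le hB0 (hB.mono fun q hq _ => hq)
  rw [Real.norm_eq_abs] at hlip
  calc ‖u x - u y‖ = ‖(mollify η J u x - mollify η J u y) - (mollify η J u x - u x) +
        (mollify η J u y - u y)‖ := by congr 1; abel
    _ ≤ B * |x - y| + d / 2 + d / 2 :=
        (norm_add_le _ _).trans (add_le_add ((norm_sub_le _ _).trans (add_le_add hlip hx')) hy')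
    _ = _ := by ring

/-- A bound for the `W^{1,∞}` norm of a continuous function on an interval bounds the function and
its Lipschitz constant. -/
theorem norm_le_and_lipschitz_of_W1infNorm_le {J : Set ℝ} (hJ : IsOpen J) (hJc : Convex ℝ J)
    {u : ℝ → E} (hu : ContinuousOn u (closure J)) {δ : ℝ} (hδ : 0 ≤ δ)
    (h : W1infNorm J u ≤ ENNReal.ofReal δ) :
    (∀ x ∈ closure J, ‖u x‖ ≤ δ) ∧
      ∀ x ∈ closure J, ∀ y ∈ closure J, ‖u x - u y‖ ≤ δ * |x - y| := by
  have huJ := hu.mono subset_closure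
  have h1 : LinfNorm J u ≤ ENNReal.ofReal δ := le_self_add.trans h
  have h2 : ⨅ (g : ℝ → E) (_ : IsWeakDeriv J 1 u g), LinfNorm J g ≤ ENNReal.ofReal δ :=
    le_add_self.trans h
  have hA := ae_norm_le_of_LinfNorm_le hδ h1
  constructor
  · intro x hx
    exact le_on_closure (norm_le_of_ae_norm_le hJ huJ hδ hA) hu.norm continuousOn_const hx
  · have hlip : ∀ x ∈ J, ∀ y ∈ J, ‖u x - u y‖ ≤ δ * |x - y| := by
      intro x hx y hy
      -- The norm is an infimum over weak derivatives, which need not be known to be attained; the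
      -- slack `d` is removed by a limit.
      have key : ∀ d > 0, ‖u x - u y‖ ≤ (δ + d) * |x - y| := by
        intro d hd
        have h3 : ⨅ (g : ℝ → E) (_ : IsWeakDeriv J 1 u g), LinfNorm J g <
            ENNReal.ofReal (δ + d) :=
          h2.trans_lt ((ENNReal.ofReal_lt_ofReal_iff (by linarith)).2 (by linarith))
        obtain ⟨g, hg⟩ := iInf_lt_iff.1 h3
        obtain ⟨hw, hg⟩ := iInf_lt_iff.1 hg
        exact norm_sub_le_of_isWeakDeriv hJ hJc huJ hA (by linarith)
          (ae_norm_le_of_LinfNorm_le (by linarith) hg.le) hw x hx y hy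
      have ht : Filter.Tendsto (fun d : ℝ => (δ + d) * |x - y|) (𝓝[>] 0)
          (𝓝 ((δ + 0) * |x - y|)) :=
        (((continuous_const.add continuous_id).mul continuous_const).tendsto 0).mono_left
          nhdsWithin_le_nhds
      rw [add_zero] at ht
      exact ge_of_tendsto ht (eventually_mem_nhdsWithin.mono fun d hd => key d hd)
    have hl : LipschitzOnWith δ.toNNReal u J := LipschitzOnWith.of_dist_le_mul fun x hx y hy => by
      rw [dist_eq_norm, Real.dist_eq, Real.coe_toNNReal _ hδ]; exact hlip x hx y hy
    have hl' := hl.closure hu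
    intro x hx y hy
    have := hl'.dist_le_mul x hx y hy
    rwa [dist_eq_norm, Real.dist_eq, Real.coe_toNNReal _ hδ] at this

end Interval

/-! ### Lipschitz functions as elements of `W^{1,∞}` -/

section Rademacher

variable {H : Type*} [NormedAddCommGroup H] [NormedSpace ℝ H] [FiniteDimensional ℝ H]
  [MeasureSpace H] [BorelSpace H] [(volume : Measure H).IsAddHaarMeasure] {n : ℕ}

/-- The almost everywhere derivative of a Lipschitz function is its weak derivative. -/
theorem isWeakDeriv_lineDeriv {f : H → Fin n → ℝ} {C : NNReal} (hf : LipschitzWith C f)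
    (Ω : Set H) (v : H) : IsWeakDeriv Ω v f fun p => lineDeriv ℝ f p v := by
  have hfl : LocallyIntegrable f := hf.continuous.locallyIntegrable
  have hgl : LocallyIntegrable fun p => lineDeriv ℝ f p v := by
    refine (locallyIntegrable_const (C * ‖v‖)).mono
      (measurable_lineDeriv hf.continuous).aestronglyMeasurable ?_
    exact Filter.Eventually.of_forall fun p =>
      (norm_lineDeriv_le_of_lipschitz ℝ hf).trans (le_abs_self _)
  refine ⟨hfl.locallyIntegrableOn _, hgl.locallyIntegrableOn _, fun φ hφ => ?_⟩
  obtain ⟨hφs, hφc, hφt⟩ := hφ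
  have hφ1 : ContDiff ℝ 1 φ := hφs.of_le (by norm_cast)
  have hφd : Differentiable ℝ φ := hφ1.differentiable (by simp)
  obtain ⟨D, hD⟩ := hφ1.lipschitzWith_of_hasCompactSupport hφc (by simp)
  have hz : ∀ p ∉ Ω, φ p = 0 := fun p hp => by
    by_contra h
    exact hp (hφt (subset_tsupport φ h))
  have hz' : ∀ p ∉ Ω, fderiv ℝ φ p = 0 := fun p hp =>
    Function.notMem_support.1 fun h => hp (hφt (support_fderiv_subset ℝ h))
  rw [setIntegral_eq_integral_of_forall_compl_eq_zero (fun p hp => by simp [hz' p hp]),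
    setIntegral_eq_integral_of_forall_compl_eq_zero (fun p hp => by simp [hz p hp])]
  have hi1 : Integrable fun p => fderiv ℝ φ p v • f p := by
    refine hfl.integrable_smul_left_of_hasCompactSupport
      ((hφ1.continuous_fderiv (by simp)).clm_apply continuous_const) ?_
    exact (hφc.fderiv (𝕜 := ℝ)).comp_left (g := fun L : H →L[ℝ] ℝ => L v) (by simp)
  have hi2 : Integrable fun p => φ p • lineDeriv ℝ f p v :=
    hgl.integrable_smul_left_of_hasCompactSupport hφ1.continuous hφc
  ext i
  have hfi : LipschitzWith C fun p => f p i := by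
    have := (LipschitzWith.eval (α := fun _ : Fin n => ℝ) i).comp hf
    rwa [one_mul] at this
  have h1 := hfi.integral_lineDeriv_mul_eq (μ := volume) hD hφc v
  have e1 : (∫ p, fderiv ℝ φ p v • f p) i = ∫ p, fderiv ℝ φ p v * f p i :=
    ((ContinuousLinearMap.proj i : (Fin n → ℝ) →L[ℝ] ℝ).integral_comp_comm hi1).symm
  have e2 : (∫ p, φ p • lineDeriv ℝ f p v) i = ∫ p, φ p * lineDeriv ℝ f p v i :=
    ((ContinuousLinearMap.proj i : (Fin n → ℝ) →L[ℝ] ℝ).integral_comp_comm hi2).symm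
  rw [Pi.neg_apply, e1, e2]
  -- Taking a component commutes with the line derivative only at points of differentiability, which
  -- is almost everywhere by Rademacher's theorem.
  have e3 : ∫ p, φ p * lineDeriv ℝ f p v i = ∫ p, lineDeriv ℝ (fun p => f p i) p v * φ p := by
    refine integral_congr_ae ?_
    filter_upwards [hf.ae_differentiableAt (μ := volume)] with p hp
    have : lineDeriv ℝ (fun p => f p i) p v = lineDeriv ℝ f p v i :=
      HasLineDerivAt.lineDeriv (𝕜 := ℝ) (f := fun p => f p i)
        (hasDerivAt_pi.1 (hp.lineDifferentiableAt (v := v)).hasLineDerivAt i)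
    rw [this, mul_comm]
  rw [e3, h1, ← integral_neg]
  congr 1 with p
  rw [(hφd p).lineDeriv_eq_fderiv, map_neg, neg_mul, neg_neg]

theorem LinfNorm_lineDeriv_le {f : H → Fin n → ℝ} {C : NNReal} (hf : LipschitzWith C f)
    (Ω : Set H) (v : H) : LinfNorm Ω (fun p => lineDeriv ℝ f p v) ≤ ENNReal.ofReal (C * ‖v‖) :=
  LinfNorm_le_of_norm_le (Filter.Eventually.of_forall fun _ => norm_lineDeriv_le_of_lipschitz ℝ hf)

theorem W1infNorm_le_of_lipschitz (J : Set ℝ) {f : ℝ → Fin n → ℝ} {A : ℝ}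
    {C : NNReal} (hA : ∀ x, ‖f x‖ ≤ A) (hf : LipschitzWith C f) :
    W1infNorm J f ≤ ENNReal.ofReal A + ENNReal.ofReal C := by
  refine add_le_add (LinfNorm_le_of_norm_le (Filter.Eventually.of_forall hA)) ?_
  refine (iInf₂_le _ (isWeakDeriv_lineDeriv hf J 1)).trans ?_
  simpa using LinfNorm_lineDeriv_le hf J 1

end Rademacher

/-! ### Uniqueness by a maximum principle along characteristics -/

/-- The space-time rectangle at distance `δ` from the parabolic boundary, up to time `T`. -/
def innerRectangle (δ T : ℝ) : Set (ℝ × ℝ) := Icc δ T ×ˢ Icc (-1 + δ) (1 - δ)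

theorem isCompact_innerRectangle (δ T : ℝ) : IsCompact (innerRectangle δ T) :=
  isCompact_Icc.prod isCompact_Icc

/-- `V'` is a differentiable approximation of `V` on the inner rectangle that solves the system
with coefficients `A(Ubar + V)` up to an error `η`. -/
structure IsSmoothApprox {n : ℕ} (F : (Fin n → ℝ) → (Fin n → ℝ)) (Ubar : Fin n → ℝ)
    (V V' : ℝ × ℝ → Fin n → ℝ) (δ T M η : ℝ) : Prop where
  diff : Differentiable ℝ V'
  -- The point `q` may lie on the boundary of the domain, so the edges of the rectangle inherit the
  -- initial and inflow data.
  close : ∀ p ∈ innerRectangle δ T, ∀ q ∈ closedSpaceTime, q.1 ≤ T → dist p q ≤ δ →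
    ‖V' p - V q‖ ≤ η
  norm_t : ∀ p ∈ innerRectangle δ T, ‖fderiv ℝ V' p (1, 0)‖ ≤ M
  norm_x : ∀ p ∈ innerRectangle δ T, ‖fderiv ℝ V' p (0, 1)‖ ≤ M
  equation : ∀ p ∈ innerRectangle δ T,
    ‖fderiv ℝ V' p (1, 0) + fderiv ℝ F (Ubar + V p) (fderiv ℝ V' p (0, 1))‖ ≤ η

theorem innerRectangle_subset {δ T : ℝ} (hδ : 0 < δ) : innerRectangle δ T ⊆ closedSpaceTime :=
  fun p hp => ⟨hδ.le.trans hp.1.1, by linarith [hp.2.1], by linarith [hp.2.2]⟩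

/-- Solutions are approximated by differentiable functions that almost solve the system. -/
theorem IsSolution.exists_isSmoothApprox {n : ℕ} {F : (Fin n → ℝ) → (Fin n → ℝ)}
    (hF : ContDiff ℝ ∞ F) {Ubar : Fin n → ℝ} {N : Set (Fin n → ℝ)}
    {lam : Fin n → (Fin n → ℝ) → ℝ} {r : Fin n → (Fin n → ℝ) → (Fin n → ℝ)}
    {V0 b : ℝ → Fin n → ℝ} {V : ℝ → ℝ → Fin n → ℝ} (hV : IsSolution F Ubar N lam r V0 b V) :
    ∃ M : ℝ, 0 ≤ M ∧ ∀ T η : ℝ, 0 < η → ∃ δ₀ > 0, ∀ δ, 0 < δ → δ ≤ δ₀ →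
      ∃ V', IsSmoothApprox F Ubar (fun p => V p.1 p.2) V' δ T M η := by
  obtain ⟨Vt, Vx, hwt, hwx, hbt, hbx, heq⟩ := hV.equation
  have hb := hV.bounded
  have hae : ∀ {u : ℝ × ℝ → Fin n → ℝ}, LinfNorm spaceTime u < ⊤ →
      ∀ᵐ q ∂volume.restrict spaceTime, ‖u q‖ ≤ (LinfNorm spaceTime u).toReal := fun hu =>
    ae_norm_le_of_LinfNorm_le ENNReal.toReal_nonneg (by rw [ENNReal.ofReal_toReal hu.ne])
  have hb := hae hb
  have hbt := hae hbt
  have hbx := hae hbx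
  set Bt := (LinfNorm spaceTime Vt).toReal
  set Bx := (LinfNorm spaceTime Vx).toReal
  have hBt : 0 ≤ Bt := ENNReal.toReal_nonneg
  have hBx : 0 ≤ Bx := ENNReal.toReal_nonneg
  have hm : MeasurableSet spaceTime := isOpen_spaceTime.measurableSet
  refine ⟨max Bt Bx, le_max_of_le_left hBt, fun T η hη => ?_⟩
  have hQ : IsCompact (Icc 0 (T + 1) ×ˢ Icc (-1) 1 : Set (ℝ × ℝ)) :=
    isCompact_Icc.prod isCompact_Icc
  have hc := hV.continuousOn.mono
    (prod_mono Icc_subset_Ici_self Subset.rfl : (Icc 0 (T + 1) ×ˢ Icc (-1) 1 : Set (ℝ × ℝ)) ⊆ _)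
  have hcA : ContinuousOn (fun p : ℝ × ℝ => fderiv ℝ F (Ubar + V p.1 p.2))
      (Icc 0 (T + 1) ×ˢ Icc (-1) 1) :=
    (hF.continuous_fderiv (by simp)).comp_continuousOn (continuousOn_const.add hc)
  obtain ⟨d₁, hd₁, H₁⟩ := Metric.uniformContinuousOn_iff.1
    (hQ.uniformContinuousOn_of_continuous hc) η hη
  obtain ⟨d₂, hd₂, H₂⟩ := Metric.uniformContinuousOn_iff.1
    (hQ.uniformContinuousOn_of_continuous hcA) (η / (Bx + 1)) (by positivity)
  obtain ⟨δ₀, hδ₀, h₁, h₂, h₃⟩ : ∃ δ₀ > 0, 2 * δ₀ ≤ d₁ ∧ δ₀ ≤ d₂ ∧ δ₀ ≤ 1 :=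
    ⟨min (d₁ / 2) (min d₂ 1), by positivity, by
      have : min (d₁ / 2) (min d₂ 1) ≤ d₁ / 2 := by simp
      linarith, by simp, by simp⟩
  -- All smaller `δ` are admitted so that two solutions can be approximated on one common rectangle.
  refine ⟨δ₀, hδ₀, fun δ hδ hδδ => ?_⟩
  obtain ⟨φ, hφ⟩ := exists_isMollifier (H := ℝ × ℝ) (half_pos hδ)
  have hball : ∀ p ∈ innerRectangle δ T, ∀ q ∈ Metric.closedBall p (δ / 2),
      q ∈ spaceTime ∧ q ∈ (Icc 0 (T + 1) ×ˢ Icc (-1) 1 : Set (ℝ × ℝ)) := by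
    intro p hp q hq
    rw [Metric.mem_closedBall, Prod.dist_eq, max_le_iff, Real.dist_eq, Real.dist_eq, abs_le,
      abs_le] at hq
    obtain ⟨⟨p1, p2⟩, p3, p4⟩ := hp
    obtain ⟨⟨q1, q2⟩, q3, q4⟩ := hq
    refine ⟨⟨mem_Ioi.2 ?_, ?_, ?_⟩, ⟨?_, ?_⟩, ?_, ?_⟩ <;> linarith
  have hsub : ∀ p ∈ innerRectangle δ T, Metric.closedBall p (δ / 2) ⊆ spaceTime := fun p hp q hq =>
    (hball p hp q hq).1
  have hft : ∀ p ∈ innerRectangle δ T, _ := fun p hp =>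
    hφ.fderiv_mollify hm hb hwt (hsub p hp)
  have hfx : ∀ p ∈ innerRectangle δ T, _ := fun p hp =>
    hφ.fderiv_mollify hm hb hwx (hsub p hp)
  refine ⟨mollify φ spaceTime (fun p : ℝ × ℝ => V p.1 p.2),
    hφ.differentiable_mollify hm hwt.1.aestronglyMeasurable hb, ?_, ?_, ?_, ?_⟩
  · intro p hp q hq hqT hpq
    refine hφ.norm_mollify_sub_le hwt.1.aestronglyMeasurable hb (hsub p hp) hη.le fun z hz => ?_
    rw [← dist_eq_norm]
    refine (H₁ z (hball p hp z hz).2 q ⟨⟨hq.1, by linarith⟩, hq.2⟩ ?_).le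
    have := dist_triangle z p q
    have hz : dist z p ≤ δ / 2 := hz
    linarith
  · intro p hp
    rw [hft p hp]
    exact hφ.norm_integral_smul_le (by positivity)
      (hbt.mono fun q hq _ => hq.trans (le_max_left _ _))
  · intro p hp
    rw [hfx p hp]
    exact hφ.norm_integral_smul_le (by positivity)
      (hbx.mono fun q hq _ => hq.trans (le_max_right _ _))
  · intro p hp
    have i1 := hφ.integrable_smul hwt.2.1.aestronglyMeasurable hbt p
    have i2 := hφ.integrable_smul hwx.2.1.aestronglyMeasurable hbx p
    rw [hft p hp, hfx p hp, ← ContinuousLinearMap.integral_comp_comm _ i2,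
      ← integral_add i1 (ContinuousLinearMap.integrable_comp _ i2)]
    simp only [map_smul, ← smul_add]
    refine hφ.norm_integral_smul_le hη.le ?_
    filter_upwards [heq, hbx] with q hq hqx hqb
    -- The commutator of averaging with the coefficient: the defect is the oscillation of `A` over
    -- the ball times the bounded function `Vx`.
    have e : Vt q + fderiv ℝ F (Ubar + V p.1 p.2) (Vx q) =
        (fderiv ℝ F (Ubar + V p.1 p.2) - fderiv ℝ F (Ubar + V q.1 q.2)) (Vx q) := by
      rw [sub_apply, ← sub_eq_zero, ← hq]; abel
    rw [e]
    have h4 := H₂ p ⟨⟨hδ.le.trans hp.1.1, by linarith [hp.1.2]⟩, (innerRectangle_subset hδ hp).2⟩ q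
      (hball p hp q hqb).2 (by
        rw [dist_comm]
        have : dist q p ≤ δ / 2 := hqb
        linarith)
    rw [dist_eq_norm] at h4
    calc _ ≤ η / (Bx + 1) * Bx := ContinuousLinearMap.le_of_opNorm_le_of_le _ h4.le hqx
      _ ≤ η / (Bx + 1) * (Bx + 1) := by gcongr; linarith
      _ = η := by field_simp

/-- A function with a one-sided maximum has a nonpositive derivative. -/
theorem HasDerivAt.nonpos_of_eventually_le {φ : ℝ → ℝ} {φ' : ℝ} (h : HasDerivAt φ φ' 0)
    (hmax : ∀ᶠ s in 𝓝[>] 0, φ s ≤ φ 0) : φ' ≤ 0 := by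
  have h1 := (hasDerivWithinAt_iff_tendsto_slope' (by simp : (0 : ℝ) ∉ Ioi 0)).1
    (h.hasDerivWithinAt (s := Ioi 0))
  refine le_of_tendsto h1 ?_
  filter_upwards [hmax, self_mem_nhdsWithin] with s hs hs0
  rw [slope_def_field, sub_zero]
  exact div_nonpos_of_nonpos_of_nonneg (sub_nonpos.2 hs) (mem_Ioi.1 hs0).le

namespace CharSystem

variable {n : ℕ} {F : (Fin n → ℝ) → (Fin n → ℝ)} {Ubar : Fin n → ℝ}
    {N : Set (Fin n → ℝ)} {lam : Fin n → (Fin n → ℝ) → ℝ}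
    {r : Fin n → (Fin n → ℝ) → (Fin n → ℝ)} (S : CharSystem F Ubar N lam r)

theorem norm_fderiv_L_le {v : Fin n → ℝ} (hv : ‖v‖ < S.ρ) : ‖fderiv ℝ S.L v‖ ≤ S.K := by
  refine (S.diff_L v hv.le).hasFDerivAt.le_of_lip' S.K_pos.le ?_
  have : ∀ᶠ w in 𝓝 v, ‖w‖ < S.ρ := continuous_norm.continuousAt.eventually_lt continuousAt_const hv
  filter_upwards [this] with w hw using S.lip_L w v hw.le hv.le

theorem abs_lam_le {v : Fin n → ℝ} (hv : ‖v‖ ≤ S.ρ) (i : Fin n) : |lam i (Ubar + v)| ≤ S.K := by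
  have h1 := S.speed_le v hv i
  have h2 := S.le_speed v hv i
  have h3 := S.c_pos
  rw [← abs_of_nonneg (h3.le.trans h2), abs_mul, S.abs_sg, one_mul] at h1
  exact h1

/-- The difference of two approximate solutions, in characteristic components. -/
theorem abs_transport_diff_le {V W V' W' : ℝ × ℝ → Fin n → ℝ} {δ T M η : ℝ}
    (hM : 0 ≤ M) (hη : 0 ≤ η)
    (hV : IsSmoothApprox F Ubar V V' δ T M η) (hW : IsSmoothApprox F Ubar W W' δ T M η)
    {p : ℝ × ℝ} (hp : p ∈ innerRectangle δ T) (hv : ‖V p‖ ≤ S.ρ) (hw : ‖W p‖ ≤ S.ρ)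
    (hv' : ‖V' p‖ < S.ρ) (hvv : ‖V' p - V p‖ ≤ η) (hww : ‖W' p - W p‖ ≤ η) (i : Fin n) :
    ∃ z' : ℝ, |z'| ≤ 6 * S.K ^ 2 * (M + 1) * (‖W' p - V' p‖ + η) ∧
      HasDerivAt (fun s : ℝ => S.L (V' (p - s • (1, lam i (Ubar + V p))))
        (W' (p - s • (1, lam i (Ubar + V p))) - V' (p - s • (1, lam i (Ubar + V p)))) i)
        (-z') 0 := by
  have hK := S.K_pos
  have hK1 := S.one_le_K
  set μ := lam i (Ubar + V p) with hμ
  have hμK : |μ| ≤ S.K := S.abs_lam_le hv i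
  set d : ℝ × ℝ := (1, μ) with hd
  have hdd : d = (1, 0) + μ • ((0 : ℝ), (1 : ℝ)) := by simp [hd]
  obtain ⟨Z, hZ⟩ : ∃ Z, Z = W' p - V' p := ⟨_, rfl⟩
  obtain ⟨Zt, hZt⟩ : ∃ Zt, Zt = fderiv ℝ W' p (1, 0) - fderiv ℝ V' p (1, 0) := ⟨_, rfl⟩
  obtain ⟨Zx, hZx⟩ : ∃ Zx, Zx = fderiv ℝ W' p (0, 1) - fderiv ℝ V' p (0, 1) := ⟨_, rfl⟩
  have hpath : HasDerivAt (fun s : ℝ => p - s • d) (-d) 0 := by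
    simpa using ((hasDerivAt_id (0 : ℝ)).smul_const d).const_sub p
  have p0 : p - (0 : ℝ) • d = p := by simp
  have dV : HasDerivAt (fun s : ℝ => V' (p - s • d)) (fderiv ℝ V' p (-d)) 0 := by
    have := (hV.diff (p - (0 : ℝ) • d)).hasFDerivAt.comp_hasDerivAt (0 : ℝ) hpath
    rwa [p0] at this
  have dW : HasDerivAt (fun s : ℝ => W' (p - s • d)) (fderiv ℝ W' p (-d)) 0 := by
    have := (hW.diff (p - (0 : ℝ) • d)).hasFDerivAt.comp_hasDerivAt (0 : ℝ) hpath
    rwa [p0] at this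
  have dL : HasDerivAt (fun s : ℝ => S.L (V' (p - s • d)))
      (fderiv ℝ S.L (V' p) (fderiv ℝ V' p (-d))) 0 := by
    have hL : HasFDerivAt S.L (fderiv ℝ S.L (V' p)) (V' (p - (0 : ℝ) • d)) := by
      rw [p0]; exact (S.diff_L _ hv'.le).hasFDerivAt
    exact hL.comp_hasDerivAt (0 : ℝ) dV
  have dz := dL.clm_apply (dW.sub dV)
  simp only [p0, Pi.sub_apply] at dz
  have dzi := hasDerivAt_pi.1 dz i
  have eV : ∀ G : ℝ × ℝ → Fin n → ℝ, fderiv ℝ G p d =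
      fderiv ℝ G p (1, 0) + μ • fderiv ℝ G p (0, 1) := fun G => by rw [hdd, map_add, map_smul]
  have e : (fderiv ℝ S.L (V' p) (fderiv ℝ V' p (-d))) (W' p - V' p) +
      S.L (V' p) (fderiv ℝ W' p (-d) - fderiv ℝ V' p (-d)) =
      -((fderiv ℝ S.L (V' p) (fderiv ℝ V' p d)) Z + S.L (V' p) (Zt + μ • Zx)) := by
    have : Zt + μ • Zx = fderiv ℝ W' p d - fderiv ℝ V' p d := by
      rw [eV, eV, hZt, hZx, smul_sub]; abel
    rw [this, hZ]
    simp only [map_neg, neg_apply, map_sub]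
    abel
  rw [e] at dzi
  refine ⟨_, ?_, dzi⟩
  have nd : ∀ G : ℝ × ℝ → Fin n → ℝ, ‖fderiv ℝ G p (1, 0)‖ ≤ M → ‖fderiv ℝ G p (0, 1)‖ ≤ M →
      ‖fderiv ℝ G p d‖ ≤ 2 * S.K * M := by
    intro G h1 h2
    rw [eV]
    refine (norm_add_le _ _).trans ?_
    rw [norm_smul, Real.norm_eq_abs]
    calc _ ≤ M + S.K * M := by gcongr
      _ ≤ S.K * M + S.K * M := by gcongr; exact le_mul_of_one_le_left hM hK1
      _ = _ := by ring
  have nV := nd V' (hV.norm_t p hp) (hV.norm_x p hp)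
  have nW := nd W' (hW.norm_t p hp) (hW.norm_x p hp)
  have nZ : ‖Zt + μ • Zx‖ ≤ 4 * S.K * M := by
    have : Zt + μ • Zx = fderiv ℝ W' p d - fderiv ℝ V' p d := by
      rw [eV, eV, hZt, hZx, smul_sub]; abel
    rw [this]
    exact (norm_sub_le _ _).trans (by linarith)
  have b1 : |(fderiv ℝ S.L (V' p) (fderiv ℝ V' p d)) Z i| ≤ S.K * (2 * S.K * M) * ‖Z‖ := by
    refine (norm_le_pi_norm ((fderiv ℝ S.L (V' p) (fderiv ℝ V' p d)) Z) i).trans ?_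
    refine ContinuousLinearMap.le_of_opNorm_le _ ?_ _
    exact ContinuousLinearMap.le_of_opNorm_le_of_le _ (S.norm_fderiv_L_le hv') nV
  have b2 : |S.L (V' p) (Zt + μ • Zx) i - S.L (V p) (Zt + μ • Zx) i| ≤
      S.K * η * (4 * S.K * M) :=
    (S.abs_L_sub_le hv'.le hv _ i).trans (by gcongr)
  -- The rows of `L` are left eigenvectors: the derivative in the `i`-th characteristic direction
  -- becomes the full operator, for which both approximate equations are available.
  have e3 : S.L (V p) (Zt + μ • Zx) i = S.L (V p) (Zt + fderiv ℝ F (Ubar + V p) Zx) i := by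
    simp only [map_add, map_smul, Pi.add_apply, Pi.smul_apply, smul_eq_mul, S.eigen _ hv, ← hμ]
  have hVW : ‖V p - W p‖ ≤ ‖Z‖ + 2 * η := by
    have : V p - W p = (W' p - W p) - (V' p - V p) - Z := by rw [hZ]; abel
    rw [this]
    refine (norm_sub_le _ _).trans ?_
    have := norm_sub_le (W' p - W p) (V' p - V p)
    linarith
  have b3 : ‖Zt + fderiv ℝ F (Ubar + V p) Zx‖ ≤ η + η + S.K * (‖Z‖ + 2 * η) * M := by
    have e4 : Zt + fderiv ℝ F (Ubar + V p) Zx =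
        (fderiv ℝ W' p (1, 0) + fderiv ℝ F (Ubar + W p) (fderiv ℝ W' p (0, 1))) -
        (fderiv ℝ V' p (1, 0) + fderiv ℝ F (Ubar + V p) (fderiv ℝ V' p (0, 1))) +
        (fderiv ℝ F (Ubar + V p) - fderiv ℝ F (Ubar + W p)) (fderiv ℝ W' p (0, 1)) := by
      rw [hZt, hZx, map_sub, sub_apply]; abel
    rw [e4]
    refine (norm_add_le _ _).trans (add_le_add ((norm_sub_le _ _).trans
      (add_le_add (hW.equation p hp) (hV.equation p hp))) ?_)
    refine ContinuousLinearMap.le_of_opNorm_le_of_le _ ?_ (hW.norm_x p hp)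
    exact (S.lip_A _ _ hv hw).trans (by gcongr)
  have b4 : |S.L (V p) (Zt + μ • Zx) i| ≤ S.K * (η + η + S.K * (‖Z‖ + 2 * η) * M) := by
    rw [e3]
    exact (S.abs_L_le hv _ i).trans (by gcongr)
  rw [← hZ, Pi.add_apply]
  have hsum := abs_add_three ((fderiv ℝ S.L (V' p) (fderiv ℝ V' p d)) Z i)
    (S.L (V' p) (Zt + μ • Zx) i - S.L (V p) (Zt + μ • Zx) i) (S.L (V p) (Zt + μ • Zx) i)
  have e5 : ∀ a b c : ℝ, a + (b - c) + c = a + b := fun a b c => by ring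
  rw [e5] at hsum
  refine hsum.trans ((add_le_add_three b1 b2 b4).trans ?_)
  have hKK : S.K ≤ S.K ^ 2 := by rw [pow_two]; exact le_mul_of_one_le_left hK.le hK1
  have h6 := mul_le_mul_of_nonneg_right hKK hη
  have h7 : 0 ≤ S.K ^ 2 * M * ‖Z‖ := by positivity
  have h8 : 0 ≤ S.K ^ 2 * ‖Z‖ := by positivity
  have h9 : 0 ≤ S.K ^ 2 * η := by positivity
  nlinarith

/-- Stability for two approximate solutions with the same data: their difference is of the order
of the approximation error. -/
theorem norm_sub_le_of_isSmoothApprox {V W V' W' : ℝ × ℝ → Fin n → ℝ} {ρ₁ δ T M η : ℝ}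
    (hρ : 4 * ρ₁ ≤ S.ρ) (hρK : 2 * S.K ^ 2 * ρ₁ ≤ 1) (hM : 0 ≤ M) (hη : 0 ≤ η)
    (hηρ : 4 * η ≤ S.ρ) (hδ : 0 < δ)
    (hVb : ∀ p ∈ closedSpaceTime, p.1 ≤ T → ‖V p‖ ≤ ρ₁)
    (hWb : ∀ p ∈ closedSpaceTime, p.1 ≤ T → ‖W p‖ ≤ ρ₁)
    (hV : IsSmoothApprox F Ubar V V' δ T M η) (hW : IsSmoothApprox F Ubar W W' δ T M η)
    (hinit : ∀ x ∈ Icc (-1 : ℝ) 1, W (0, x) = V (0, x))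
    (hbdry : ∀ t, 0 ≤ t → t ≤ T → ∀ i, S.L (W (t, -S.sg i)) (W (t, -S.sg i)) i =
      S.L (V (t, -S.sg i)) (V (t, -S.sg i)) i) :
    ∀ p ∈ innerRectangle δ T, ‖W' p - V' p‖ ≤
      S.K * Real.exp ((6 * S.K ^ 2 * (M + 1) * S.K + 1) * T) *
        ((8 * S.K + 6 * S.K ^ 2 * (M + 1)) * η) := by
  intro p₀ hp₀
  have hK := S.K_pos
  have hK1 := S.one_le_K
  have hT : δ ≤ T := hp₀.1.1.trans hp₀.1.2
  obtain ⟨C, hC⟩ : ∃ C, C = 6 * S.K ^ 2 * (M + 1) := ⟨_, rfl⟩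
  have hC0 : 0 ≤ C := by rw [hC]; positivity
  -- One more than the growth rate `C * K` along characteristics: at an interior maximum, `κ * |z| ≤
  -- C * (K * |z| + η)` then forces `|z| ≤ C * η`.
  obtain ⟨κ, hκ⟩ : ∃ κ, κ = C * S.K + 1 := ⟨_, rfl⟩
  have hκ0 : 0 ≤ κ := by rw [hκ]; positivity
  rw [← hC, ← hκ]
  have hρ1 : 0 ≤ ρ₁ := (norm_nonneg _).trans (hVb p₀ (innerRectangle_subset hδ hp₀) hp₀.1.2)
  have hself : ∀ p ∈ innerRectangle δ T, ‖V' p - V p‖ ≤ η ∧ ‖W' p - W p‖ ≤ η := fun p hp =>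
    ⟨hV.close p hp p (innerRectangle_subset hδ hp) hp.1.2 (by simpa using hδ.le),
      hW.close p hp p (innerRectangle_subset hδ hp) hp.1.2 (by simpa using hδ.le)⟩
  have hvb : ∀ p ∈ innerRectangle δ T, ‖V' p‖ < S.ρ := by
    intro p hp
    have h1 := (hself p hp).1
    have h2 := hVb p (innerRectangle_subset hδ hp) hp.1.2
    have h3 := norm_add_le (V' p - V p) (V p)
    rw [sub_add_cancel] at h3
    have := S.ρ_pos
    linarith
  set G : ℝ × ℝ → ℝ := fun p => Real.exp (-(κ * p.1)) * ‖S.L (V' p) (W' p - V' p)‖ with hG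
  have hGc : ContinuousOn G (innerRectangle δ T) := by
    intro p hp
    refine ContinuousAt.continuousWithinAt ?_
    have c1 : ContinuousAt (fun p => S.L (V' p)) p :=
      (S.diff_L _ (hvb p hp).le).continuousAt.comp hV.diff.continuous.continuousAt
    have c2 : ContinuousAt (fun p => W' p - V' p) p :=
      (hW.diff.continuous.sub hV.diff.continuous).continuousAt
    have c3 : ContinuousAt (fun p : ℝ × ℝ => Real.exp (-(κ * p.1))) p := by fun_prop
    exact c3.mul (c1.clm_apply c2).norm
  obtain ⟨p, hp, hmax⟩ := (isCompact_innerRectangle δ T).exists_isMaxOn ⟨p₀, hp₀⟩ hGc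
  suffices hmain : ‖S.L (V' p) (W' p - V' p)‖ ≤ (8 * S.K + C) * η by
    have h1 : G p₀ ≤ G p := hmax hp₀
    have h2 : G p ≤ (8 * S.K + C) * η := by
      rw [hG]
      have : Real.exp (-(κ * p.1)) ≤ 1 := by
        rw [Real.exp_le_one_iff, neg_nonpos]
        exact mul_nonneg hκ0 (hδ.le.trans hp.1.1)
      calc _ ≤ 1 * ‖S.L (V' p) (W' p - V' p)‖ :=
            mul_le_mul_of_nonneg_right this (norm_nonneg _)
        _ ≤ _ := by rwa [one_mul]
    have h3 : ‖S.L (V' p₀) (W' p₀ - V' p₀)‖ = Real.exp (κ * p₀.1) * G p₀ := by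
      rw [hG]; simp only; rw [← mul_assoc, ← Real.exp_add]; simp
    calc ‖W' p₀ - V' p₀‖ ≤ S.K * ‖S.L (V' p₀) (W' p₀ - V' p₀)‖ := S.norm_le _ (hvb p₀ hp₀).le _
      _ = S.K * (Real.exp (κ * p₀.1) * G p₀) := by rw [h3]
      _ ≤ S.K * (Real.exp (κ * T) * ((8 * S.K + C) * η)) := by
        gcongr
        · exact hp₀.1.2
        · exact h1.trans h2
      _ = _ := by ring
  rcases isEmpty_or_nonempty (Fin n) with hn | hn
  · have : S.L (V' p) (W' p - V' p) = 0 := Subsingleton.elim _ _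
    rw [this, norm_zero]; positivity
  obtain ⟨i, hi⟩ := Finite.exists_max fun i => |S.L (V' p) (W' p - V' p) i|
  have hnorm : ‖S.L (V' p) (W' p - V' p)‖ = |S.L (V' p) (W' p - V' p) i| :=
    le_antisymm ((pi_norm_le_iff_of_nonneg (abs_nonneg _)).2 hi) (norm_le_pi_norm (S.L (V' p) (W' p - V' p)) i)
  have hv' := hvb p hp
  have hpc := innerRectangle_subset hδ hp
  have hv : ‖V p‖ ≤ S.ρ := (hVb p hpc hp.1.2).trans (by linarith)
  have hw : ‖W p‖ ≤ S.ρ := (hWb p hpc hp.1.2).trans (by linarith)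
  have hZ := S.norm_le _ hv'.le (W' p - V' p)
  rw [hnorm] at hZ ⊢
  have hpT := hp.1.2
  -- On the initial edge both approximations are within `η` of the same initial value.
  by_cases h1 : p.1 = δ
  · have hx : p.2 ∈ Icc (-1 : ℝ) 1 := hpc.2
    have hq : ((0 : ℝ), p.2) ∈ closedSpaceTime := ⟨mem_Ici.2 le_rfl, hx⟩
    have hd : dist p (0, p.2) ≤ δ := by
      rw [Prod.dist_eq, max_le_iff]
      simp [h1, abs_of_pos hδ, hδ.le]
    have a1 := hV.close p hp _ hq (hδ.le.trans hT) hd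
    have a2 := hW.close p hp _ hq (hδ.le.trans hT) hd
    rw [hinit _ hx] at a2
    have a3 : ‖W' p - V' p‖ ≤ 2 * η := by
      have e : W' p - V' p = (W' p - V (0, p.2)) - (V' p - V (0, p.2)) := by abel
      rw [e]; exact (norm_sub_le _ _).trans (by linarith)
    calc _ ≤ S.K * ‖W' p - V' p‖ := S.abs_L_le hv'.le _ i
      _ ≤ S.K * (2 * η) := by gcongr
      _ ≤ _ := by
        have : 0 ≤ S.K * η := by positivity
        have : 0 ≤ C * η := by positivity
        linarith
  by_cases h2 : p.2 = -S.sg i * (1 - δ)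
  · have hq : (p.1, -(S.sg i : ℝ)) ∈ closedSpaceTime :=
      ⟨hpc.1, by rcases S.sg_cases i with e | e <;> simp [e]⟩
    have hd : dist p (p.1, -(S.sg i : ℝ)) ≤ δ := by
      rw [Prod.dist_eq, max_le_iff]
      refine ⟨by simpa using hδ.le, ?_⟩
      have : p.2 - -(S.sg i : ℝ) = S.sg i * δ := by rw [h2]; ring
      rw [Real.dist_eq]
      change |p.2 - -(S.sg i : ℝ)| ≤ δ
      rw [this, abs_mul, S.abs_sg, one_mul, abs_of_pos hδ]
    have a1 := hV.close p hp _ hq hpT hd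
    have a2 := hW.close p hp _ hq hpT hd
    have hbd := hbdry p.1 hpc.1 hpT i
    have n1 := hVb _ hq hpT
    have n2 := hWb _ hq hpT
    generalize V (p.1, -(S.sg i : ℝ)) = v₁ at *
    generalize W (p.1, -(S.sg i : ℝ)) = w₁ at *
    have n1' : ‖v₁‖ ≤ S.ρ := by linarith
    have n2' : ‖w₁‖ ≤ S.ρ := by linarith
    generalize V' p = v' at *
    generalize W' p = w' at *
    have hd1 : ‖w₁ - v₁‖ ≤ ‖w' - v'‖ + 2 * η := by
      have e : w₁ - v₁ = (w' - v') - (w' - w₁) + (v' - v₁) := by abel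
      rw [e]
      refine (norm_add_le _ _).trans ?_
      have := norm_sub_le (w' - v') (w' - w₁)
      linarith
    -- On the inlet edge of the largest component, equal data reduce `L v₁ (w₁ - v₁)` in that
    -- component to a difference of frames applied to the small vector `w₁`. Since the component
    -- controls the full difference, `2 * K ^ 2 * ρ₁ ≤ 1` lets half of it absorb this term.
    have c1 : |S.L v₁ w₁ i - S.L w₁ w₁ i| ≤ S.K * (‖w' - v'‖ + 2 * η) * ρ₁ :=
      (S.abs_L_sub_le n1' n2' w₁ i).trans (by rw [norm_sub_rev]; gcongr)
    have c2 : |S.L v' (w' - w₁ - (v' - v₁)) i| ≤ S.K * (η + η) :=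
      (S.abs_L_le hv'.le _ i).trans (by
        gcongr; exact (norm_sub_le _ _).trans (add_le_add a2 a1))
    have c3 : |S.L v' (w₁ - v₁) i - S.L v₁ (w₁ - v₁) i| ≤ S.K * η * (ρ₁ + ρ₁) :=
      (S.abs_L_sub_le hv'.le n1' _ i).trans (by
        gcongr; exact (norm_sub_le _ _).trans (add_le_add n2 n1))
    have e : S.L v' (w' - v') i = S.L v' (w' - w₁ - (v' - v₁)) i +
        (S.L v' (w₁ - v₁) i - S.L v₁ (w₁ - v₁) i) + (S.L v₁ w₁ i - S.L w₁ w₁ i) := by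
      rw [hbd]; simp only [map_sub, Pi.sub_apply]; ring
    have c4 := abs_add_three (S.L v' (w' - w₁ - (v' - v₁)) i)
      (S.L v' (w₁ - v₁) i - S.L v₁ (w₁ - v₁) i) (S.L v₁ w₁ i - S.L w₁ w₁ i)
    rw [← e] at c4
    generalize |S.L v' (w' - v') i| = y at *
    have hy : 0 ≤ y := by
      by_contra hy
      push Not at hy
      have := mul_neg_of_pos_of_neg hK hy
      linarith [norm_nonneg (w' - v')]
    have hKρ : S.K * ρ₁ ≤ 1 / 2 := by
      have : S.K * ρ₁ ≤ S.K ^ 2 * ρ₁ := by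
        rw [pow_two]; gcongr; exact le_mul_of_one_le_left hK.le hK1
      linarith
    have c5 : S.K * (‖w' - v'‖ + 2 * η) * ρ₁ ≤ 1 / 2 * y + η := by
      have g1 : S.K * ρ₁ * ‖w' - v'‖ ≤ S.K * ρ₁ * (S.K * y) := by gcongr
      have g2 : S.K ^ 2 * ρ₁ * y ≤ 1 / 2 * y := by gcongr; linarith
      have g3 : S.K * ρ₁ * η ≤ 1 / 2 * η := by gcongr
      linarith
    have c6 : S.K * η * (ρ₁ + ρ₁) ≤ η := by
      have g3 : S.K * ρ₁ * η ≤ 1 / 2 * η := by gcongr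
      linarith
    have c7 : η ≤ S.K * η := le_mul_of_one_le_left hη hK1
    have : 0 ≤ C * η := by positivity
    linarith
  -- On the rest of the rectangle, outlet and final time included, the short backward characteristic
  -- of family `i` stays inside, so the weighted component has a one-sided maximum at `s = 0`. Its
  -- square is used because the modulus need not be differentiable.
  · obtain ⟨hvv, hww⟩ := hself p hp
    obtain ⟨z', hz', hder⟩ := S.abs_transport_diff_le hM hη hV hW hp hv hw hv' hvv hww i
    rw [← hC] at hz'
    set μ := lam i (Ubar + V p) with hμ
    have hspeed : 0 < S.sg i * μ := S.c_pos.trans_le (S.le_speed _ hv i)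
    obtain ⟨z, hzdef⟩ : ∃ z : ℝ → ℝ, z = fun s : ℝ => S.L (V' (p - s • (1, μ)))
        (W' (p - s • (1, μ)) - V' (p - s • (1, μ))) i := ⟨_, rfl⟩
    rw [← hzdef] at hder
    have hz0 : S.L (V' p) (W' p - V' p) i = z 0 := by
      rw [hzdef]; simp only [zero_smul, sub_zero]
    have dexp : HasDerivAt (fun s : ℝ => Real.exp (-(κ * (p.1 - s))))
        (Real.exp (-(κ * p.1)) * κ) 0 := by
      have h : HasDerivAt (fun s : ℝ => -(κ * (p.1 - s))) κ 0 := by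
        have h := (((hasDerivAt_id' (0 : ℝ)).const_sub p.1).const_mul κ).neg
        rwa [mul_neg_one, neg_neg] at h
      simpa using h.exp
    have dsq := ((dexp.mul hder).pow 2).nonpos_of_eventually_le ?_
    · simp only [Pi.mul_apply, sub_zero] at dsq
      rw [hz0] at hZ ⊢
      have hEpos : 0 < Real.exp (-(κ * p.1)) := Real.exp_pos _
      set Ex := Real.exp (-(κ * p.1))
      have d1 : κ * z 0 ^ 2 ≤ z 0 * z' := by
        have : 2 * Ex ^ 2 * (κ * z 0 ^ 2 - z 0 * z') ≤ 0 := by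
          refine le_trans (le_of_eq ?_) dsq
          norm_num
          ring
        have := nonpos_of_mul_nonpos_right this (by positivity)
        linarith
      have d2 : κ * |z 0| ≤ |z'| := by
        by_cases hz : z 0 = 0
        · simp [hz]
        · have : |z 0| * (κ * |z 0|) ≤ |z 0| * |z'| := by
            calc _ = κ * |z 0| ^ 2 := by ring
              _ = κ * z 0 ^ 2 := by rw [sq_abs]
              _ ≤ z 0 * z' := d1
              _ ≤ |z 0 * z'| := le_abs_self _
              _ = _ := abs_mul _ _
          exact le_of_mul_le_mul_left this (abs_pos.2 hz)
      have d3 : |z'| ≤ C * (S.K * |z 0| + η) := hz'.trans (by gcongr)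
      have : 0 ≤ S.K * η := by positivity
      rw [hκ] at d2
      linarith
    · have hp1 : δ < p.1 := lt_of_le_of_ne hp.1.1 (Ne.symm h1)
      have ev1 : ∀ᶠ s : ℝ in 𝓝 0, δ < p.1 - s := by
        have : ContinuousAt (fun s : ℝ => p.1 - s) 0 := by fun_prop
        exact continuousAt_const.eventually_lt this (by simpa using hp1)
      have hside : ∀ᶠ s : ℝ in 𝓝[>] 0, p.2 - s * μ ∈ Icc (-1 + δ) (1 - δ) := by
        have hcont : ContinuousAt (fun s : ℝ => p.2 - s * μ) 0 := by fun_prop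
        rcases S.sg_cases i with e | e
        · rw [e] at h2 hspeed
          have hlt : -1 + δ < p.2 := lt_of_le_of_ne hp.2.1 fun h => h2 (by rw [← h]; push_cast; ring)
          have ev2 : ∀ᶠ s : ℝ in 𝓝 0, -1 + δ < p.2 - s * μ :=
            continuousAt_const.eventually_lt hcont (by simpa using hlt)
          filter_upwards [ev2.filter_mono nhdsWithin_le_nhds, self_mem_nhdsWithin] with s hs hs0
          have hμ0 : 0 < μ := by simpa using hspeed
          have := mul_pos (mem_Ioi.1 hs0) hμ0
          exact ⟨hs.le, by linarith [hp.2.2]⟩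
        · rw [e] at h2 hspeed
          have hlt : p.2 < 1 - δ := lt_of_le_of_ne hp.2.2 fun h => h2 (by rw [h]; push_cast; ring)
          have ev2 : ∀ᶠ s : ℝ in 𝓝 0, p.2 - s * μ < 1 - δ :=
            hcont.eventually_lt continuousAt_const (by simpa using hlt)
          filter_upwards [ev2.filter_mono nhdsWithin_le_nhds, self_mem_nhdsWithin] with s hs hs0
          have hμ0 : μ < 0 := by simpa using hspeed
          have := mul_neg_of_pos_of_neg (mem_Ioi.1 hs0) hμ0
          exact ⟨by linarith [hp.2.1], hs.le⟩
      filter_upwards [ev1.filter_mono nhdsWithin_le_nhds, hside, self_mem_nhdsWithin]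
        with s hs1 hs2 hs0
      have hmem : p - s • ((1 : ℝ), μ) ∈ innerRectangle δ T := by
        refine ⟨⟨?_, ?_⟩, ?_⟩
        · simpa using hs1.le
        · have := mem_Ioi.1 hs0
          simp; linarith
        · simpa using hs2
      have hle : G (p - s • ((1 : ℝ), μ)) ≤ G p := hmax hmem
      rw [hG] at hle
      simp only at hle
      rw [hnorm, hz0] at hle
      have e1 : (p - s • ((1 : ℝ), μ)).1 = p.1 - s := by simp
      rw [e1] at hle
      have e2 : |z s| ≤ ‖S.L (V' (p - s • (1, μ))) (W' (p - s • (1, μ)) - V' (p - s • (1, μ)))‖ := by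
        rw [hzdef]
        exact norm_le_pi_norm (S.L (V' (p - s • (1, μ)))
          (W' (p - s • (1, μ)) - V' (p - s • (1, μ)))) i
      simp only [Pi.mul_apply, Pi.pow_apply, sub_zero]
      rw [← sq_abs, ← sq_abs (_ * z 0), abs_mul, abs_mul, Real.abs_exp, Real.abs_exp]
      refine pow_le_pow_left₀ (mul_nonneg (Real.exp_pos _).le (abs_nonneg _)) ?_ 2
      exact (mul_le_mul_of_nonneg_left e2 (Real.exp_pos _).le).trans hle

end CharSystem

theorem IsSmoothApprox.mono {n : ℕ} {F : (Fin n → ℝ) → (Fin n → ℝ)} {Ubar : Fin n → ℝ}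
    {V V' : ℝ × ℝ → Fin n → ℝ} {δ T M M' η : ℝ} (h : IsSmoothApprox F Ubar V V' δ T M η)
    (hM : M ≤ M') : IsSmoothApprox F Ubar V V' δ T M' η :=
  ⟨h.diff, h.close, fun p hp => (h.norm_t p hp).trans hM, fun p hp => (h.norm_x p hp).trans hM,
    h.equation⟩

namespace CharSystem

variable {n : ℕ} {F : (Fin n → ℝ) → (Fin n → ℝ)} {Ubar : Fin n → ℝ}
    {N : Set (Fin n → ℝ)} {lam : Fin n → (Fin n → ℝ) → ℝ}
    {r : Fin n → (Fin n → ℝ) → (Fin n → ℝ)} (S : CharSystem F Ubar N lam r)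

theorem L_inflow {V0 b : ℝ → Fin n → ℝ} {V : ℝ → ℝ → Fin n → ℝ}
    (hV : IsSolution F Ubar N lam r V0 b V) {t : ℝ} (ht : 0 ≤ t) (i : Fin n)
    (hb : ‖V t (-S.sg i)‖ ≤ S.ρ) : S.L (V t (-S.sg i)) (V t (-S.sg i)) i = b t i := by
  rw [← S.charUnknown_eq _ hb]
  exact hV.inflow t ht i _ ((S.incoming i _).2 rfl)

/-- Two small solutions with the same data coincide. -/
theorem eq_of_isSolution_of_small (hF : ContDiff ℝ ∞ F) {V0 b : ℝ → Fin n → ℝ}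
    {V W : ℝ → ℝ → Fin n → ℝ} (hV : IsSolution F Ubar N lam r V0 b V)
    (hW : IsSolution F Ubar N lam r V0 b W) {ρ₁ T : ℝ}
    (hρ : 4 * ρ₁ ≤ S.ρ) (hρK : 2 * S.K ^ 2 * ρ₁ ≤ 1)
    (hVb : ∀ t, 0 ≤ t → t ≤ T → ∀ x ∈ Icc (-1 : ℝ) 1, ‖V t x‖ ≤ ρ₁)
    (hWb : ∀ t, 0 ≤ t → t ≤ T → ∀ x ∈ Icc (-1 : ℝ) 1, ‖W t x‖ ≤ ρ₁) :
    ∀ t, 0 ≤ t → t ≤ T → ∀ x ∈ Icc (-1 : ℝ) 1, W t x = V t x := by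
  intro t₀ ht₀ ht₀T x₀ hx₀
  rcases ht₀.eq_or_lt with rfl | ht₀
  · rw [hV.initial _ hx₀, hW.initial _ hx₀]
  have hT : 0 < T := ht₀.trans_le ht₀T
  have hρ1 : 0 ≤ ρ₁ := (norm_nonneg _).trans (hVb t₀ ht₀.le ht₀T x₀ hx₀)
  obtain ⟨M₁, hM₁, H₁⟩ := hV.exists_isSmoothApprox hF
  obtain ⟨M₂, hM₂, H₂⟩ := hW.exists_isSmoothApprox hF
  obtain ⟨M, hM⟩ : ∃ M, M = max M₁ M₂ := ⟨_, rfl⟩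
  have hM0 : 0 ≤ M := by rw [hM]; exact le_max_of_le_left hM₁
  obtain ⟨C, hC⟩ : ∃ C, C = S.K * Real.exp ((6 * S.K ^ 2 * (M + 1) * S.K + 1) * T) *
        (8 * S.K + 6 * S.K ^ 2 * (M + 1)) + 2 := ⟨_, rfl⟩
  have hinterior : EqOn (fun p : ℝ × ℝ => W p.1 p.2) (fun p => V p.1 p.2)
      (Ioo 0 T ×ˢ Ioo (-1) 1) := by
    rintro ⟨t, x⟩ ⟨⟨t0, tT⟩, x0, x1⟩
    have key : ∀ η, 0 < η → 4 * η ≤ S.ρ → ‖W t x - V t x‖ ≤ C * η := by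
      intro η hη hηρ
      obtain ⟨δ₁, hδ₁, G₁⟩ := H₁ T η hη
      obtain ⟨δ₂, hδ₂, G₂⟩ := H₂ T η hη
      simp only at t0 tT x0 x1
      obtain ⟨δ, hδ, d1, d2, d3, d4, d5⟩ :
          ∃ δ > 0, δ ≤ δ₁ ∧ δ ≤ δ₂ ∧ δ ≤ t ∧ δ ≤ x + 1 ∧ δ ≤ 1 - x := by
        refine ⟨min (min δ₁ δ₂) (min t (min (x + 1) (1 - x))), ?_, by simp, by simp, by simp,
          by simp, by simp⟩
        simp only [gt_iff_lt, lt_min_iff]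
        exact ⟨⟨hδ₁, hδ₂⟩, t0, by linarith, by linarith⟩
      obtain ⟨V', hV'⟩ := G₁ δ hδ d1
      obtain ⟨W', hW'⟩ := G₂ δ hδ d2
      have hmem : (t, x) ∈ innerRectangle δ T :=
        ⟨⟨d3, tT.le⟩, ⟨by simp only; linarith, by simp only; linarith⟩⟩
      have hcl := innerRectangle_subset hδ hmem
      have h1 := S.norm_sub_le_of_isSmoothApprox hρ hρK hM0 hη.le hηρ hδ
        (fun p hp hpT => hVb p.1 hp.1 hpT p.2 hp.2) (fun p hp hpT => hWb p.1 hp.1 hpT p.2 hp.2)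
        (hV'.mono (hM ▸ le_max_left _ _)) (hW'.mono (hM ▸ le_max_right _ _))
        (fun y hy => by rw [hV.initial y hy, hW.initial y hy])
        (fun s hs hsT i => by
          have hsg : -(S.sg i : ℝ) ∈ Icc (-1 : ℝ) 1 := by
            rcases S.sg_cases i with e | e <;> simp [e]
          rw [S.L_inflow hV hs i ((hVb s hs hsT _ hsg).trans (by linarith)),
            S.L_inflow hW hs i ((hWb s hs hsT _ hsg).trans (by linarith))]) _ hmem
      have h2 := hV'.close _ hmem _ hcl tT.le (by simpa using hδ.le)
      have h3 := hW'.close _ hmem _ hcl tT.le (by simpa using hδ.le)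
      simp only at h2 h3
      calc ‖W t x - V t x‖ = ‖(W' (t, x) - V' (t, x)) - (W' (t, x) - W t x) +
            (V' (t, x) - V t x)‖ := by congr 1; abel
        _ ≤ _ := (norm_add_le _ _).trans (add_le_add ((norm_sub_le _ _).trans
            (add_le_add h1 h3)) h2)
        _ = C * η := by rw [hC]; ring
    have ht : Filter.Tendsto (fun η : ℝ => C * η) (𝓝[>] 0) (𝓝 (C * 0)) :=
      ((continuous_const.mul continuous_id).tendsto 0).mono_left nhdsWithin_le_nhds
    rw [mul_zero] at ht
    have h0 : ‖W t x - V t x‖ ≤ 0 := by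
      refine ge_of_tendsto ht ?_
      filter_upwards [Ioc_mem_nhdsGT (div_pos S.ρ_pos (by norm_num : (0 : ℝ) < 4))] with η hη
      exact key η hη.1 (by linarith [hη.2])
    exact sub_eq_zero.1 (norm_le_zero_iff.1 h0)
  have hsub : (Icc 0 T ×ˢ Icc (-1) 1 : Set (ℝ × ℝ)) ⊆ Ici 0 ×ˢ Icc (-1) 1 :=
    prod_mono Icc_subset_Ici_self Subset.rfl
  have := hinterior.of_subset_closure (hW.continuousOn.mono hsub) (hV.continuousOn.mono hsub)
    (prod_mono Ioo_subset_Icc_self Ioo_subset_Icc_self) (by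
      rw [closure_prod_eq, closure_Ioo hT.ne, closure_Ioo (by norm_num)])
  exact this (show (t₀, x₀) ∈ _ from ⟨⟨ht₀.le, ht₀T⟩, hx₀⟩)

/-- A solution with the same data as a small solution coincides with it. -/
theorem eq_of_isSolution (hF : ContDiff ℝ ∞ F) {V0 b : ℝ → Fin n → ℝ}
    {V W : ℝ → ℝ → Fin n → ℝ} (hV : IsSolution F Ubar N lam r V0 b V)
    (hW : IsSolution F Ubar N lam r V0 b W) {ρ₁ : ℝ} (hρ1 : 0 < ρ₁)
    (hρ : 4 * ρ₁ ≤ S.ρ) (hρK : 2 * S.K ^ 2 * ρ₁ ≤ 1)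
    (hVb : ∀ t, 0 ≤ t → ∀ x ∈ Icc (-1 : ℝ) 1, ‖V t x‖ ≤ ρ₁ / 2) :
    ∀ t, 0 ≤ t → ∀ x ∈ Icc (-1 : ℝ) 1, W t x = V t x := by
  have hVb' : ∀ t, 0 ≤ t → ∀ x ∈ Icc (-1 : ℝ) 1, ‖V t x‖ ≤ ρ₁ := fun t ht x hx =>
    (hVb t ht x hx).trans (by linarith)
  suffices hWb : ∀ t, 0 ≤ t → ∀ x ∈ Icc (-1 : ℝ) 1, ‖W t x‖ < ρ₁ from fun t ht x hx =>
    S.eq_of_isSolution_of_small hF hV hW hρ hρK (fun s hs _ => hVb' s hs)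
      (fun s hs _ y hy => (hWb s hs y hy).le) t ht le_rfl x hx
  intro t₀ ht₀ x₀ hx₀
  by_contra hcon
  push Not at hcon
  have hsub : (Icc 0 t₀ ×ˢ Icc (-1) 1 : Set (ℝ × ℝ)) ⊆ Ici 0 ×ˢ Icc (-1) 1 :=
    prod_mono Icc_subset_Ici_self Subset.rfl
  have hcpt : IsCompact ((Icc 0 t₀ ×ˢ Icc (-1) 1 : Set (ℝ × ℝ)) ∩
      (fun p : ℝ × ℝ => ‖W p.1 p.2‖) ⁻¹' Ici ρ₁) :=
    (isCompact_Icc.prod isCompact_Icc).of_isClosed_subset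
      ((hW.continuousOn.mono hsub).norm.preimage_isClosed_of_isClosed
        (isClosed_Icc.prod isClosed_Icc) isClosed_Ici) inter_subset_left
  -- The first time at which `W` reaches size `ρ₁`. Before it `W` is small and equals `V`;
  -- continuity in time carries the equality, hence the bound `ρ₁ / 2`, up to that time.
  obtain ⟨⟨t, x⟩, ⟨⟨ht, hx⟩, htx⟩, hmin⟩ := hcpt.exists_isMinOn
    ⟨(t₀, x₀), ⟨⟨ht₀, le_rfl⟩, hx₀⟩, hcon⟩ continuous_fst.continuousOn
  simp only at ht hx
  replace htx : ρ₁ ≤ ‖W t x‖ := htx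
  have hbefore : ∀ s, 0 ≤ s → s < t → ∀ y ∈ Icc (-1 : ℝ) 1, ‖W s y‖ ≤ ρ₁ := by
    intro s hs hst y hy
    by_contra h
    push Not at h
    have : t ≤ s := hmin (show (s, y) ∈ _ from ⟨⟨⟨hs, hst.le.trans ht.2⟩, hy⟩, h.le⟩)
    linarith
  have heq : EqOn (fun s => W s x) (fun s => V s x) (Ico 0 t) := fun s hs =>
    S.eq_of_isSolution_of_small hF hV hW hρ hρK (T := s) (fun s' hs' _ => hVb' s' hs')
      (fun s' hs' hss' => hbefore s' hs' (hss'.trans_lt hs.2)) s hs.1 le_rfl x hx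
  have hend : W t x = V t x := by
    rcases ht.1.eq_or_lt with h0 | h0
    · rw [← h0, hV.initial _ hx, hW.initial _ hx]
    · have hline : ContinuousOn (fun s : ℝ => (s, x)) (Icc 0 t) := by fun_prop
      have hmaps : MapsTo (fun s : ℝ => (s, x)) (Icc 0 t) (Ici 0 ×ˢ Icc (-1) 1) := fun s hs =>
        ⟨hs.1, hx⟩
      refine heq.of_subset_closure (hW.continuousOn.comp hline hmaps)
        (hV.continuousOn.comp hline hmaps) Ico_subset_Icc_self ?_ ⟨h0.le, le_rfl⟩
      rw [closure_Ico h0.ne]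
  rw [hend] at htx
  linarith [hVb t ht.1 x hx]

end CharSystem

/-! ### The time derivative at every time, and the solution norm -/

/-- The product of test functions in time and space is a test function in space-time. -/
theorem IsTestFunction.mul {ψ φ : ℝ → ℝ} (hψ : IsTestFunction (Ioi 0) ψ)
    (hφ : IsTestFunction spaceInterval φ) :
    IsTestFunction spaceTime fun p : ℝ × ℝ => ψ p.1 * φ p.2 := by
  obtain ⟨s1, c1, t1⟩ := hψ
  obtain ⟨s2, c2, t2⟩ := hφ
  have hts : tsupport (fun p : ℝ × ℝ => ψ p.1 * φ p.2) ⊆ tsupport ψ ×ˢ tsupport φ := by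
    refine closure_minimal (fun p hp => ?_) ((isClosed_tsupport ψ).prod (isClosed_tsupport φ))
    have := mul_ne_zero_iff.1 hp
    exact ⟨subset_tsupport ψ this.1, subset_tsupport φ this.2⟩
  exact ⟨(s1.comp contDiff_fst).mul (s2.comp contDiff_snd),
    HasCompactSupport.of_support_subset_isCompact (c1.prod c2) ((subset_tsupport _).trans hts),
    hts.trans (prod_mono t1 t2)⟩

theorem fderiv_mul_fst_snd {ψ φ : ℝ → ℝ} (hψ : Differentiable ℝ ψ) (hφ : Differentiable ℝ φ)
    (p : ℝ × ℝ) :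
    fderiv ℝ (fun p : ℝ × ℝ => ψ p.1 * φ p.2) p (1, 0) = fderiv ℝ ψ p.1 1 * φ p.2 ∧
    fderiv ℝ (fun p : ℝ × ℝ => ψ p.1 * φ p.2) p (0, 1) = ψ p.1 * fderiv ℝ φ p.2 1 := by
  have h1 : HasFDerivAt (fun p : ℝ × ℝ => ψ p.1) _ p :=
    (hψ p.1).hasFDerivAt.comp p hasFDerivAt_fst
  have h2 : HasFDerivAt (fun p : ℝ × ℝ => φ p.2) _ p :=
    (hφ p.2).hasFDerivAt.comp p hasFDerivAt_snd
  have h : HasFDerivAt (fun p : ℝ × ℝ => ψ p.1 * φ p.2) _ p := h1.mul h2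
  rw [h.fderiv]
  constructor <;> simp [mul_comm]

/-- A continuous function on the half-line with a continuous bounded weak derivative is
differentiable. -/
theorem hasDerivWithinAt_of_weak {n : ℕ} {G H : ℝ → Fin n → ℝ} (hG : Continuous G)
    (hH : Continuous H) {B : ℝ} (hB : ∀ t, ‖H t‖ ≤ B)
    (hw : ∀ ψ : ℝ → ℝ, IsTestFunction (Ioi 0) ψ →
      ∫ t in Ioi 0, fderiv ℝ ψ t 1 • G t = -∫ t in Ioi 0, ψ t • H t) {t : ℝ} (ht : 0 ≤ t) :
    HasDerivWithinAt G (H t) (Ici 0) t := by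
  -- `G - P` has zero weak derivative and is therefore constant, so `G` inherits the classical
  -- derivative of the primitive `P`.
  set P : ℝ → Fin n → ℝ := fun t => ∫ s in (0 : ℝ)..t, H s with hP
  have hPd : ∀ t, HasDerivAt P (H t) t := fun t =>
    intervalIntegral.integral_hasDerivAt_right (hH.intervalIntegrable _ _)
      hH.stronglyMeasurable.stronglyMeasurableAtFilter hH.continuousAt
  have hPc : Continuous P := continuous_iff_continuousAt.2 fun t => (hPd t).continuousAt
  have hPlip : LipschitzWith B.toNNReal P := by
    refine lipschitzWith_of_nnnorm_deriv_le (fun t => (hPd t).differentiableAt) fun t => ?_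
    rw [(hPd t).deriv, ← NNReal.coe_le_coe, coe_nnnorm]
    exact (hB t).trans (Real.le_coe_toNNReal B)
  have hPw : (fun t => lineDeriv ℝ P t 1) = H := by
    ext1 t
    have : HasLineDerivAt ℝ P (H t) t 1 := by
      have := (hPd t).hasFDerivAt.hasLineDerivAt 1
      simpa using this
    exact this.lineDeriv
  -- Bounded intervals are used because `norm_sub_le_of_isWeakDeriv` asks for a bound on `G - P`.
  have hconst : ∀ T, 0 < T → ∀ x ∈ Ioo 0 T, ∀ y ∈ Ioo 0 T, G x - P x = G y - P y := by
    intro T hT x hx y hy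
    have hweak : IsWeakDeriv (Ioo 0 T) 1 (fun t => G t - P t) fun _ => 0 := by
      refine ⟨(hG.sub hPc).locallyIntegrable.locallyIntegrableOn _,
        locallyIntegrable_zero.locallyIntegrableOn _, fun ψ hψ => ?_⟩
      have hz : ∀ t ∉ Ioo 0 T, ψ t = 0 := fun t ht => by
        by_contra h
        exact ht (hψ.2.2 (subset_tsupport ψ h))
      have hz' : ∀ t ∉ Ioo 0 T, fderiv ℝ ψ t = 0 := fun t ht =>
        Function.notMem_support.1 fun h => ht (hψ.2.2 (support_fderiv_subset ℝ h))
      have hψ' : IsTestFunction (Ioi 0) ψ := ⟨hψ.1, hψ.2.1, hψ.2.2.trans Ioo_subset_Ioi_self⟩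
      have e1 := hw ψ hψ'
      have e2 := (isWeakDeriv_lineDeriv hPlip (Ioi 0) 1).2.2 ψ hψ'
      have hPw' : ∀ t, lineDeriv ℝ P t 1 = H t := congrFun hPw
      simp only [hPw'] at e2
      have hc : Continuous fun t => fderiv ℝ ψ t 1 :=
        (hψ.1.continuous_fderiv (by simp)).clm_apply continuous_const
      have hcs : HasCompactSupport fun t => fderiv ℝ ψ t 1 :=
        (hψ.2.1.fderiv (𝕜 := ℝ)).comp_left (g := fun L : ℝ →L[ℝ] ℝ => L 1) (by simp)
      have i1 : Integrable fun t => fderiv ℝ ψ t 1 • G t :=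
        (hc.smul hG).integrable_of_hasCompactSupport hcs.smul_right
      have i2 : Integrable fun t => fderiv ℝ ψ t 1 • P t :=
        (hc.smul hPc).integrable_of_hasCompactSupport hcs.smul_right
      have e3 : ∫ t in Ioo 0 T, fderiv ℝ ψ t 1 • (G t - P t) =
          ∫ t in Ioi 0, fderiv ℝ ψ t 1 • (G t - P t) := by
        rw [setIntegral_eq_integral_of_forall_compl_eq_zero fun t ht => by simp [hz' t ht],
          setIntegral_eq_integral_of_forall_compl_eq_zero fun t ht => by
            simp [hz' t fun h => ht h.1]]
      rw [e3]
      simp only [smul_sub, smul_zero, integral_zero, neg_zero]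
      rw [integral_sub i1.restrict i2.restrict, e1, e2, sub_self]
    obtain ⟨A, hA⟩ := (isCompact_Icc (a := 0) (b := T)).exists_bound_of_continuousOn
      (hG.sub hPc).continuousOn
    have := norm_sub_le_of_isWeakDeriv isOpen_Ioo (convex_Ioo 0 T) (hG.sub hPc).continuousOn
      (A := A) (B := 0) ((ae_restrict_iff' measurableSet_Ioo).2
        (Filter.Eventually.of_forall fun t ht => hA t (Ioo_subset_Icc_self ht))) le_rfl
      (Filter.Eventually.of_forall fun _ => by simp) hweak x hx y hy
    rw [zero_mul] at this
    exact sub_eq_zero.1 (norm_le_zero_iff.1 this)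
  have heq : EqOn (fun t => G t - P t) (fun _ => G 1 - P 1) (Ici 0) := by
    refine EqOn.of_subset_closure (s := Ioi 0) (fun t ht => ?_) (hG.sub hPc).continuousOn
      continuousOn_const Ioi_subset_Ici_self (by rw [closure_Ioi])
    have ht : 0 < t := ht
    exact hconst (t + 2) (by linarith) t ⟨ht, by linarith⟩ 1 ⟨one_pos, by linarith⟩
  have heq' : ∀ s ∈ Ici (0 : ℝ), G s = P s + (G 1 - P 1) := fun s hs => by
    have : G s - P s = G 1 - P 1 := heq hs
    rw [← this]; abel
  exact ((hPd t).add_const _).hasDerivWithinAt.congr heq' (heq' t ht)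

namespace CharSystem

variable {n : ℕ} {F : (Fin n → ℝ) → (Fin n → ℝ)} {Ubar : Fin n → ℝ}
    {N : Set (Fin n → ℝ)} {lam : Fin n → (Fin n → ℝ) → ℝ}
    {r : Fin n → (Fin n → ℝ) → (Fin n → ℝ)} (S : CharSystem F Ubar N lam r)

theorem norm_flux_sub_le (hF : ContDiff ℝ ∞ F) {v w : Fin n → ℝ} (hv : ‖v‖ ≤ S.ρ)
    (hw : ‖w‖ ≤ S.ρ) : ‖F (Ubar + v) - F (Ubar + w)‖ ≤ S.K * ‖v - w‖ := by
  have hd : ∀ x, HasFDerivAt (fun v => F (Ubar + v)) (fderiv ℝ F (Ubar + x)) x := fun x =>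
    ((hF.differentiable (by simp)) (Ubar + x)).hasFDerivAt.comp x ((hasFDerivAt_id x).const_add Ubar)
  exact (convex_closedBall (0 : Fin n → ℝ) S.ρ).norm_image_sub_le_of_norm_hasFDerivWithin_le
    (fun x _ => (hd x).hasFDerivWithinAt)
    (fun x hx => S.norm_A x (by simpa using hx)) (by simpa using hw) (by simpa using hv)

/-- Lipschitz functions satisfying the system at their points of differentiability. -/
structure IsLipschitzSolution (V : ℝ × ℝ → Fin n → ℝ) (Λ : NNReal) : Prop where
  small : ∀ p, ‖V p‖ ≤ S.ρ
  lip : LipschitzWith Λ V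
  equation : ∀ p ∈ spaceTime, ∀ D : ℝ × ℝ →L[ℝ] Fin n → ℝ, HasFDerivAt V D p →
    D (1, 0) + fderiv ℝ F (Ubar + V p) (D (0, 1)) = 0

namespace IsLipschitzSolution

variable {S} {V : ℝ × ℝ → Fin n → ℝ} {Λ : NNReal} (hV : S.IsLipschitzSolution V Λ)
include hV

theorem ae_equation : ∀ᵐ p ∂volume.restrict spaceTime,
    lineDeriv ℝ V p (1, 0) + fderiv ℝ F (Ubar + V p) (lineDeriv ℝ V p (0, 1)) = 0 := by
  filter_upwards [ae_restrict_of_ae (hV.lip.ae_differentiableAt (μ := volume)),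
    ae_restrict_mem isOpen_spaceTime.measurableSet] with p hp hps
  rw [hp.lineDeriv_eq_fderiv, hp.lineDeriv_eq_fderiv]
  exact hV.equation p hps _ hp.hasFDerivAt

theorem lipschitzWith_flux (hF : ContDiff ℝ ∞ F) :
    LipschitzWith (S.K.toNNReal * Λ) fun p => F (Ubar + V p) := by
  refine LipschitzWith.of_dist_le_mul fun p q => ?_
  rw [dist_eq_norm, NNReal.coe_mul, Real.coe_toNNReal _ S.K_pos.le, mul_assoc]
  refine (S.norm_flux_sub_le hF (hV.small p) (hV.small q)).trans ?_
  rw [← dist_eq_norm]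
  exact mul_le_mul_of_nonneg_left (hV.lip.dist_le_mul p q) S.K_pos.le

/-- The fact that `A` is the gradient of `F` matters here: in divergence form the space derivative
can be moved onto a test function. -/
theorem ae_conservation (hF : ContDiff ℝ ∞ F) : ∀ᵐ p ∂volume.restrict spaceTime,
    lineDeriv ℝ V p (1, 0) + lineDeriv ℝ (fun p => F (Ubar + V p)) p (0, 1) = 0 := by
  filter_upwards [ae_restrict_of_ae (hV.lip.ae_differentiableAt (μ := volume)), hV.ae_equation]
    with p hp heq
  have h : HasFDerivAt (fun p => F (Ubar + V p)) _ p :=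
    ((hF.differentiable (by simp)) (Ubar + V p)).hasFDerivAt.comp p (hp.hasFDerivAt.const_add Ubar)
  rw [h.differentiableAt.lineDeriv_eq_fderiv, h.fderiv]
  rw [hp.lineDeriv_eq_fderiv] at heq ⊢
  rw [hp.lineDeriv_eq_fderiv] at heq
  exact heq

/-- Testing with products `ψ(t) φ(x)` shows that `∫ φ V` has weak time derivative `∫ φ' F(Ubar +
V)`. The latter is continuous in `t`, so the derivative is classical at every time, from the right
at `0`. -/
theorem isTimeDerivAt (hF : ContDiff ℝ ∞ F) {t : ℝ} (ht : 0 ≤ t) :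
    IsTimeDerivAt (fun t x => V (t, x)) t
      fun x => -lineDeriv ℝ (fun x => F (Ubar + V (t, x))) x 1 := by
  have hΦ := hV.lipschitzWith_flux hF
  have hΦt : LipschitzWith (S.K.toNNReal * Λ) fun x => F (Ubar + V (t, x)) := by
    have := hΦ.comp (LipschitzWith.prodMk_left t)
    rwa [mul_one] at this
  have hw := isWeakDeriv_lineDeriv hΦt spaceInterval 1
  refine ⟨hw.2.1.neg, fun φ hφ => ?_⟩
  have hφc := hφ.1.continuous
  have hφ' : Continuous fun x => fderiv ℝ φ x 1 :=
    (hφ.1.continuous_fderiv (by simp)).clm_apply continuous_const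
  have hφcs : HasCompactSupport fun x => fderiv ℝ φ x 1 :=
    (hφ.2.1.fderiv (𝕜 := ℝ)).comp_left (g := fun L : ℝ →L[ℝ] ℝ => L 1) (by simp)
  have e : ∫ x in spaceInterval, φ x • -lineDeriv ℝ (fun x => F (Ubar + V (t, x))) x 1 =
      ∫ x in spaceInterval, fderiv ℝ φ x 1 • F (Ubar + V (t, x)) := by
    rw [hw.2.2 φ hφ]; simp [integral_neg]
  rw [e]
  have hcont : ∀ {f : ℝ → ℝ} {U : ℝ × ℝ → Fin n → ℝ}, Continuous f → Continuous U →
      Continuous fun s => ∫ x in spaceInterval, f x • U (s, x) := by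
    intro f U hf hU
    simp only [spaceInterval, ← integral_Icc_eq_integral_Ioo]
    exact continuous_parametric_integral_of_continuous
      (f := fun s x => f x • U (s, x)) (by
        exact (hf.comp continuous_snd).smul hU) isCompact_Icc
  obtain ⟨B₁, hB₁⟩ := hφcs.exists_bound_of_continuous hφ'
  have hB₁0 : 0 ≤ B₁ := (norm_nonneg _).trans (hB₁ 0)
  have hB₂ : ∀ p, ‖F (Ubar + V p)‖ ≤ ‖F (Ubar + 0)‖ + S.K * S.ρ := fun p => by
    have h1 := S.norm_flux_sub_le hF (hV.small p) (w := 0) (by simpa using S.ρ_pos.le)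
    rw [sub_zero] at h1
    have h2 := norm_add_le (F (Ubar + V p) - F (Ubar + 0)) (F (Ubar + 0))
    rw [sub_add_cancel] at h2
    have h3 := mul_le_mul_of_nonneg_left (hV.small p) S.K_pos.le
    linarith
  refine hasDerivWithinAt_of_weak (G := fun s => ∫ x in spaceInterval, φ x • V (s, x))
    (H := fun s => ∫ x in spaceInterval, fderiv ℝ φ x 1 • F (Ubar + V (s, x)))
    (B := B₁ * (‖F (Ubar + 0)‖ + S.K * S.ρ) * volume.real spaceInterval)
    (hcont hφc hV.lip.continuous) (hcont hφ' hΦ.continuous) (fun s => ?_) (fun ψ hψ => ?_) ht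
  · refine norm_setIntegral_le_of_norm_le_const (by simp [spaceInterval]) fun x _ => ?_
    rw [norm_smul]
    exact mul_le_mul (hB₁ x) (hB₂ _) (norm_nonneg _) hB₁0
  · have hψd := hψ.1.differentiable (by simp)
    have hφd := hφ.1.differentiable (by simp)
    have hχ := hψ.mul hφ
    have e1 := (isWeakDeriv_lineDeriv hV.lip spaceTime (1, 0)).2.2 _ hχ
    have e2 := (isWeakDeriv_lineDeriv hΦ spaceTime (0, 1)).2.2 _ hχ
    have e3 : ∫ p in spaceTime, (ψ p.1 * φ p.2) • lineDeriv ℝ V p (1, 0) =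
        -∫ p in spaceTime, (ψ p.1 * φ p.2) • lineDeriv ℝ (fun p => F (Ubar + V p)) p (0, 1) := by
      rw [← integral_neg]
      refine integral_congr_ae ?_
      filter_upwards [hV.ae_conservation hF] with p hp
      rw [eq_neg_of_add_eq_zero_left hp, smul_neg]
    rw [e3, ← e2] at e1
    have hint : ∀ (v : ℝ × ℝ) {U : ℝ × ℝ → Fin n → ℝ}, Continuous U → Integrable fun p : ℝ × ℝ =>
        fderiv ℝ (fun p : ℝ × ℝ => ψ p.1 * φ p.2) p v • U p := by
      intro v U hU
      have hc : Continuous fun p : ℝ × ℝ => fderiv ℝ (fun p : ℝ × ℝ => ψ p.1 * φ p.2) p v :=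
        (hχ.1.continuous_fderiv (by simp)).clm_apply continuous_const
      refine (hc.smul hU).integrable_of_hasCompactSupport (HasCompactSupport.smul_right ?_)
      exact (hχ.2.1.fderiv (𝕜 := ℝ)).comp_left (g := fun L : ℝ × ℝ →L[ℝ] ℝ => L v) (by simp)
    have i1 := hint (1, 0) hV.lip.continuous
    have i2 := hint (0, 1) hΦ.continuous
    simp only [(fderiv_mul_fst_snd hψd hφd _).1] at e1 i1
    simp only [(fderiv_mul_fst_snd hψd hφd _).2] at e1 i2
    rw [Measure.volume_eq_prod] at e1 i1 i2
    rw [spaceTime, setIntegral_prod _ i1.integrableOn, setIntegral_prod _ i2.integrableOn] at e1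
    simp only [mul_smul, integral_smul] at e1 ⊢
    exact e1

theorem timeDerivNorm_le (hF : ContDiff ℝ ∞ F) {t : ℝ} (ht : 0 ≤ t) :
    timeDerivNorm (fun t x => V (t, x)) t ≤ ENNReal.ofReal (S.K * Λ) := by
  refine (iInf₂_le _ (hV.isTimeDerivAt hF ht)).trans (LinfNorm_le_of_norm_le ?_)
  refine Filter.Eventually.of_forall fun x => ?_
  have hΦt : LipschitzWith (S.K.toNNReal * Λ) fun x => F (Ubar + V (t, x)) := by
    have := (hV.lipschitzWith_flux hF).comp (LipschitzWith.prodMk_left t)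
    rwa [mul_one] at this
  have := norm_lineDeriv_le_of_lipschitz ℝ (x₀ := x) (v := 1) hΦt
  rw [norm_neg]
  simpa [Real.coe_toNNReal _ S.K_pos.le] using this

/-- The three copies of `A + Λ` come from the norm in space and the traces at the two endpoints; `K
* Λ` bounds the time derivative. -/
theorem solutionNorm_le (hF : ContDiff ℝ ∞ F) {A : ℝ} (hA : 0 ≤ A) (hVA : ∀ p, ‖V p‖ ≤ A) :
    solutionNorm (fun t x => V (t, x)) ≤ ENNReal.ofReal (3 * (A + Λ) + S.K * Λ) := by
  have hK := S.K_pos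
  have hx : ∀ t, W1infNorm spaceInterval (fun x => V (t, x)) ≤ ENNReal.ofReal (A + Λ) := by
    intro t
    have h := hV.lip.comp (LipschitzWith.prodMk_left t)
    rw [mul_one] at h
    rw [ENNReal.ofReal_add hA Λ.coe_nonneg]
    exact W1infNorm_le_of_lipschitz _ (fun x => hVA (t, x)) h
  have ht : ∀ x, W1infNorm (Ioi 0) (fun t => V (t, x)) ≤ ENNReal.ofReal (A + Λ) := by
    intro x
    have h := hV.lip.comp (LipschitzWith.prodMk_right x)
    rw [mul_one] at h
    rw [ENNReal.ofReal_add hA Λ.coe_nonneg]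
    exact W1infNorm_le_of_lipschitz _ (fun t => hVA (t, x)) h
  have hΛ := Λ.coe_nonneg
  have e : ENNReal.ofReal (3 * (A + Λ) + S.K * Λ) =
      (ENNReal.ofReal (A + Λ) + ENNReal.ofReal (S.K * Λ)) +
        (ENNReal.ofReal (A + Λ) + ENNReal.ofReal (A + Λ)) := by
    rw [← ENNReal.ofReal_add (by positivity) (by positivity),
      ← ENNReal.ofReal_add (by positivity) (by positivity),
      ← ENNReal.ofReal_add (by positivity) (by positivity)]
    congr 1; ring
  rw [e]
  refine add_le_add (iSup₂_le fun t h0 => ?_) (add_le_add (ht _) (ht _))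
  exact add_le_add (hx t) (hV.timeDerivNorm_le hF h0)

theorem isSolution {V0 b : ℝ → Fin n → ℝ} (hinit : ∀ x ∈ Icc (-1 : ℝ) 1, V (0, x) = V0 x)
    (hbdry : ∀ t, 0 ≤ t → ∀ i, S.L (V (t, -S.sg i)) (V (t, -S.sg i)) i = b t i) :
    IsSolution F Ubar N lam r V0 b fun t x => V (t, x) where
  continuousOn := hV.lip.continuous.continuousOn
  mem_nhd t _ x _ := S.mem_N _ (hV.small _)
  bounded := (LinfNorm_le_of_norm_le (Filter.Eventually.of_forall fun p =>
    hV.small p)).trans_lt ENNReal.ofReal_lt_top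
  equation := ⟨fun p => lineDeriv ℝ V p (1, 0), fun p => lineDeriv ℝ V p (0, 1),
    isWeakDeriv_lineDeriv hV.lip _ _, isWeakDeriv_lineDeriv hV.lip _ _,
    (LinfNorm_lineDeriv_le hV.lip _ _).trans_lt ENNReal.ofReal_lt_top,
    (LinfNorm_lineDeriv_le hV.lip _ _).trans_lt ENNReal.ofReal_lt_top, hV.ae_equation⟩
  initial := hinit
  inflow t ht i x hx := by
    rw [(S.incoming i x).1 hx, S.charUnknown_eq _ (hV.small _)]
    exact hbdry t ht i

end IsLipschitzSolution

/-- Sufficiently small positive numbers satisfy finitely many linear smallness conditions. -/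
theorem exists_pos_forall_mul_le {a b : ℝ} (ha : 0 ≤ a) (hb : 0 < b) :
    ∃ ε > 0, ∀ δ, 0 ≤ δ → δ ≤ ε → a * δ ≤ b := by
  refine ⟨b / (a + 1), by positivity, fun δ _ h => ?_⟩
  rw [le_div_iff₀ (by positivity)] at h
  linarith

end CharSystem

end

/-! ### Choice of the constants and conclusion -/

theorem theorem1p1 {n : ℕ} (F : (Fin n → ℝ) → (Fin n → ℝ)) (hF : ContDiff ℝ ∞ F)
    (Ubar : Fin n → ℝ) (N : Set (Fin n → ℝ)) (lam : Fin n → (Fin n → ℝ) → ℝ)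
    (r : Fin n → (Fin n → ℝ) → (Fin n → ℝ))
    (hdiag : SmoothlyDiagonalizable F Ubar N lam r)
    (hnonchar : ∀ i, lam i Ubar ≠ 0) :
    ∃ ε₀ : ℝ, 0 < ε₀ ∧ ∃ C : ℝ, 0 < C ∧
      ∀ V0 b : ℝ → Fin n → ℝ,
        ContinuousOn V0 (Icc (-1) 1) → ContinuousOn b (Ici 0) →
        (∀ i, ∀ x ∈ incomingSet (lam i Ubar), charUnknown r Ubar (V0 x) i = b 0 i) →
        W1infNorm spaceInterval V0 + W1infNorm (Ioi 0) b ≤ ENNReal.ofReal ε₀ →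
        ∃ V : ℝ → ℝ → Fin n → ℝ,
          IsSolution F Ubar N lam r V0 b V ∧
          solutionNorm V ≤
            ENNReal.ofReal C * (W1infNorm spaceInterval V0 + W1infNorm (Ioi 0) b) ∧
          ∀ W : ℝ → ℝ → Fin n → ℝ, IsSolution F Ubar N lam r V0 b W →
            ∀ t, 0 ≤ t → ∀ x ∈ Icc (-1 : ℝ) 1, W t x = V t x := by
  obtain ⟨S⟩ := exists_charSystem hF hdiag hnonchar
  have hK := S.K_pos
  have hc := S.c_pos
  have hρ := S.ρ_pos
  have hl := S.lipConst_pos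
  obtain ⟨ρ₁, hρ₁, hρ₁a, hρ₁b⟩ : ∃ ρ₁ > 0, 4 * ρ₁ ≤ S.ρ ∧ 2 * S.K ^ 2 * ρ₁ ≤ 1 := by
    refine ⟨min (S.ρ / 4) (1 / (2 * S.K ^ 2)), by positivity, ?_, ?_⟩
    · have : min (S.ρ / 4) (1 / (2 * S.K ^ 2)) ≤ S.ρ / 4 := min_le_left _ _
      linarith
    · have : min (S.ρ / 4) (1 / (2 * S.K ^ 2)) ≤ 1 / (2 * S.K ^ 2) := min_le_right _ _
      rw [le_div_iff₀ (by positivity)] at this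
      linarith
  obtain ⟨ε₁, hε₁, h₁⟩ := CharSystem.exists_pos_forall_mul_le
    (a := 8 * S.K * S.K ^ 2) (b := S.ρ) (by positivity) hρ
  obtain ⟨ε₂, hε₂, h₂⟩ := CharSystem.exists_pos_forall_mul_le
    (a := 32 * S.K ^ 3 * S.K ^ 2) (b := 1) (by positivity) one_pos
  obtain ⟨ε₃, hε₃, h₃⟩ := CharSystem.exists_pos_forall_mul_le
    (a := (12 * S.K ^ 3 * (8 * S.K / S.c) + 32 * S.K ^ 4) * S.K ^ 2) (b := S.c) (by positivity) hc
  obtain ⟨ε₄, hε₄, h₄⟩ := CharSystem.exists_pos_forall_mul_le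
    (a := 4 * S.K * S.K ^ 2) (b := ρ₁ / 2) (by positivity) (by positivity)
  -- `ε₁`, `ε₂`, `ε₃` serve the scheme, `ε₄` gives the bound `ρ₁ / 2` used for uniqueness, and `ρ`
  -- keeps the initial data in the ball. `C` is the bound of `solutionNorm_le` with `A` and `Λ`
  -- linear in the size `δ` of the data.
  refine ⟨min (min ε₁ ε₂) (min (min ε₃ ε₄) S.ρ), by positivity,
    3 * (4 * S.K * S.K ^ 2 + S.lipConst) + S.K * S.lipConst, by positivity, ?_⟩
  intro V0 b hV0 hb hcompat hsmall
  have htop : W1infNorm spaceInterval V0 + W1infNorm (Ioi 0) b ≠ ⊤ :=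
    (hsmall.trans_lt ENNReal.ofReal_lt_top).ne
  obtain ⟨δ, hδ0, hδ⟩ : ∃ δ : ℝ, 0 ≤ δ ∧
      W1infNorm spaceInterval V0 + W1infNorm (Ioi 0) b = ENNReal.ofReal δ :=
    ⟨_, ENNReal.toReal_nonneg, (ENNReal.ofReal_toReal htop).symm⟩
  rw [hδ, ENNReal.ofReal_le_ofReal_iff (by positivity)] at hsmall
  simp only [le_min_iff] at hsmall
  obtain ⟨⟨s₁, s₂⟩, ⟨s₃, s₄⟩, s₅⟩ := hsmall
  have hI : closure spaceInterval = Icc (-1) 1 := closure_Ioo (by norm_num)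
  have hR : closure (Ioi (0 : ℝ)) = Ici 0 := closure_Ioi 0
  obtain ⟨n0, l0⟩ := norm_le_and_lipschitz_of_W1infNorm_le (J := spaceInterval) isOpen_Ioo
    (convex_Ioo _ _) (by rwa [hI]) hδ0 (le_self_add.trans_eq hδ)
  obtain ⟨nb, lb⟩ := norm_le_and_lipschitz_of_W1infNorm_le (J := Ioi 0) isOpen_Ioi
    (convex_Ioi _) (by rwa [hR]) hδ0 (le_add_self.trans_eq hδ)
  rw [hI] at n0 l0
  rw [hR] at nb lb
  have hd : S.SmallData δ V0 b := by
    refine ⟨hδ0, ?_, ?_, ?_, n0, l0, nb, lb, fun i => ?_⟩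
    · rw [← mul_assoc]; exact h₁ δ hδ0 s₁
    · rw [← mul_assoc]; exact h₂ δ hδ0 s₂
    · rw [← mul_assoc]; exact h₃ δ hδ0 s₃
    · have hmem : -(S.sg i : ℝ) ∈ Icc (-1 : ℝ) 1 := by
        rcases S.sg_cases i with e | e <;> simp [e]
      rw [← S.charUnknown_eq _ ((n0 _ hmem).trans s₅)]
      exact hcompat i _ ((S.incoming i _).2 rfl)
  obtain ⟨V, hVb, hVl, hVi, hVbd, hVe⟩ := S.exists_lipschitz_solution hd
  have hA : 4 * S.K * (S.K ^ 2 * δ) ≤ ρ₁ / 2 := by rw [← mul_assoc]; exact h₄ δ hδ0 s₄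
  have hΛ0 : 0 ≤ S.lipConst * δ := by positivity
  have hsol : S.IsLipschitzSolution V (S.lipConst * δ).toNNReal := by
    refine ⟨fun p => (hVb p).trans (by linarith), LipschitzWith.of_dist_le_mul fun p q => ?_, hVe⟩
    rw [dist_eq_norm, Real.coe_toNNReal _ hΛ0]
    exact hVl p q
  have hV := hsol.isSolution hVi hVbd
  refine ⟨_, hV, ?_, fun W hW => S.eq_of_isSolution hF hV hW hρ₁ hρ₁a hρ₁b
    fun t _ x _ => (hVb _).trans hA⟩
  rw [hδ, ← ENNReal.ofReal_mul (by positivity)]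
  refine (hsol.solutionNorm_le hF (by positivity) hVb).trans (ENNReal.ofReal_le_ofReal ?_)
  rw [Real.coe_toNNReal _ hΛ0]
  exact le_of_eq (by ring)
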